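/- Fix $\lambda\in[0,1]$ and put $\rho_1=\lambda/(1+\lambda)$, $\rho_2=1/(1+\lambda)$. A $(\rho_1,\rho_2)$-rectangular probability space is a unital complex $*$-algebra $\mathcal A$ with self-adjoint projectors $p_1,p_2$, $p_1p_2=p_2p_1=0$, $p_1+p_2=1$, and linear functionals $\varphi_k$ on $p_k\mathcal A p_k$ with $\varphi_k(p_k)=1$, $\varphi_k(xy)=\varphi_k(yx)$ for $x,y\in p_k\mathcal Ap_k$ ($k=1,2$), and $\rho_1\varphi_1(xy)=\rho_2\varphi_2(yx)$ for $x\in p_1\mathcal Ap_2$, $y\in p_2\mathcal Ap_1$. Let $\mathcal D=\mathbb Cp_1+\mathbb Cp_2$ and $E(x)=\varphi_1(p_1xp_1)p_1+\varphi_2(p_2xp_2)p_2$. Elements $a_1,a_2$ are free with amalgamation over $\mathcal D$ if they belong respectively to $*$-subalgebras $\mathcal B_1,\mathcal B_2\supseteq\mathcal D$ such that $E(x_1\cdots x_m)=0$ whenever $m\ge1$, $x_j\in\mathcal B_{i_j}$, $E(x_j)=0$ for all $j$, and $i_j\ne i_{j+1}$ for $1\le j<m$. For compactly supported symmetric probability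 measures $\mu_1,\mu_2$ on $\mathbb R$, $\mu_1\boxplus_\lambda\mu_2$ denotes the compactly supported symmetric probability measure whose $2k$-th moment is $\varphi_1\big(((a_1+a_2)(a_1+a_2)^*)^k\big)$ for all $k\ge0$, where $a_1,a_2\in p_1\mathcal Ap_2$ are free with amalgamation over $\mathcal D$ in a $(\rho_1,\rho_2)$-rectangular probability space and $\varphi_1((a_ia_i^*)^k)$ is the $2k$-th moment of $\mu_i$ for all $k\geq 0$, $i=1,2$ (such $a_1,a_2$ exist, and the result does not depend on their choice). For a symmetric probability measure $\mu$ on $\mathbb R$ let $G_\mu(z)=\int\frac{d\mu(t)}{z-t}$ and, for $z\in\mathbb C\setminus[0,\infty)$, $$H_\mu(z)=\lambda\, G_\mu\!\left(\tfrac1{\sqrt z}\right)^2+(1-\lambda)\sqrt z\,G_\mu\!\left(\tfrac1{\sqrt z}\right),$$ where $\sqrt{\cdot}$ is analytic on $\mathbb C\setminus[0,\infty)$ with $\sqrt{-1}=i$. With $\arg z\in[0,2\pi)$, let $\Delta_{\alpha,\beta}=\{z\neq 0:|\arg z-\pi|<\alpha,\ |z|<\beta\}$. Let $H_\mu^{-1}$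 be the inverse of $H_\mu$ near $0$ in sectors: for every $\alpha\in(0,\pi)$ it is analytic on $\Delta_{\alpha,\beta}$ for some $\beta>0$, $H_\mu^{-1}(z)/z\to1$ as $z\to0$ with $|\arg z-\pi|<\alpha$, and $H_\mu\circ H_\mu^{-1}=H_\mu^{-1}\circ H_\mu=\mathrm{id}$ on $\Delta_{\alpha,\beta}$ for some $\beta>0$. The rectangular $R$-transform is $C_\mu(z)=U\big(z/H_\mu^{-1}(z)-1\big)$, where $U(z)=\frac{-\lambda-1+[(\lambda+1)^2+4\lambda z]^{1/2}}{2\lambda}$ with the principal square root ($U(z)=z$ if $\lambda=0$). **Theorem.** The operation $\boxplus_\lambda$ on compactly supported symmetric probability measures extends in a unique way to a commutative, associative and (jointly) continuous, for weak convergence, binary operation on the set of all symmetric probability measures on $\mathbb R$. Moreover, for every symmetric probability measure $\mu$ an inverse $H_\mu^{-1}$ as above exists, so that $C_\mu$ is defined, and for all symmetric probability measures $\mu,\nu$, $$C_{\mu\boxplus_\lambda\nu}=C_\mu+C_\nu,$$ in the sense that for every $\alpha\in(0,\pi)$ there is $\beta>0$ such that the equality holds on $\Delta_{\alpha,\beta}$.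 -/

import Mathlib

open MeasureTheory Set Filter Topology

noncomputable section

/-! ### Rectangular probability spaces and freeness with amalgamation -/

/-- A `(ρ₁, ρ₂)`-rectangular probability space on the unital complex `*`-algebra `A`:
orthogonal self-adjoint projectors `p₁`, `p₂` with sum `1`, and normalised tracial functionals
`φ₁`, `φ₂` on the corners `p₁ A p₁`, `p₂ A p₂`, subject to `ρ₁ φ₁ (x y) = ρ₂ φ₂ (y x)` for
`x ∈ p₁ A p₂`, `y ∈ p₂ A p₁`.

The functional `φₖ` on the corner `pₖ A pₖ` is represented by its canonical extension
`x ↦ φₖ (pₖ x pₖ)` to `A` (fields `corner₁`, `corner₂`). The projectors are nonzero because of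
`unit₁`, `unit₂`. -/
structure RectProbSpace (ρ₁ ρ₂ : ℝ) (A : Type*) [Ring A] [StarRing A] [Algebra ℂ A]
    [StarModule ℂ A] where
  p₁ : A
  p₂ : A
  φ₁ : A →ₗ[ℂ] ℂ
  φ₂ : A →ₗ[ℂ] ℂ
  proj₁ : IsStarProjection p₁
  proj₂ : IsStarProjection p₂
  orth₁₂ : p₁ * p₂ = 0
  orth₂₁ : p₂ * p₁ = 0
  add_eq_one : p₁ + p₂ = 1
  corner₁ : ∀ x, φ₁ x = φ₁ (p₁ * x * p₁)
  corner₂ : ∀ x, φ₂ x = φ₂ (p₂ * x * p₂)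
  unit₁ : φ₁ p₁ = 1
  unit₂ : φ₂ p₂ = 1
  trace₁ : ∀ x y, p₁ * x * p₁ = x → p₁ * y * p₁ = y → φ₁ (x * y) = φ₁ (y * x)
  trace₂ : ∀ x y, p₂ * x * p₂ = x → p₂ * y * p₂ = y → φ₂ (x * y) = φ₂ (y * x)
  trace₁₂ : ∀ x y, p₁ * x * p₂ = x → p₂ * y * p₁ = y →
    (ρ₁ : ℂ) * φ₁ (x * y) = (ρ₂ : ℂ) * φ₂ (y * x)

namespace RectProbSpace

variable {ρ₁ ρ₂ : ℝ} {A : Type*} [Ring A] [StarRing A] [Algebra ℂ A] [StarModule ℂ A]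

/-- The conditional expectation `E(x) = φ₁(p₁ x p₁) p₁ + φ₂(p₂ x p₂) p₂` onto the span `𝒟` of
`p₁` and `p₂`. -/
def condExp (S : RectProbSpace ρ₁ ρ₂ A) (x : A) : A :=
  S.φ₁ x • S.p₁ + S.φ₂ x • S.p₂

/-- Two `*`-subalgebras `B 0`, `B 1`, both containing `𝒟`, are free with amalgamation over `𝒟`:
`E(x₁ ⋯ xₘ) = 0` whenever `m ≥ 1`, `xⱼ ∈ B (iⱼ)`, `E(xⱼ) = 0` and consecutive indices `iⱼ`
are distinct. A word is a list of pairs `(iⱼ, xⱼ)`. -/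
def FreeSubalgebras (S : RectProbSpace ρ₁ ρ₂ A) (B : Fin 2 → StarSubalgebra ℂ A) : Prop :=
  (∀ i, S.p₁ ∈ B i ∧ S.p₂ ∈ B i) ∧
  ∀ w : List (Fin 2 × A), w ≠ [] →
    (∀ x ∈ w, x.2 ∈ B x.1 ∧ S.condExp x.2 = 0) →
    w.IsChain (fun x y => x.1 ≠ y.1) →
    S.condExp (w.map Prod.snd).prod = 0

/-- Two elements are free with amalgamation over `𝒟` if they lie in `*`-subalgebras which are. -/
def FreeElements (S : RectProbSpace ρ₁ ρ₂ A) (a₁ a₂ : A) : Prop :=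
  ∃ B : Fin 2 → StarSubalgebra ℂ A, S.FreeSubalgebras B ∧ a₁ ∈ B 0 ∧ a₂ ∈ B 1

end RectProbSpace

/-! ### Symmetric probability measures and the convolution of compactly supported ones -/

/-- Symmetric Borel probability measures on the real line, with the topology of weak
convergence. -/
abbrev SymmProb : Type :=
  {μ : ProbabilityMeasure ℝ // (μ : Measure ℝ).IsNegInvariant}

namespace SymmProb

/-- The underlying measure on the real line. -/
def toMeasure (μ : SymmProb) : Measure ℝ := (μ.1 : Measure ℝ)

/-- The measure is carried by a compact set. -/
def CompactlySupported (μ : SymmProb) : Prop :=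
  ∃ K : Set ℝ, IsCompact K ∧ μ.toMeasure Kᶜ = 0

end SymmProb

/-- `a ∈ p₁ A p₂` and for every even `r = 2k`, `φ₁((a a*)^k)` is the `r`-th moment of `μ`. -/
def HasRectDistribution {ρ₁ ρ₂ : ℝ} {A : Type*} [Ring A] [StarRing A] [Algebra ℂ A]
    [StarModule ℂ A] (S : RectProbSpace ρ₁ ρ₂ A) (a : A) (μ : SymmProb) : Prop :=
  S.p₁ * a * S.p₂ = a ∧
  ∀ k : ℕ, S.φ₁ ((a * star a) ^ k) = ((∫ x, x ^ (2 * k) ∂μ.toMeasure : ℝ) : ℂ)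

/-- `a₁, a₂` are `𝒟`-free elements of `p₁ A p₂` with distributions `μ₁`, `μ₂`, in a
`(ρ₁, ρ₂)`-rectangular probability space with `ρ₁ + ρ₂ = 1` and `ρ₁ / ρ₂ = lam`. -/
def IsFreeModel (lam : ℝ) (μ₁ μ₂ : SymmProb) {A : Type*} [Ring A] [StarRing A] [Algebra ℂ A]
    [StarModule ℂ A] (S : RectProbSpace (lam / (1 + lam)) (1 / (1 + lam)) A) (a₁ a₂ : A) : Prop :=
  HasRectDistribution S a₁ μ₁ ∧ HasRectDistribution S a₂ μ₂ ∧ S.FreeElements a₁ a₂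

/-- The graph of the rectangular free convolution with ratio `lam` of compactly supported
symmetric measures: `μ` is the compactly supported symmetric probability measure whose even
moments are those of the sum `a₁ + a₂` of free elements with distributions `μ₁`, `μ₂`.
Such a pair exists, and the moments are the right ones for every such pair. -/
def IsRectConv (lam : ℝ) (μ₁ μ₂ μ : SymmProb) : Prop :=
  μ.CompactlySupported ∧
  (∃ (A : Type) (_ : Ring A) (_ : StarRing A) (_ : Algebra ℂ A) (_ : StarModule ℂ A)
    (S : RectProbSpace (lam / (1 + lam)) (1 / (1 + lam)) A) (a₁ a₂ : A),
    IsFreeModel lam μ₁ μ₂ S a₁ a₂) ∧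
  (∀ (A : Type) [Ring A] [StarRing A] [Algebra ℂ A] [StarModule ℂ A]
    (S : RectProbSpace (lam / (1 + lam)) (1 / (1 + lam)) A) (a₁ a₂ : A),
    IsFreeModel lam μ₁ μ₂ S a₁ a₂ → HasRectDistribution S (a₁ + a₂) μ)

/-- A binary operation on symmetric probability measures which extends the rectangular free
convolution of compactly supported ones and is commutative, associative and (jointly)
continuous for weak convergence. -/
structure IsContinuousExtension (lam : ℝ) (op : SymmProb → SymmProb → SymmProb) : Prop where
  extends_conv : ∀ μ ν : SymmProb, μ.CompactlySupported → ν.CompactlySupported →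
    IsRectConv lam μ ν (op μ ν)
  comm : ∀ μ ν : SymmProb, op μ ν = op ν μ
  assoc : ∀ μ ν ξ : SymmProb, op (op μ ν) ξ = op μ (op ν ξ)
  continuous : Continuous (fun q : SymmProb × SymmProb => op q.1 q.2)

/-! ### The rectangular R-transform -/

/-- The Cauchy transform `G_μ(z) = ∫ dμ(t) / (z - t)`, for `z` off the real line. -/
def cauchyTransform (μ : SymmProb) (z : ℂ) : ℂ :=
  ∫ t : ℝ, 1 / (z - (t : ℂ)) ∂μ.toMeasure

/-- The square root which is analytic off `[0, ∞)` and maps `-1` to `i`. -/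
def sqrtCut (z : ℂ) : ℂ := Complex.I * (-z) ^ (1 / 2 : ℂ)

/-- The rectangular Cauchy transform with ratio `lam`, for `z` off `[0, ∞)`:
`H_μ(z) = lam G_μ(1/√z)² + (1 - lam) √z G_μ(1/√z)`. -/
def rectCauchy (lam : ℝ) (μ : SymmProb) (z : ℂ) : ℂ :=
  (lam : ℂ) * cauchyTransform μ (1 / sqrtCut z) ^ 2 +
    (1 - (lam : ℂ)) * sqrtCut z * cauchyTransform μ (1 / sqrtCut z)

/-- The sector of nonzero `z` with `|arg z - π| < α`, where `arg z ∈ [0, 2π)`; as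
`arg z - π` is the principal argument of `-z` off the positive half-line, for `0 < α < π` this
says `|Arg(-z)| < α`. -/
def leftSector (α : ℝ) : Set ℂ := {z | z ≠ 0 ∧ |Complex.arg (-z)| < α}

/-- The truncated sector `Δ_{α,β}`: `|arg z - π| < α` and `0 < |z| < β`. -/
def truncSector (α β : ℝ) : Set ℂ := leftSector α ∩ {z | ‖z‖ < β}

/-- `F` is an inverse of `H` near `0` in all sectors around the negative half-line: for every
`α ∈ (0, π)`, `F` is analytic on some `Δ_{α,β}`, `F(z)/z → 1` as `z → 0` with `|arg z - π| < α`,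
and `H ∘ F = F ∘ H = id` on some `Δ_{α,β}`. -/
def IsSectorialInverse (H F : ℂ → ℂ) : Prop :=
  ∀ α ∈ Ioo (0 : ℝ) Real.pi,
    (∃ β > 0, DifferentiableOn ℂ F (truncSector α β)) ∧
    Tendsto (fun z => F z / z) (𝓝[leftSector α] 0) (𝓝 1) ∧
    (∃ β > 0, ∀ z ∈ truncSector α β, H (F z) = z ∧ F (H z) = z)

/-- The inverse `H_μ⁻¹`, determined near `0` in every sector. -/
def rectCauchyInv (lam : ℝ) (μ : SymmProb) : ℂ → ℂ :=
  Classical.epsilon (IsSectorialInverse (rectCauchy lam μ))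

/-- `U(z) = (-lam - 1 + ((lam + 1)² + 4 lam z)^{1/2}) / (2 lam)`, and `U(z) = z` if `lam = 0`. -/
def rectU (lam : ℝ) (z : ℂ) : ℂ :=
  if lam = 0 then z
  else (-(lam : ℂ) - 1 + (((lam : ℂ) + 1) ^ 2 + 4 * (lam : ℂ) * z) ^ (1 / 2 : ℂ)) /
    (2 * (lam : ℂ))

/-- The rectangular R-transform with ratio `lam`: `C_μ(z) = U(z / H_μ⁻¹(z) - 1)`. -/
def rectRTransform (lam : ℝ) (μ : SymmProb) (z : ℂ) : ℂ :=
  rectU lam (z / rectCauchyInv lam μ z - 1)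

/-- Equality of functions near `0` in every sector around the negative half-line, i.e. for every
`α ∈ (0, π)` on some `Δ_{α,β}`. -/
def SectorialEq (f g : ℂ → ℂ) : Prop :=
  ∀ α ∈ Ioo (0 : ℝ) Real.pi, ∃ β > 0, ∀ z ∈ truncSector α β, f z = g z

end

/-! ### The resolvent mean of a measure on the line -/

/-! Put d_μ(u) = ∫ u x²/(1 + u x²) dμ, the defect. On the negative half-line H_μ(-u) = -u (1 - d)(1
- λd) with d = d_μ(u), and U((1 - d)(1 - λd) - 1) = -d for small d. Hence C_μ(-y) = -d_μ(u) where u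
solves u (1 - d)(1 - λd) = y; this defect is `rectDefect`. Additivity of C thus says: if D is the
sum of the two defects belonging to the same y, then d_ξ(w) = D at w = y/((1 - D)(1 - λD)). The
relation `RectAdd` records it on an explicit range of y, and everything passes through it.

For compact supports it is a moment computation. An element a of p₁Ap₂ is replaced by the
self-adjoint letter a + a*, which exchanges the two corners; its laws are μ in the first and λμ + (1
- λ)δ₀ in the second. In any free model, products of orthogonal polynomials in the letters are
indexed by words and obey a recursion with Jacobi coefficients, while freeness makes the functional
vanish on every nonempty word. So the moments of the sum are those of a weighted walk on words,
whatever the model (`FreeLetters.φ_pow`). A function that is multiplicative over the blocks of a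
word, built from resolvent entries of the single letters, solves the resolvent equation of this walk
(`walk_blockFun`). This is 𝒟-valued subordination: if the Cauchy transform of the i-th letter takes
the value g at ω_i, then that of the sum takes it at ω_0 + ω_1 - 1/g. Evaluation at the empty word
yields d_ξ(w) = D for small y (`tendsto_sum_walkMoment_of_defect`), and analyticity in y extends
this to the range of `RectAdd`.

Free models exist because the same recursion is realised by bounded creation and annihilation
operators on ℓ² of labelled words (`fockLetters`). The trace relations there follow from freeness
and from the relation between the moments of the corners, and the spectral measure of the sum at the
vacuum provides the convolution.

For general measures, the range and the bounds in `RectAdd` involve only defects at 2y, so they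
survive weak limits (`RectAdd.of_tendsto`) and also yield tightness. `rectDefect` near 0 determines
a symmetric measure: it gives back d_ξ on an interval, differentiation gives the means of all powers
of (1 + u x²)⁻¹, and Stone–Weierstrass concludes. With density of compact supports this produces the
operation, its uniqueness and its continuity; commutativity and associativity become those of
addition of numbers.

In a sector H_μ is tangent to the identity at 0, so by Cauchy's estimate H - id is a contraction on
balls of radius proportional to |z|, and a fixed point gives the inverse. Finally C_ξ and C_μ + C_ν
are analytic on a connected truncated sector and agree on a piece of the negative half-line, so the
identity theorem makes them equal. -/

namespace RectConv

/-- The mean of `(1 + u x²)⁻¹`. -/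
noncomputable def resMean (μ : Measure ℝ) (u : ℝ) : ℝ := ∫ x, (1 + u * x ^ 2)⁻¹ ∂μ

/-- The defect `1 - resMean μ u`. -/
noncomputable def defect (μ : Measure ℝ) (u : ℝ) : ℝ := 1 - resMean μ u

/-- The mean of the powers of `(1 + u x²)⁻¹`. -/
noncomputable def resPow (μ : Measure ℝ) (k : ℕ) (u : ℝ) : ℝ := ∫ x, ((1 + u * x ^ 2)⁻¹) ^ k ∂μ

lemma one_add_pos {u : ℝ} (hu : 0 ≤ u) (x : ℝ) : 0 < 1 + u * x ^ 2 := by positivity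

lemma res_le_one {u : ℝ} (hu : 0 ≤ u) (x : ℝ) : (1 + u * x ^ 2)⁻¹ ≤ 1 :=
  inv_le_one_of_one_le₀ (by nlinarith [mul_nonneg hu (sq_nonneg x)])

lemma res_nonneg {u : ℝ} (hu : 0 ≤ u) (x : ℝ) : 0 ≤ (1 + u * x ^ 2)⁻¹ :=
  inv_nonneg.2 (one_add_pos hu x).le

lemma continuous_res {u : ℝ} (hu : 0 ≤ u) : Continuous fun x : ℝ => (1 + u * x ^ 2)⁻¹ :=
  Continuous.inv₀ (by fun_prop) fun x => (one_add_pos hu x).ne'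

lemma defect_le_one {μ : Measure ℝ} {u : ℝ} (hu : 0 ≤ u) : defect μ u ≤ 1 := by
  have : 0 ≤ resMean μ u := integral_nonneg fun x => res_nonneg hu x
  unfold defect; linarith

variable {μ ν : Measure ℝ} [IsProbabilityMeasure μ] [IsProbabilityMeasure ν]

lemma integrable_of_continuous_of_abs_le {f : ℝ → ℝ} (hf : Continuous f) (C : ℝ)
    (h : ∀ x, |f x| ≤ C) : Integrable f μ :=
  Integrable.of_bound hf.aestronglyMeasurable C (ae_of_all _ h)

lemma integrable_res {u : ℝ} (hu : 0 ≤ u) : Integrable (fun x : ℝ => (1 + u * x ^ 2)⁻¹) μ :=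
  integrable_of_continuous_of_abs_le (continuous_res hu) 1 fun x => by
    rw [abs_of_nonneg (res_nonneg hu x)]; exact res_le_one hu x

lemma integrable_resPow (k : ℕ) {u : ℝ} (hu : 0 ≤ u) :
    Integrable (fun x : ℝ => ((1 + u * x ^ 2)⁻¹) ^ k) μ :=
  integrable_of_continuous_of_abs_le ((continuous_res hu).pow k) 1 fun x => by
    rw [abs_of_nonneg (pow_nonneg (res_nonneg hu x) k)]
    exact pow_le_one₀ (res_nonneg hu x) (res_le_one hu x)

lemma defect_eq_integral {u : ℝ} (hu : 0 ≤ u) :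
    defect μ u = ∫ x, (1 - (1 + u * x ^ 2)⁻¹) ∂μ := by
  rw [integral_sub (integrable_const _) (integrable_res hu)]
  simp [defect, resMean]

lemma defect_nonneg {u : ℝ} (hu : 0 ≤ u) : 0 ≤ defect μ u := by
  rw [defect_eq_integral hu]
  exact integral_nonneg fun x => sub_nonneg.2 (res_le_one hu x)

lemma defect_mono {u v : ℝ} (hu : 0 ≤ u) (huv : u ≤ v) : defect μ u ≤ defect μ v := by
  unfold defect resMean
  have := integral_mono (integrable_res (μ := μ) (hu.trans huv)) (integrable_res (μ := μ) hu)
    (fun x => inv_anti₀ (one_add_pos hu x)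
      (by nlinarith [mul_le_mul_of_nonneg_right huv (sq_nonneg x)]))
  linarith

/-- The integrand u x²/(1 + u x²) divided by u decreases in u. This sublinearity is what makes later
bounds uniform in the measure. -/
lemma mul_defect_le {u v : ℝ} (hu : 0 ≤ u) (huv : u ≤ v) :
    u * defect μ v ≤ v * defect μ u := by
  have hv := hu.trans huv
  rw [defect_eq_integral hu, defect_eq_integral hv, ← integral_const_mul, ← integral_const_mul]
  refine integral_mono (((integrable_const _).sub (integrable_res hv)).const_mul _)
    (((integrable_const _).sub (integrable_res hu)).const_mul _) fun x => ?_
  have h1 := one_add_pos hu x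
  have h2 := one_add_pos hv x
  have e1 : 1 - (1 + u * x ^ 2)⁻¹ = u * x ^ 2 / (1 + u * x ^ 2) := by field_simp; ring
  have e2 : 1 - (1 + v * x ^ 2)⁻¹ = v * x ^ 2 / (1 + v * x ^ 2) := by field_simp; ring
  simp only [e1, e2]
  rw [mul_div_assoc', mul_div_assoc', div_le_div_iff₀ h2 h1]
  have : 0 ≤ u * v * x ^ 2 * ((v - u) * x ^ 2) := by
    have := sub_nonneg.2 huv
    positivity
  nlinarith

/-- The constant 1/a does not depend on the measure, so the argument of the defect may move along a
weakly convergent sequence. -/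
lemma abs_defect_sub_le {a u v : ℝ} (ha : 0 < a) (hu : a ≤ u) (hv : a ≤ v) :
    |defect μ u - defect μ v| ≤ |u - v| / a := by
  wlog h : u ≤ v generalizing u v
  · rw [abs_sub_comm, abs_sub_comm u v]; exact this hv hu (le_of_not_ge h)
  have hu0 : 0 < u := ha.trans_le hu
  have h1 := mul_defect_le (μ := μ) hu0.le h
  have h2 := defect_mono (μ := μ) hu0.le h
  have h3 := defect_le_one (μ := μ) hu0.le
  rw [abs_sub_comm, abs_of_nonneg (sub_nonneg.2 h2), abs_sub_comm, abs_of_nonneg (sub_nonneg.2 h),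
    le_div_iff₀ ha]
  have : u * (defect μ v - defect μ u) ≤ (v - u) * 1 := by
    nlinarith [mul_le_mul_of_nonneg_left h3 (sub_nonneg.2 h)]
  nlinarith [mul_le_mul_of_nonneg_right hu (sub_nonneg.2 h2)]

lemma tendsto_defect_zero : Tendsto (defect μ) (𝓝[>] 0) (𝓝 0) := by
  have h : Tendsto (resMean μ) (𝓝[>] 0) (𝓝 (∫ _, (1 : ℝ) ∂μ)) := by
    refine tendsto_integral_filter_of_dominated_convergence (fun _ => 1) ?_ ?_
      (integrable_const _) ?_
    · filter_upwards [self_mem_nhdsWithin] with u hu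
      exact (continuous_res (le_of_lt hu)).aestronglyMeasurable
    · filter_upwards [self_mem_nhdsWithin] with u hu
      refine ae_of_all _ fun x => ?_
      rw [Real.norm_of_nonneg (res_nonneg (le_of_lt hu) x)]
      exact res_le_one (le_of_lt hu) x
    · refine ae_of_all _ fun x => ?_
      have : Tendsto (fun u : ℝ => (1 + u * x ^ 2)⁻¹) (𝓝 0) (𝓝 ((1 + 0 * x ^ 2)⁻¹)) :=
        ContinuousAt.tendsto (ContinuousAt.inv₀ (by fun_prop) (by simp))
      simp only [zero_mul, add_zero, inv_one] at this
      exact this.mono_left nhdsWithin_le_nhds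
  simp only [integral_const, probReal_univ, smul_eq_mul, mul_one] at h
  have h2 := (tendsto_const_nhds (x := (1 : ℝ))).sub h
  rw [sub_self] at h2
  exact h2

/-- For r = (1 + v x²)⁻¹ one has v ∂r/∂v = r² - r. The derivative therefore stays in the family of
powers of r and is dominated without any moment of μ. -/
lemma hasDerivAt_resPow (k : ℕ) {u : ℝ} (hu : 0 < u) :
    HasDerivAt (resPow μ k) (-(k / u) * (resPow μ k u - resPow μ (k + 1) u)) u := by
  have key := hasDerivAt_integral_of_dominated_loc_of_deriv_le (μ := μ)
    (F := fun v x => ((1 + v * x ^ 2)⁻¹) ^ k)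
    (F' := fun v x => -(k / v) * (((1 + v * x ^ 2)⁻¹) ^ k - ((1 + v * x ^ 2)⁻¹) ^ (k + 1)))
    (x₀ := u) (s := Ioi (u / 2)) (bound := fun _ => k / (u / 2)) (Ioi_mem_nhds (by linarith))
    ?_ (integrable_resPow k hu.le) ?_ ?_ (integrable_const _) ?_
  · have := key.2
    rw [integral_const_mul, integral_sub (integrable_resPow k hu.le)
      (integrable_resPow (k + 1) hu.le)] at this
    exact this
  · filter_upwards [Ioi_mem_nhds hu] with v hv
    exact ((continuous_res (le_of_lt hv)).pow k).aestronglyMeasurable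
  · exact (continuous_const.mul (((continuous_res hu.le).pow k).sub
      ((continuous_res hu.le).pow (k + 1)))).aestronglyMeasurable
  · refine ae_of_all _ fun x v hv => ?_
    have hv' : u / 2 < v := hv
    have hv0 : 0 < v := by linarith
    have h0 := res_nonneg hv0.le x
    have h1 := res_le_one hv0.le x
    have h2 := pow_nonneg h0 k
    have h3 : ((1 + v * x ^ 2)⁻¹) ^ k ≤ 1 := pow_le_one₀ h0 h1
    have h4 : ((1 + v * x ^ 2)⁻¹) ^ (k + 1) ≤ ((1 + v * x ^ 2)⁻¹) ^ k :=
      pow_le_pow_of_le_one h0 h1 (Nat.le_succ k)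
    have h5 := pow_nonneg h0 (k + 1)
    rw [norm_mul, norm_neg, Real.norm_of_nonneg (by positivity),
      Real.norm_of_nonneg (by linarith)]
    calc (k : ℝ) / v * _ ≤ k / v * 1 := by gcongr; linarith
      _ ≤ k / (u / 2) := by rw [mul_one]; gcongr
  · refine ae_of_all _ fun x v hv => ?_
    have hv' : u / 2 < v := hv
    have hv0 : 0 < v := by linarith
    have hp := one_add_pos hv0.le x
    have := ((((hasDerivAt_id v).mul_const (x ^ 2)).const_add 1).inv hp.ne').pow k
    refine HasDerivAt.congr_deriv this ?_
    simp only [Pi.inv_apply, id]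
    rcases k with _ | k
    · simp
    · simp only [Nat.add_sub_cancel]
      obtain ⟨A, hA⟩ : ∃ A, A = 1 + v * x ^ 2 := ⟨_, rfl⟩
      have hx : x ^ 2 = (A - 1) / v := by rw [hA]; field_simp; ring
      rw [← hA] at hp ⊢
      rw [hx]
      push_cast
      simp only [inv_pow, pow_succ]
      field_simp

/-- Differentiating in u climbs from one power to the next, which is why agreement on an open
interval is assumed and not only at a point. -/
lemma resPow_succ_eqOn {a b : ℝ} (ha : 0 < a)
    (h : ∀ u ∈ Ioo a b, resMean μ u = resMean ν u) (k : ℕ) :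
    ∀ u ∈ Ioo a b, resPow μ (k + 1) u = resPow ν (k + 1) u := by
  induction k with
  | zero => simpa [resPow, resMean] using h
  | succ k ih =>
    intro u hu
    have hu0 : 0 < u := ha.trans hu.1
    have h1 := hasDerivAt_resPow (μ := μ) (k + 1) hu0
    have h2 := hasDerivAt_resPow (μ := ν) (k + 1) hu0
    have h3 : resPow μ (k + 1) =ᶠ[𝓝 u] resPow ν (k + 1) := by
      filter_upwards [Ioo_mem_nhds hu.1 hu.2] with v hv using ih v hv
    have h4 := h1.unique (h2.congr_of_eventuallyEq h3)
    rw [ih u hu] at h4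
    have h5 : -(((k + 1 : ℕ) : ℝ) / u) ≠ 0 := by
      have : (0 : ℝ) < ((k + 1 : ℕ) : ℝ) := by positivity
      have := div_pos this hu0
      exact (neg_lt_zero.2 this).ne
    have := mul_left_cancel₀ h5 h4
    linarith

/-- Two probability measures on the half-line which agree on the powers of `(1 + u y²)⁻¹` are
equal. -/
lemma nnreal_measure_ext {P P' : Measure NNReal} [IsProbabilityMeasure P]
    [IsProbabilityMeasure P'] {u : ℝ} (hu : 0 < u)
    (h : ∀ k : ℕ, ∫ y : NNReal, ((1 + u * (y : ℝ) ^ 2)⁻¹) ^ k ∂P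
      = ∫ y : NNReal, ((1 + u * (y : ℝ) ^ 2)⁻¹) ^ k ∂P') : P = P' := by
  have hc : Continuous fun y : NNReal => (1 + u * (y : ℝ) ^ 2)⁻¹ :=
    (continuous_res hu.le).comp NNReal.continuous_coe
  let s : BoundedContinuousFunction NNReal ℝ := BoundedContinuousFunction.ofNormedAddCommGroup
    (fun y : NNReal => (1 + u * (y : ℝ) ^ 2)⁻¹) hc 1 fun y => by
      rw [Real.norm_of_nonneg (res_nonneg hu.le _)]; exact res_le_one hu.le _
  refine ext_of_forall_mem_subalgebra_integral_eq_of_polish (𝕜 := ℝ)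
    (A := StarAlgebra.adjoin ℝ {s}) ?_ ?_
  -- The single function `s` separates points because squaring is injective on the half-line; on the
  -- whole line it would not.
  · intro x y hxy
    refine ⟨_, ⟨BoundedContinuousFunction.toContinuousMapStarₐ ℝ s,
      ⟨s, StarAlgebra.subset_adjoin ℝ _ rfl, rfl⟩, rfl⟩, ?_⟩
    change (1 + u * (x : ℝ) ^ 2)⁻¹ ≠ (1 + u * (y : ℝ) ^ 2)⁻¹
    intro he
    have h1 : (x : ℝ) ^ 2 = (y : ℝ) ^ 2 := by
      have := inv_injective he
      exact mul_left_cancel₀ hu.ne' (by linarith)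
    exact hxy (NNReal.coe_injective ((pow_left_inj₀ x.2 y.2 two_ne_zero).1 h1))
  · intro g hg
    have hs : star ({s} : Set (BoundedContinuousFunction NNReal ℝ)) = {s} := by
      rw [Set.star_singleton]
      congr 1
    have hg' : g ∈ Algebra.adjoin ℝ {s} := by
      have : g ∈ (StarAlgebra.adjoin ℝ {s}).toSubalgebra := hg
      rwa [StarAlgebra.adjoin_toSubalgebra, hs, Set.union_self] at this
    rw [Algebra.adjoin_singleton_eq_range_aeval] at hg'
    obtain ⟨p, rfl⟩ := hg'
    clear hg
    induction p using Polynomial.induction_on' with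
    | add p q hp hq =>
      simp only [map_add, BoundedContinuousFunction.coe_add, Pi.add_apply] at *
      rw [integral_add (BoundedContinuousFunction.integrable _ _)
        (BoundedContinuousFunction.integrable _ _), integral_add
        (BoundedContinuousFunction.integrable _ _) (BoundedContinuousFunction.integrable _ _)]
      exact congrArg₂ _ hp hq
    | monomial n a =>
      have hv : ∀ y : NNReal, (Polynomial.aeval s (Polynomial.monomial n a)) y
          = a * ((1 + u * (y : ℝ) ^ 2)⁻¹) ^ n := by
        intro y
        simp [Polynomial.aeval_monomial, s]
      refine (integral_congr_ae (ae_of_all _ hv)).trans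
        (Eq.trans ?_ (integral_congr_ae (ae_of_all _ hv)).symm)
      rw [integral_const_mul, integral_const_mul, h n]

/-- A symmetric probability measure is determined by its resolvent mean on an interval. -/
lemma ext_of_resMean [μ.IsNegInvariant] [ν.IsNegInvariant] {a b : ℝ} (ha : 0 < a) (hab : a < b)
    (h : ∀ u ∈ Ioo a b, resMean μ u = resMean ν u) : μ = ν := by
  obtain ⟨u, hu⟩ := nonempty_Ioo.2 hab
  have hu0 : 0 < u := ha.trans hu.1
  have hm : Continuous Real.nnabs := continuous_abs.subtype_mk _
  have hP : ∀ (Q : Measure ℝ) [IsProbabilityMeasure Q], IsProbabilityMeasure (Q.map Real.nnabs) :=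
    fun Q _ => Measure.isProbabilityMeasure_map hm.measurable.aemeasurable
  have := hP μ
  have := hP ν
  have hmap : μ.map Real.nnabs = ν.map Real.nnabs := by
    refine nnreal_measure_ext hu0 fun k => ?_
    have hc : Continuous fun y : NNReal => ((1 + u * (y : ℝ) ^ 2)⁻¹) ^ k :=
      ((continuous_res hu0.le).comp NNReal.continuous_coe).pow k
    rw [integral_map hm.measurable.aemeasurable hc.aestronglyMeasurable,
      integral_map hm.measurable.aemeasurable hc.aestronglyMeasurable]
    simp only [Real.coe_nnabs, sq_abs]
    rcases k with _ | k
    · simp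
    · exact resPow_succ_eqOn ha h k u hu
  refine ext_of_forall_integral_eq_of_IsFiniteMeasure fun f => ?_
  -- By symmetry the integral of f only sees its even part, hence only the law of |x|.
  have hsym : ∀ (Q : Measure ℝ) [IsProbabilityMeasure Q] [Q.IsNegInvariant],
      ∫ x, f x ∂Q = ∫ y : NNReal, (f (y : ℝ) + f (-(y : ℝ))) / 2 ∂(Q.map Real.nnabs) := by
    intro Q _ _
    have hc : Continuous fun y : NNReal => (f (y : ℝ) + f (-(y : ℝ))) / 2 := by fun_prop
    rw [integral_map hm.measurable.aemeasurable hc.aestronglyMeasurable]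
    have h1 : ∀ x : ℝ, (f ((Real.nnabs x : NNReal) : ℝ) + f (-((Real.nnabs x : NNReal) : ℝ))) / 2
        = (f x + f (-x)) / 2 := by
      intro x
      rw [Real.coe_nnabs]
      rcases abs_cases x with ⟨hx, _⟩ | ⟨hx, _⟩ <;> rw [hx]
      rw [neg_neg, add_comm]
    have hi : Integrable f Q := f.integrable Q
    have hi' : Integrable (fun x => f (-x)) Q :=
      (f.compContinuous ⟨fun x => -x, continuous_neg⟩).integrable Q
    simp_rw [h1]
    rw [integral_div, integral_add hi hi', integral_neg_eq_self (fun x => f x) Q]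
    ring
  rw [hsym μ, hsym ν, hmap]

end RectConv

/-! ### Sectors and the analytic resolvent mean -/

namespace RectConv

lemma neg_mem_slitPlane_of_mem_leftSector {α : ℝ} (hα : α ≤ Real.pi) {z : ℂ}
    (hz : z ∈ leftSector α) : -z ∈ Complex.slitPlane := by
  rw [Complex.mem_slitPlane_iff_arg]
  refine ⟨fun h => ?_, neg_ne_zero.2 hz.1⟩
  have := hz.2
  rw [h, abs_of_pos Real.pi_pos] at this
  linarith

lemma isOpen_leftSector {α : ℝ} (hα : α ≤ Real.pi) : IsOpen (leftSector α) := by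
  have h : leftSector α = {z | -z ∈ Complex.slitPlane} ∩ (fun z : ℂ => |Complex.arg (-z)|) ⁻¹' Iio α := by
    ext z
    exact ⟨fun hz => ⟨neg_mem_slitPlane_of_mem_leftSector hα hz, hz.2⟩,
      fun hz => ⟨neg_ne_zero.1 (Complex.slitPlane_ne_zero hz.1), hz.2⟩⟩
  rw [h]
  refine ContinuousOn.isOpen_inter_preimage (fun z hz => ?_)
    (Complex.isOpen_slitPlane.preimage continuous_neg) isOpen_Iio
  exact ((Complex.continuousAt_arg hz).comp continuous_neg.continuousAt).abs.continuousWithinAt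

lemma isOpen_truncSector {α : ℝ} (hα : α ≤ Real.pi) (β : ℝ) : IsOpen (truncSector α β) :=
  (isOpen_leftSector hα).inter (isOpen_lt continuous_norm continuous_const)

lemma exists_mem_leftSector {z : ℂ} (hz : -z ∈ Complex.slitPlane) :
    ∃ α ∈ Ioo (0 : ℝ) Real.pi, z ∈ leftSector α := by
  rw [Complex.mem_slitPlane_iff_arg] at hz
  have h : |Complex.arg (-z)| < Real.pi := by
    rw [abs_lt]
    exact ⟨Complex.neg_pi_lt_arg _, lt_of_le_of_ne (Complex.arg_le_pi _) hz.1⟩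
  refine ⟨(|Complex.arg (-z)| + Real.pi) / 2, ⟨?_, by linarith⟩, neg_ne_zero.1 hz.2, by linarith⟩
  have := abs_nonneg (Complex.arg (-z))
  linarith [Real.pi_pos]

lemma cos_le_cos_arg {α : ℝ} (hα : α ∈ Ioo (0 : ℝ) Real.pi) {z : ℂ} (hz : z ∈ leftSector α) :
    ‖z‖ * Real.cos α ≤ -z.re := by
  have h1 : Real.cos α ≤ Real.cos (Complex.arg (-z)) := by
    rw [← Real.cos_abs (Complex.arg (-z))]
    exact Real.cos_le_cos_of_nonneg_of_le_pi (abs_nonneg _) hα.2.le hz.2.le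
  have h2 := Complex.norm_mul_cos_arg (-z)
  rw [norm_neg, Complex.neg_re] at h2
  rw [← h2]
  exact mul_le_mul_of_nonneg_left h1 (norm_nonneg z)

/-- With t = s‖z‖ the squared norm is at least 1 + 2t cos α + t² = sin² α + (t + cos α)². -/
lemma sin_le_norm_one_sub {α : ℝ} (hα : α ∈ Ioo (0 : ℝ) Real.pi) {z : ℂ} (hz : z ∈ leftSector α)
    {s : ℝ} (hs : 0 ≤ s) : Real.sin α ≤ ‖1 - z * s‖ := by
  have h1 := cos_le_cos_arg hα hz
  have h2 : ‖1 - z * s‖ ^ 2 = 1 + 2 * s * (-z.re) + (s * ‖z‖) ^ 2 := by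
    rw [mul_pow, ← Complex.normSq_eq_norm_sq, ← Complex.normSq_eq_norm_sq, Complex.normSq_apply,
      Complex.normSq_apply]
    simp
    ring
  have h3 := Real.sin_sq_add_cos_sq α
  refine abs_le_of_sq_le_sq' ?_ (norm_nonneg _) |>.2
  have h4 := mul_le_mul_of_nonneg_left h1 hs
  nlinarith [sq_nonneg (s * ‖z‖ + Real.cos α)]

lemma one_sub_ne_zero {z : ℂ} (hz : -z ∈ Complex.slitPlane) {s : ℝ} (hs : 0 ≤ s) :
    1 - z * s ≠ 0 := by
  obtain ⟨α, hα, hzα⟩ := exists_mem_leftSector hz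
  exact norm_pos_iff.1 ((Real.sin_pos_of_mem_Ioo hα).trans_le (sin_le_norm_one_sub hα hzα hs))

/-- The mean of `(1 - z x²)⁻¹`. -/
noncomputable def cResMean (μ : Measure ℝ) (z : ℂ) : ℂ := ∫ x : ℝ, (1 - z * ((x ^ 2 : ℝ) : ℂ))⁻¹ ∂μ

lemma cResMean_neg (μ : Measure ℝ) (u : ℝ) : cResMean μ (-(u : ℂ)) = (resMean μ u : ℂ) := by
  unfold cResMean resMean
  rw [← integral_complex_ofReal]
  congr 1
  ext x
  push_cast
  ring_nf

variable {μ : Measure ℝ} [IsProbabilityMeasure μ]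

lemma continuous_cRes {z : ℂ} (hz : -z ∈ Complex.slitPlane) :
    Continuous fun x : ℝ => (1 - z * ((x ^ 2 : ℝ) : ℂ))⁻¹ :=
  Continuous.inv₀ (by fun_prop) fun x => one_sub_ne_zero hz (sq_nonneg x)

lemma norm_cRes_le {α : ℝ} (hα : α ∈ Ioo (0 : ℝ) Real.pi) {z : ℂ} (hz : z ∈ leftSector α) (x : ℝ) :
    ‖(1 - z * ((x ^ 2 : ℝ) : ℂ))⁻¹‖ ≤ (Real.sin α)⁻¹ := by
  rw [norm_inv]
  exact inv_anti₀ (Real.sin_pos_of_mem_Ioo hα) (sin_le_norm_one_sub hα hz (sq_nonneg x))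

lemma integrable_cRes {z : ℂ} (hz : -z ∈ Complex.slitPlane) :
    Integrable (fun x : ℝ => (1 - z * ((x ^ 2 : ℝ) : ℂ))⁻¹) μ := by
  obtain ⟨α, hα, hzα⟩ := exists_mem_leftSector hz
  exact Integrable.of_bound (continuous_cRes hz).aestronglyMeasurable _
    (ae_of_all _ (norm_cRes_le hα hzα))

lemma differentiableAt_cResMean {z : ℂ} (hz : -z ∈ Complex.slitPlane) :
    DifferentiableAt ℂ (cResMean μ) z := by
  obtain ⟨α, hα, hzα⟩ := exists_mem_leftSector hz
  have hz0 : 0 < ‖z‖ := norm_pos_iff.2 hzα.1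
  have hc := Real.sin_pos_of_mem_Ioo hα
  set c := Real.sin α with hcdef
  set r := ‖z‖ / 2 with hr
  have hr0 : 0 < r := by positivity
  have hopen : IsOpen (leftSector α ∩ {w : ℂ | r < ‖w‖}) :=
    (isOpen_leftSector hα.2.le).inter (isOpen_lt continuous_const continuous_norm)
  have hslit : ∀ w ∈ leftSector α ∩ {w : ℂ | r < ‖w‖}, -w ∈ Complex.slitPlane := fun w hw =>
    neg_mem_slitPlane_of_mem_leftSector hα.2.le hw.1
  have key := hasDerivAt_integral_of_dominated_loc_of_deriv_le (μ := μ)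
    (F := fun w (x : ℝ) => (1 - w * ((x ^ 2 : ℝ) : ℂ))⁻¹)
    (F' := fun w (x : ℝ) => ((x ^ 2 : ℝ) : ℂ) * ((1 - w * ((x ^ 2 : ℝ) : ℂ))⁻¹) ^ 2)
    (x₀ := z) (s := leftSector α ∩ {w : ℂ | r < ‖w‖})
    (bound := fun _ => r⁻¹ * (c⁻¹ + c⁻¹ ^ 2))
    (hopen.mem_nhds ⟨hzα, by simp only [mem_ofPred_eq]; linarith⟩)
    ?_ (integrable_cRes hz) ?_ ?_ (integrable_const _) ?_
  · exact key.2.differentiableAt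
  · filter_upwards [hopen.mem_nhds ⟨hzα, by simp only [mem_ofPred_eq]; linarith⟩] with w hw
    exact (continuous_cRes (hslit w hw)).aestronglyMeasurable
  · exact (Continuous.mul (by fun_prop) ((continuous_cRes hz).pow 2)).aestronglyMeasurable
  · refine ae_of_all _ fun x w hw => ?_
    have h1 := norm_cRes_le hα hw.1 x
    have hw2 : r < ‖w‖ := hw.2
    have hne := one_sub_ne_zero (hslit w hw) (sq_nonneg x)
    have hw0 : w ≠ 0 := hw.1.1
    -- The unbounded factor x² is traded for 1/w, so no moment of μ is needed.
    have e : ((x ^ 2 : ℝ) : ℂ) * ((1 - w * ((x ^ 2 : ℝ) : ℂ))⁻¹) ^ 2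
        = w⁻¹ * (((1 - w * ((x ^ 2 : ℝ) : ℂ))⁻¹) ^ 2 - (1 - w * ((x ^ 2 : ℝ) : ℂ))⁻¹) := by
      field_simp
      ring
    rw [e, norm_mul, norm_inv]
    refine mul_le_mul (inv_anti₀ hr0 hw2.le) ?_ (norm_nonneg _) (by positivity)
    refine (norm_sub_le _ _).trans ?_
    rw [norm_pow, add_comm]
    gcongr
  · refine ae_of_all _ fun x w hw => ?_
    have hne := one_sub_ne_zero (hslit w hw) (sq_nonneg x)
    have := (((hasDerivAt_id w).mul_const ((x ^ 2 : ℝ) : ℂ)).const_sub 1).inv hne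
    refine HasDerivAt.congr_deriv this ?_
    simp only [id]
    field_simp

lemma tendsto_cResMean {α : ℝ} (hα : α ∈ Ioo (0 : ℝ) Real.pi) :
    Tendsto (cResMean μ) (𝓝[leftSector α] 0) (𝓝 1) := by
  have h : Tendsto (cResMean μ) (𝓝[leftSector α] 0) (𝓝 (∫ _, (1 : ℂ) ∂μ)) := by
    refine tendsto_integral_filter_of_dominated_convergence (fun _ => (Real.sin α)⁻¹) ?_ ?_
      (integrable_const _) ?_
    · filter_upwards [self_mem_nhdsWithin] with z hz
      exact (continuous_cRes (neg_mem_slitPlane_of_mem_leftSector hα.2.le hz)).aestronglyMeasurable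
    · filter_upwards [self_mem_nhdsWithin] with z hz
      exact ae_of_all _ (norm_cRes_le hα hz)
    · refine ae_of_all _ fun x => ?_
      have : Tendsto (fun z : ℂ => (1 - z * ((x ^ 2 : ℝ) : ℂ))⁻¹) (𝓝 0)
          (𝓝 ((1 - 0 * ((x ^ 2 : ℝ) : ℂ))⁻¹)) :=
        ContinuousAt.tendsto (ContinuousAt.inv₀ (by fun_prop) (by simp))
      simp only [zero_mul, sub_zero, inv_one] at this
      exact this.mono_left nhdsWithin_le_nhds
  simpa using h

lemma sqrtCut_sq {z : ℂ} : sqrtCut z ^ 2 = z := by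
  unfold sqrtCut
  rw [mul_pow, Complex.I_sq, ← Complex.cpow_nat_mul]
  norm_num

/-- With s the root, 1/(1/s - x) = s(1 + s x)/(1 - z x²), and the part odd in x integrates to zero
by symmetry. Only s² = z is used. -/
lemma cauchyTransform_inv_sqrtCut (μ : SymmProb) {z : ℂ} (hz : -z ∈ Complex.slitPlane) :
    cauchyTransform μ (1 / sqrtCut z) = sqrtCut z * cResMean μ.toMeasure z := by
  have : IsProbabilityMeasure μ.toMeasure := by unfold SymmProb.toMeasure; infer_instance
  have : μ.toMeasure.IsNegInvariant := μ.2
  set s := sqrtCut z with hs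
  have hsq : s ^ 2 = z := sqrtCut_sq
  have hz0 : z ≠ 0 := neg_ne_zero.1 (Complex.slitPlane_ne_zero hz)
  have hs0 : s ≠ 0 := by
    intro h; rw [h] at hsq; exact hz0 (by rw [← hsq]; simp)
  have hne : ∀ x : ℝ, 1 - s * x ≠ 0 ∧ 1 + s * x ≠ 0 := by
    intro x
    have h1 : (1 - s * x) * (1 + s * x) ≠ 0 := by
      have : (1 - s * x) * (1 + s * x) = 1 - z * ((x ^ 2 : ℝ) : ℂ) := by
        rw [← hsq]; push_cast; ring
      rw [this]
      exact one_sub_ne_zero hz (sq_nonneg x)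
    exact ⟨left_ne_zero_of_mul h1, right_ne_zero_of_mul h1⟩
  have hsplit : ∀ x : ℝ, 1 / (1 / s - (x : ℂ))
      = s * (1 - z * ((x ^ 2 : ℝ) : ℂ))⁻¹ + z * x * (1 - z * ((x ^ 2 : ℝ) : ℂ))⁻¹ := by
    intro x
    have h1 := (hne x).1
    have h2 := (hne x).2
    have h3 : 1 - z * ((x ^ 2 : ℝ) : ℂ) = (1 - s * x) * (1 + s * x) := by
      rw [← hsq]; push_cast; ring
    have h4 : 1 / s - (x : ℂ) = (1 - s * x) / s := by field_simp
    rw [h3, h4, ← hsq]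
    field_simp
  have hbound : ∃ C : ℝ, ∀ x : ℝ, ‖z * x * (1 - z * ((x ^ 2 : ℝ) : ℂ))⁻¹‖ ≤ C := by
    obtain ⟨α, hα, hzα⟩ := exists_mem_leftSector hz
    have hc := Real.sin_pos_of_mem_Ioo hα
    refine ⟨1 + (1 + ‖z‖) * (Real.sin α)⁻¹, fun x => ?_⟩
    have h1 := norm_cRes_le hα hzα x
    have h2 : ‖z * ((x ^ 2 : ℝ) : ℂ) * (1 - z * ((x ^ 2 : ℝ) : ℂ))⁻¹‖
        ≤ 1 + (Real.sin α)⁻¹ := by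
      have hn := one_sub_ne_zero hz (sq_nonneg x)
      have : z * ((x ^ 2 : ℝ) : ℂ) * (1 - z * ((x ^ 2 : ℝ) : ℂ))⁻¹
          = (1 - z * ((x ^ 2 : ℝ) : ℂ))⁻¹ - 1 := by field_simp; ring
      rw [this]
      refine (norm_sub_le _ _).trans ?_
      simp only [norm_one]
      linarith
    -- This is |x| ≤ 1 + x², which reduces the odd part to terms already bounded.
    have h3 : ‖z * x * (1 - z * ((x ^ 2 : ℝ) : ℂ))⁻¹‖
        ≤ ‖z * ((x ^ 2 : ℝ) : ℂ) * (1 - z * ((x ^ 2 : ℝ) : ℂ))⁻¹‖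
          + ‖z‖ * ‖(1 - z * ((x ^ 2 : ℝ) : ℂ))⁻¹‖ := by
      rw [norm_mul, norm_mul, norm_mul, norm_mul, ← add_mul]
      refine mul_le_mul_of_nonneg_right ?_ (norm_nonneg _)
      rw [Complex.norm_real, Complex.norm_real, Real.norm_eq_abs, Real.norm_eq_abs, abs_pow]
      nlinarith [norm_nonneg z, sq_nonneg (|x| - 1), abs_nonneg x,
        mul_nonneg (norm_nonneg z) (sq_nonneg (|x| - 1)), mul_nonneg (norm_nonneg z) (abs_nonneg x)]
    nlinarith [mul_le_mul_of_nonneg_left h1 (norm_nonneg z)]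
  obtain ⟨C, hC⟩ := hbound
  have hi : Integrable (fun x : ℝ => z * x * (1 - z * ((x ^ 2 : ℝ) : ℂ))⁻¹) μ.toMeasure :=
    Integrable.of_bound (Continuous.mul (by fun_prop) (continuous_cRes hz)).aestronglyMeasurable C
      (ae_of_all _ hC)
  have hodd : ∫ x : ℝ, z * x * (1 - z * ((x ^ 2 : ℝ) : ℂ))⁻¹ ∂μ.toMeasure = 0 := by
    have h := integral_neg_eq_self (fun x : ℝ => z * x * (1 - z * ((x ^ 2 : ℝ) : ℂ))⁻¹) μ.toMeasure
    have h2 : ∀ x : ℝ, z * ((-x : ℝ) : ℂ) * (1 - z * (((-x) ^ 2 : ℝ) : ℂ))⁻¹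
        = -(z * x * (1 - z * ((x ^ 2 : ℝ) : ℂ))⁻¹) := by
      intro x; rw [neg_sq]; push_cast; ring
    simp_rw [h2] at h
    rw [integral_neg] at h
    exact CharZero.neg_eq_self_iff.1 h
  unfold cauchyTransform
  simp_rw [hsplit]
  rw [integral_add ((integrable_cRes hz).const_mul s) hi, hodd, add_zero, integral_const_mul]
  rfl

lemma rectCauchy_eq (lam : ℝ) (μ : SymmProb) {z : ℂ} (hz : -z ∈ Complex.slitPlane) :
    rectCauchy lam μ z = z * (cResMean μ.toMeasure z *
      ((lam : ℂ) * cResMean μ.toMeasure z + (1 - (lam : ℂ)))) := by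
  unfold rectCauchy
  rw [cauchyTransform_inv_sqrtCut μ hz]
  linear_combination ((lam : ℂ) * cResMean μ.toMeasure z ^ 2
    + (1 - (lam : ℂ)) * cResMean μ.toMeasure z) * (sqrtCut_sq (z := z))

lemma analyticAt_resMean {u : ℝ} (hu : 0 < u) : AnalyticAt ℝ (resMean μ) u := by
  have hopen : IsOpen {z : ℂ | -z ∈ Complex.slitPlane} :=
    Complex.isOpen_slitPlane.preimage continuous_neg
  have hmem : (-(u : ℂ)) ∈ {z : ℂ | -z ∈ Complex.slitPlane} := by
    simp only [mem_ofPred_eq, neg_neg]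
    exact Complex.ofReal_mem_slitPlane.2 hu
  have h1 : AnalyticAt ℂ (cResMean μ) (-(u : ℂ)) :=
    DifferentiableOn.analyticAt (fun z hz => (differentiableAt_cResMean hz).differentiableWithinAt)
      (hopen.mem_nhds hmem)
  have h2 : AnalyticAt ℂ (fun w : ℂ => cResMean μ (-w)) (u : ℂ) :=
    AnalyticAt.comp (g := cResMean μ) (f := fun w : ℂ => -w) h1 analyticAt_id.neg
  have h3 := h2.re_ofReal
  have h4 : (fun x : ℝ => (cResMean μ (-(x : ℂ))).re) = resMean μ := by
    ext x; rw [cResMean_neg]; simp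
  rwa [h4] at h3

end RectConv

/-! ### Orthogonal polynomials of a symmetric measure with bounded support -/

namespace RectConv

/-- The monic orthogonal polynomials of a symmetric measure, as functions. -/
noncomputable def orthoFun (m : Measure ℝ) : ℕ → ℝ → ℝ
  | 0 => fun _ => 1
  | 1 => fun x => x
  | n + 2 => fun x => x * orthoFun m (n + 1) x -
      ((∫ t, orthoFun m (n + 1) t ^ 2 ∂m) / ∫ t, orthoFun m n t ^ 2 ∂m) * orthoFun m n x

/-- The squared `L²` norm of the `n`-th orthogonal polynomial. -/
noncomputable def orthoNormSq (m : Measure ℝ) (n : ℕ) : ℝ := ∫ t, orthoFun m n t ^ 2 ∂m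

/-- The coefficients of the three-term recurrence of the orthogonal polynomials. -/
noncomputable def jacobi (m : Measure ℝ) (n : ℕ) : ℝ := orthoNormSq m (n + 1) / orthoNormSq m n

/-- A symmetric probability measure carried by `[-R, R]`, with `1 ≤ R`. -/
structure SymmBdd (m : Measure ℝ) (R : ℝ) : Prop where
  prob : IsProbabilityMeasure m
  symm : m.IsNegInvariant
  bdd : ∀ᵐ x ∂m, |x| ≤ R
  one_le : 1 ≤ R

lemma orthoFun_succ_succ (m : Measure ℝ) (n : ℕ) (x : ℝ) :
    orthoFun m (n + 2) x = x * orthoFun m (n + 1) x - jacobi m n * orthoFun m n x := by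
  rw [orthoFun]; rfl

lemma mul_orthoFun_zero (m : Measure ℝ) (x : ℝ) : x * orthoFun m 0 x = orthoFun m 1 x := by
  simp [orthoFun]

lemma mul_orthoFun_succ (m : Measure ℝ) (n : ℕ) (x : ℝ) :
    x * orthoFun m (n + 1) x = orthoFun m (n + 2) x + jacobi m n * orthoFun m n x := by
  rw [orthoFun_succ_succ]; ring

lemma continuous_orthoFun (m : Measure ℝ) (n : ℕ) : Continuous (orthoFun m n) := by
  induction n using Nat.twoStepInduction with
  | zero => exact continuous_const
  | one => exact continuous_id
  | more n h0 h1 =>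
    have : orthoFun m (n + 2) = fun x => x * orthoFun m (n + 1) x - jacobi m n * orthoFun m n x :=
      funext (orthoFun_succ_succ m n)
    rw [this]
    fun_prop

lemma orthoFun_neg (m : Measure ℝ) (n : ℕ) (x : ℝ) :
    orthoFun m n (-x) = (-1) ^ n * orthoFun m n x := by
  induction n using Nat.twoStepInduction with
  | zero => simp [orthoFun]
  | one => simp [orthoFun]
  | more n h0 h1 => rw [orthoFun_succ_succ, orthoFun_succ_succ, h0, h1]; ring

lemma orthoNormSq_nonneg (m : Measure ℝ) (n : ℕ) : 0 ≤ orthoNormSq m n :=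
  integral_nonneg fun _ => sq_nonneg _

lemma jacobi_nonneg (m : Measure ℝ) (n : ℕ) : 0 ≤ jacobi m n :=
  div_nonneg (orthoNormSq_nonneg _ _) (orthoNormSq_nonneg _ _)

namespace SymmBdd

variable {m : Measure ℝ} {R : ℝ}

lemma integrable (h : SymmBdd m R) {f : ℝ → ℝ} (hf : Continuous f) : Integrable f m := by
  have := h.prob
  obtain ⟨C, hC⟩ := (isCompact_Icc (a := -R) (b := R)).exists_bound_of_continuousOn hf.continuousOn
  refine Integrable.of_bound hf.aestronglyMeasurable C ?_
  filter_upwards [h.bdd] with x hx using hC x (abs_le.1 hx)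

lemma integral_odd (h : SymmBdd m R) {f : ℝ → ℝ} (hf : ∀ x, f (-x) = -f x) : ∫ x, f x ∂m = 0 := by
  have := h.symm
  have h1 := integral_neg_eq_self f m
  simp_rw [hf] at h1
  rw [integral_neg] at h1
  linarith

/-- Continuity side goals for products of orthogonal polynomials. -/
lemma integrable_mul (h : SymmBdd m R) (n k : ℕ) :
    Integrable (fun x => orthoFun m n x * orthoFun m k x) m :=
  h.integrable ((continuous_orthoFun m n).mul (continuous_orthoFun m k))

lemma orthoFun_ae_zero (h : SymmBdd m R) {n : ℕ} (hn : orthoNormSq m n = 0) :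
    ∀ᵐ x ∂m, orthoFun m n x = 0 := by
  have h1 := (integral_eq_zero_iff_of_nonneg (μ := m) (f := fun x => orthoFun m n x ^ 2)
    (fun _ => sq_nonneg _) (h.integrable ((continuous_orthoFun m n).pow 2))).1 hn
  filter_upwards [h1] with x hx
  exact pow_eq_zero_iff two_ne_zero |>.1 hx

lemma orthoNormSq_zero (h : SymmBdd m R) : orthoNormSq m 0 = 1 := by
  have := h.prob
  simp [orthoNormSq, orthoFun]

/-- If the norm of p_{n+1} is zero, so is the numerator of the n-th Jacobi coefficient, and then
p_{n+2} vanishes almost everywhere. The relation thus survives finitely supported measures, where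
the quotient takes the default value of division by zero. -/
lemma jacobi_mul (h : SymmBdd m R) (n : ℕ) :
    jacobi m n * orthoNormSq m n = orthoNormSq m (n + 1) := by
  unfold jacobi
  by_cases h0 : orthoNormSq m n = 0
  · rw [h0, mul_zero]
    symm
    rcases n with _ | n
    · rw [h.orthoNormSq_zero] at h0; norm_num at h0
    · have hb : jacobi m n = 0 := by unfold jacobi; rw [h0, zero_div]
      have : ∀ᵐ x ∂m, orthoFun m (n + 1 + 1) x ^ 2 = 0 := by
        filter_upwards [h.orthoFun_ae_zero h0] with x hx
        rw [orthoFun_succ_succ, hx, hb]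
        ring
      unfold orthoNormSq
      rw [integral_congr_ae this, integral_zero]
  · field_simp

lemma integral_orthoFun_mul (h : SymmBdd m R) (n : ℕ) :
    ∀ k < n, ∫ x, orthoFun m n x * orthoFun m k x ∂m = 0 := by
  induction n using Nat.strong_induction_on with
  | _ n ih =>
    intro k hk
    rcases n with _ | n
    · omega
    rcases n with _ | n
    · have : k = 0 := by omega
      subst this
      exact h.integral_odd fun x => by simp [orthoFun]
    have e : ∀ x, orthoFun m (n + 2) x * orthoFun m k x
        = orthoFun m (n + 1) x * (x * orthoFun m k x)
          - jacobi m n * (orthoFun m n x * orthoFun m k x) := by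
      intro x; rw [orthoFun_succ_succ]; ring
    have hi : Integrable (fun x => orthoFun m (n + 1) x * (x * orthoFun m k x)) m :=
      h.integrable ((continuous_orthoFun m _).mul (continuous_id.mul (continuous_orthoFun m k)))
    have e1 : ∫ x, orthoFun m (n + 2) x * orthoFun m k x ∂m
        = ∫ x, orthoFun m (n + 1) x * (x * orthoFun m k x) ∂m
          - jacobi m n * ∫ x, orthoFun m n x * orthoFun m k x ∂m := by
      rw [integral_congr_ae (ae_of_all _ e), integral_sub hi ((h.integrable_mul n k).const_mul _),
        integral_const_mul]
    rw [e1]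
    -- The case k = n + 1 is parity, k = n is the choice of the Jacobi coefficient, and k < n is the
    -- induction hypothesis.
    rcases Nat.lt_or_ge n k with hnk | hnk
    · have hk' : k = n + 1 := by omega
      subst hk'
      have h1 : ∫ x, orthoFun m n x * orthoFun m (n + 1) x ∂m = 0 := by
        simp_rw [mul_comm (orthoFun m n _)]
        exact ih (n + 1) (by omega) n (by omega)
      rw [h1, h.integral_odd]
      · simp
      · intro x
        simp only [orthoFun_neg]
        have : ((-1 : ℝ) ^ (n + 1)) * ((-1) ^ (n + 1)) = 1 := by
          rw [← mul_pow]; simp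
        linear_combination (-(x * orthoFun m (n + 1) x ^ 2)) * this
    · have e2 : ∫ x, orthoFun m (n + 1) x * (x * orthoFun m k x) ∂m
          = ∫ x, orthoFun m (n + 1) x * orthoFun m (k + 1) x ∂m := by
        rcases k with _ | k
        · simp_rw [mul_orthoFun_zero]
        · simp_rw [mul_orthoFun_succ, mul_add, mul_left_comm _ (jacobi m k)]
          rw [integral_add (h.integrable_mul _ _) ((h.integrable_mul _ _).const_mul _),
            integral_const_mul, ih (n + 1) (by omega) k (by omega), mul_zero, add_zero]
      rw [e2]
      rcases hnk.lt_or_eq with hlt | rfl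
      · rw [ih (n + 1) (by omega) (k + 1) (by omega), ih n (by omega) k hlt]; simp
      · have h1 := h.jacobi_mul k
        simp only [orthoNormSq, sq] at h1
        rw [h1, sub_self]

lemma integral_orthoFun (h : SymmBdd m R) (n : ℕ) :
    ∫ x, orthoFun m n x ∂m = if n = 0 then 1 else 0 := by
  have := h.prob
  split_ifs with hn
  · subst hn; simp [orthoFun]
  · have := h.integral_orthoFun_mul n 0 (by omega)
    simpa [orthoFun] using this

/-- The splitting of x p_n into p_{n+1} and a multiple of p_{n-1} is orthogonal, so p_{n+1} is no
longer than x p_n. -/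
lemma orthoNormSq_succ_le (h : SymmBdd m R) (n : ℕ) :
    orthoNormSq m (n + 1) ≤ R ^ 2 * orthoNormSq m n := by
  have h1 : ∫ x, (x * orthoFun m n x) ^ 2 ∂m ≤ R ^ 2 * orthoNormSq m n := by
    unfold orthoNormSq
    rw [← integral_const_mul]
    refine integral_mono_ae (h.integrable ((continuous_id.mul (continuous_orthoFun m n)).pow 2))
      ((h.integrable ((continuous_orthoFun m n).pow 2)).const_mul _) ?_
    filter_upwards [h.bdd] with x hx
    simp only [mul_pow]
    exact mul_le_mul_of_nonneg_right (sq_le_sq' (abs_le.1 hx).1 (abs_le.1 hx).2) (sq_nonneg _)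
  refine le_trans ?_ h1
  rcases n with _ | n
  · unfold orthoNormSq
    simp_rw [mul_orthoFun_zero]
    exact le_refl _
  · have e : ∀ x, (x * orthoFun m (n + 1) x) ^ 2 = orthoFun m (n + 2) x ^ 2
        + (2 * jacobi m n * (orthoFun m (n + 2) x * orthoFun m n x)
          + jacobi m n ^ 2 * orthoFun m n x ^ 2) := by
      intro x; rw [mul_orthoFun_succ]; ring
    have i1 : Integrable (fun x => orthoFun m (n + 2) x ^ 2) m :=
      h.integrable ((continuous_orthoFun m (n + 2)).pow 2)
    have i2 := (h.integrable_mul (n + 2) n).const_mul (2 * jacobi m n)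
    have i3 : Integrable (fun x => jacobi m n ^ 2 * orthoFun m n x ^ 2) m :=
      (h.integrable ((continuous_orthoFun m n).pow 2)).const_mul (jacobi m n ^ 2)
    have i23 : Integrable (fun x => 2 * jacobi m n * (orthoFun m (n + 2) x * orthoFun m n x)
        + jacobi m n ^ 2 * orthoFun m n x ^ 2) m := i2.add i3
    rw [integral_congr_ae (ae_of_all _ e), integral_add i1 i23, integral_add i2 i3,
      integral_const_mul, integral_const_mul, h.integral_orthoFun_mul (n + 2) n (by omega)]
    have : 0 ≤ ∫ x, orthoFun m n x ^ 2 ∂m := orthoNormSq_nonneg m n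
    have h3 : 0 ≤ jacobi m n ^ 2 * ∫ x, orthoFun m n x ^ 2 ∂m := by positivity
    unfold orthoNormSq
    linarith

lemma jacobi_le (h : SymmBdd m R) (n : ℕ) : jacobi m n ≤ R ^ 2 := by
  unfold jacobi
  exact div_le_of_le_mul₀ (orthoNormSq_nonneg _ _) (sq_nonneg R) (h.orthoNormSq_succ_le n)

lemma abs_orthoFun_le (h : SymmBdd m R) (n : ℕ) {x : ℝ} (hx : |x| ≤ R) :
    |orthoFun m n x| ≤ (2 * R) ^ n := by
  have hR := h.one_le
  induction n using Nat.twoStepInduction with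
  | zero => simp [orthoFun]
  | one => simp only [orthoFun, pow_one]; linarith
  | more n h0 h1 =>
    rw [orthoFun_succ_succ]
    have h2 : |x * orthoFun m (n + 1) x| ≤ R * (2 * R) ^ (n + 1) := by
      rw [abs_mul]; gcongr
    have h3 : |jacobi m n * orthoFun m n x| ≤ R ^ 2 * (2 * R) ^ n := by
      rw [abs_mul, abs_of_nonneg (jacobi_nonneg m n)]
      have := h.jacobi_le n
      gcongr
    have h4 := abs_sub (x * orthoFun m (n + 1) x) (jacobi m n * orthoFun m n x)
    have h5 : 0 ≤ R ^ 2 * (2 * R) ^ n := by positivity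
    have h6 : (2 * R) ^ (n + 2) = 4 * (R ^ 2 * (2 * R) ^ n) := by ring
    have h7 : R * (2 * R) ^ (n + 1) = 2 * (R ^ 2 * (2 * R) ^ n) := by ring
    linarith

end SymmBdd

/-- The moments of the orthogonal polynomials. -/
noncomputable def orthoMoment (m : Measure ℝ) (k n : ℕ) : ℝ := ∫ x, x ^ k * orthoFun m n x ∂m

lemma orthoMoment_zero_right (m : Measure ℝ) (k : ℕ) : orthoMoment m k 0 = ∫ x, x ^ k ∂m := by
  simp [orthoMoment, orthoFun]

lemma orthoMoment_succ_zero (m : Measure ℝ) (k : ℕ) :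
    orthoMoment m (k + 1) 0 = orthoMoment m k 1 := by
  unfold orthoMoment
  congr 1; ext x; rw [← mul_orthoFun_zero]; ring

namespace SymmBdd

variable {m : Measure ℝ} {R : ℝ}

lemma orthoMoment_zero_left (h : SymmBdd m R) (n : ℕ) :
    orthoMoment m 0 n = if n = 0 then 1 else 0 := by
  rw [← h.integral_orthoFun n]; simp [orthoMoment]

/-- This recursion is what the algebraic and the Hilbert space models both reproduce, with no
integral at hand. -/
lemma orthoMoment_succ_succ (h : SymmBdd m R) (k n : ℕ) :
    orthoMoment m (k + 1) (n + 1) = orthoMoment m k (n + 2) + jacobi m n * orthoMoment m k n := by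
  unfold orthoMoment
  have e : ∀ x, x ^ (k + 1) * orthoFun m (n + 1) x
      = x ^ k * orthoFun m (n + 2) x + jacobi m n * (x ^ k * orthoFun m n x) := by
    intro x; rw [pow_succ, mul_assoc, mul_orthoFun_succ]; ring
  have hi : ∀ j, Integrable (fun x => x ^ k * orthoFun m j x) m := fun j =>
    h.integrable ((continuous_pow k).mul (continuous_orthoFun m j))
  rw [integral_congr_ae (ae_of_all _ e), integral_add (hi _) ((hi _).const_mul _),
    integral_const_mul]

end SymmBdd

end RectConv

/-! ### Words and the generating function of the sum of two free elements -/

namespace RectConv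

/-- The number of leading letters `i` of a word. -/
def run (i : Fin 2) : List (Fin 2) → ℕ
  | [] => 0
  | j :: w => if j = i then run i w + 1 else 0

/-- A word without its leading letters `i`. -/
def rest (i : Fin 2) : List (Fin 2) → List (Fin 2)
  | [] => []
  | j :: w => if j = i then rest i w else j :: w

/-- The label of a word: that of the empty word is `k`, and each letter flips it. -/
def lab (k : Bool) : List (Fin 2) → Bool
  | [] => k
  | _ :: w => !lab k w

lemma length_rest_le (i : Fin 2) (w : List (Fin 2)) : (rest i w).length ≤ w.length := by
  induction w with
  | nil => simp [rest]
  | cons j w ih =>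
    simp only [rest]
    split_ifs
    · exact ih.trans (by simp)
    · exact le_refl _

lemma run_add_length_rest (i : Fin 2) (w : List (Fin 2)) :
    run i w + (rest i w).length = w.length := by
  induction w with
  | nil => simp [rest, run]
  | cons j w ih =>
    simp only [rest, run]
    split_ifs
    · simp only [List.length_cons]; omega
    · simp

lemma lab_eq_iterate (k : Bool) (i : Fin 2) (w : List (Fin 2)) :
    lab k w = not^[run i w] (lab k (rest i w)) := by
  induction w with
  | nil => simp [rest, run]
  | cons j w ih =>
    simp only [rest, run]
    split_ifs
    · rw [Function.iterate_succ_apply', ← ih]; rfl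
    · rfl

lemma run_cons_self (i : Fin 2) (w : List (Fin 2)) : run i (i :: w) = run i w + 1 := by simp [run]

lemma rest_cons_self (i : Fin 2) (w : List (Fin 2)) : rest i (i :: w) = rest i w := by simp [rest]

lemma run_cons_ne {i j : Fin 2} (h : j ≠ i) (w : List (Fin 2)) : run i (j :: w) = 0 := by
  simp [run, h]

lemma rest_cons_ne {i j : Fin 2} (h : j ≠ i) (w : List (Fin 2)) : rest i (j :: w) = j :: w := by
  simp [rest, h]

variable (m : Fin 2 → Bool → Measure ℝ) (k : Bool)

/-- The weight of the step from the word `i :: w` to the word `w`. -/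
noncomputable def weight (i : Fin 2) (w : List (Fin 2)) : ℝ :=
  jacobi (m i (lab k (rest i w))) (run i w)

/-- The action of the letter `i` on functions of words. -/
noncomputable def step (i : Fin 2) : (List (Fin 2) → ℝ) →ₗ[ℝ] (List (Fin 2) → ℝ) where
  toFun f w := f (i :: w) + match w with
    | [] => 0
    | j :: v => if j = i then weight m k i v * f v else 0
  map_add' f g := by
    ext w
    rcases w with _ | ⟨j, v⟩
    · simp
    · simp only [Pi.add_apply]; split_ifs <;> ring
  map_smul' c f := by
    ext w
    rcases w with _ | ⟨j, v⟩
    · simp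
    · simp only [Pi.smul_apply, smul_eq_mul, RingHom.id_apply]; split_ifs <;> ring

lemma step_nil (i : Fin 2) (f : List (Fin 2) → ℝ) : step m k i f [] = f [i] := by
  simp [step]

lemma step_cons (i j : Fin 2) (f : List (Fin 2) → ℝ) (v : List (Fin 2)) :
    step m k i f (j :: v) = f (i :: j :: v) + if j = i then weight m k i v * f v else 0 := rfl

/-- The action of the sum of the two letters. -/
noncomputable def walk : (List (Fin 2) → ℝ) →ₗ[ℝ] (List (Fin 2) → ℝ) := ∑ i, step m k i

lemma walk_apply (f : List (Fin 2) → ℝ) (w : List (Fin 2)) :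
    walk m k f w = step m k 0 f w + step m k 1 f w := by
  simp [walk, Fin.sum_univ_two]

/-- The indicator function of the empty word. -/
def nilFun : List (Fin 2) → ℝ := fun w => if w = [] then 1 else 0

/-- The `n`-th moment of the sum of two free elements. -/
noncomputable def walkMoment (n : ℕ) : ℝ := ((walk m k) ^ n) nilFun []

/-- A step changes the length of the word by one and so flips its label. -/
lemma walk_eq_mul {f g : List (Fin 2) → ℝ} {c : ℝ} {w : List (Fin 2)}
    (h : ∀ v, lab k v = !lab k w → f v = c * g v) : walk m k f w = c * walk m k g w := by
  have hs : ∀ i, step m k i f w = c * step m k i g w := by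
    intro i
    rcases w with _ | ⟨j, v⟩
    · rw [step_nil, step_nil, h _ (by simp [lab])]
    · rw [step_cons, step_cons, h _ (by simp [lab]), h v (by simp [lab])]
      split_ifs <;> ring
  rw [walk_apply, walk_apply, hs, hs]; ring

lemma walk_congr {f g : List (Fin 2) → ℝ} {w : List (Fin 2)}
    (h : ∀ v, lab k v = !lab k w → f v = g v) : walk m k f w = walk m k g w := by
  have := walk_eq_mul m k (c := 1) (f := f) (g := g) (w := w) fun v hv => by rw [h v hv, one_mul]
  rwa [one_mul] at this

lemma walk_sq_pow_congr (J : ℕ) {f g : List (Fin 2) → ℝ} (h : ∀ w, lab k w = k → f w = g w) :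
    ∀ w, lab k w = k → ((walk m k ^ 2) ^ J) f w = ((walk m k ^ 2) ^ J) g w := by
  induction J generalizing f g with
  | zero => simpa using h
  | succ J ih =>
    intro w hw
    rw [pow_succ, Module.End.mul_apply, Module.End.mul_apply]
    refine ih (fun v hv => ?_) w hw
    rw [sq, Module.End.mul_apply, Module.End.mul_apply]
    refine walk_congr m k fun v' hv' => walk_congr m k fun v'' hv'' => h _ ?_
    rw [hv'', hv', hv, Bool.not_not]

variable {m k}

lemma weight_nonneg (i : Fin 2) (w : List (Fin 2)) : 0 ≤ weight m k i w := jacobi_nonneg _ _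

lemma weight_le {R : ℝ} (hm : ∀ i l, SymmBdd (m i l) R) (i : Fin 2) (w : List (Fin 2)) :
    weight m k i w ≤ R ^ 2 := (hm _ _).jacobi_le _

/-- Against the growth L^|w|, lengthening a word costs a factor L and shortening it at most R²;
there are two letters. -/
lemma abs_walk_le {R L C : ℝ} (hm : ∀ i l, SymmBdd (m i l) R) (hL : 1 ≤ L) (hC : 0 ≤ C)
    {f : List (Fin 2) → ℝ} (hf : ∀ w, |f w| ≤ C * L ^ w.length) (w : List (Fin 2)) :
    |walk m k f w| ≤ (C * (2 * L + 2 * R ^ 2)) * L ^ w.length := by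
  have hs : ∀ i, |step m k i f w| ≤ (C * (L + R ^ 2)) * L ^ w.length := by
    intro i
    rcases w with _ | ⟨j, v⟩
    · rw [step_nil]
      have := hf [i]
      simp only [List.length_cons, List.length_nil, zero_add, pow_one, pow_zero, mul_one] at this ⊢
      nlinarith [mul_nonneg hC (sq_nonneg R)]
    · rw [step_cons]
      refine (abs_add_le _ _).trans ?_
      have h1 := hf (i :: j :: v)
      have h2 : |if j = i then weight m k i v * f v else 0| ≤ R ^ 2 * (C * L ^ (v.length + 1)) := by
        split_ifs
        · rw [abs_mul, abs_of_nonneg (weight_nonneg _ _)]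
          refine mul_le_mul (weight_le hm _ _) ((hf v).trans ?_) (abs_nonneg _) (sq_nonneg R)
          exact mul_le_mul_of_nonneg_left (pow_le_pow_right₀ hL (Nat.le_succ _)) hC
        · rw [abs_zero]; positivity
      simp only [List.length_cons] at h1 ⊢
      have h3 : C * L ^ (v.length + 1 + 1) = C * L * L ^ (v.length + 1) := by ring
      rw [h3] at h1
      calc _ ≤ C * L * L ^ (v.length + 1) + R ^ 2 * (C * L ^ (v.length + 1)) := add_le_add h1 h2
        _ = _ := by ring
  rw [walk_apply]
  refine (abs_add_le _ _).trans ?_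
  calc _ ≤ (C * (L + R ^ 2)) * L ^ w.length + (C * (L + R ^ 2)) * L ^ w.length :=
        add_le_add (hs 0) (hs 1)
    _ = _ := by ring

lemma abs_walk_sq_pow_le {R L : ℝ} (hm : ∀ i l, SymmBdd (m i l) R) (hL : 1 ≤ L) (J : ℕ)
    {f : List (Fin 2) → ℝ} {C : ℝ} (hC : 0 ≤ C) (hf : ∀ w, |f w| ≤ C * L ^ w.length) :
    ∀ w, |((walk m k ^ 2) ^ J) f w| ≤ C * (2 * L + 2 * R ^ 2) ^ (2 * J) * L ^ w.length := by
  induction J generalizing f C with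
  | zero => simpa using hf
  | succ J ih =>
    intro w
    rw [pow_succ, Module.End.mul_apply]
    have h0 : 0 ≤ 2 * L + 2 * R ^ 2 := by positivity
    have h1 := abs_walk_le (k := k) hm hL hC hf
    have h2 := abs_walk_le (k := k) hm hL (by positivity) h1
    have h3 := ih (C := C * (2 * L + 2 * R ^ 2) * (2 * L + 2 * R ^ 2)) (by positivity)
      (f := (walk m k ^ 2) f) (fun v => by
      rw [sq, Module.End.mul_apply]; exact h2 v) w
    refine h3.trans (le_of_eq ?_)
    ring

/-! ### Block-multiplicative solutions of the resolvent equation on words. -/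

section Multiplicative

variable (r : Fin 2 → Bool → ℕ → ℝ) (k)

/-- The function of words which is multiplicative over the maximal blocks of equal letters. -/
def blockFun : List (Fin 2) → ℝ
  | [] => 1
  | i :: w => r i (lab k (rest i w)) (run i w + 1) * blockFun (rest i w)
termination_by w => w.length
decreasing_by exact Nat.lt_succ_of_le (length_rest_le _ _)

variable {r}

lemma blockFun_eq (hr : ∀ i l, r i l 0 = 1) (i : Fin 2) (w : List (Fin 2)) :
    blockFun k r w = r i (lab k (rest i w)) (run i w) * blockFun k r (rest i w) := by
  rcases w with _ | ⟨j, w⟩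
  · simp [run, rest, hr]
  · by_cases h : j = i
    · subst h
      rw [run_cons_self, rest_cons_self, blockFun]
    · rw [run_cons_ne h, rest_cons_ne h, hr, one_mul]

lemma abs_blockFun_le {L : ℝ} (hL : 0 ≤ L) (hr : ∀ i l n, |r i l (n + 1)| ≤ L ^ (n + 1))
    (w : List (Fin 2)) : |blockFun k r w| ≤ L ^ w.length := by
  induction w using blockFun.induct with
  | case1 => simp [blockFun]
  | case2 i w ih =>
    rw [blockFun, abs_mul, List.length_cons, ← run_add_length_rest i w, add_right_comm, pow_add]
    exact mul_le_mul (hr _ _ _) ih (abs_nonneg _) (by positivity)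

variable {ω : Fin 2 → Bool → ℝ} {g : Bool → ℝ}

/-- Inside a block of letters i this is the three-term recurrence of r. Where the letter would open
a new block, the initial value r 1 = ω - g⁻¹ produces the correction. -/
lemma step_blockFun (hr : ∀ i l, r i l 0 = 1)
    (hrec0 : ∀ i l, r i l 1 = ω i l - (g l)⁻¹)
    (hrec : ∀ i l n, r i l (n + 2) + jacobi (m i l) n * r i l n
      = ω i (not^[n + 1] l) * r i l (n + 1)) (i : Fin 2) (w : List (Fin 2)) :
    step m k i (blockFun k r) w = ω i (lab k w) * blockFun k r w
      - if run i w = 0 then (g (lab k w))⁻¹ * blockFun k r w else 0 := by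
  have hup : blockFun k r (i :: w)
      = r i (lab k (rest i w)) (run i w + 1) * blockFun k r (rest i w) := by
    rw [blockFun]
  rcases w with _ | ⟨j, v⟩
  · rw [step_nil, hup]
    simp [run, rest, lab, hrec0, blockFun]
  · by_cases h : j = i
    · subst h
      rw [step_cons, hup, if_pos rfl, run_cons_self, rest_cons_self, if_neg (Nat.succ_ne_zero _),
        sub_zero, blockFun_eq k hr j v, blockFun_eq k hr j (j :: v), run_cons_self, rest_cons_self,
        lab_eq_iterate k j (j :: v), run_cons_self, rest_cons_self, weight]
      linear_combination blockFun k r (rest j v) * hrec j (lab k (rest j v)) (run j v)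
    · rw [step_cons, hup, if_neg h, run_cons_ne h, rest_cons_ne h, if_pos rfl, hrec0]
      ring

/-- A nonempty word starts with exactly one of the letters, so one correction g⁻¹ remains; at the
empty word both remain, and the second one is the source term. This is additivity of the 𝒟-valued
R-transform in the form ω = ω_0 + ω_1 - g⁻¹. -/
lemma walk_blockFun (hr : ∀ i l, r i l 0 = 1)
    (hrec0 : ∀ i l, r i l 1 = ω i l - (g l)⁻¹)
    (hrec : ∀ i l n, r i l (n + 2) + jacobi (m i l) n * r i l n
      = ω i (not^[n + 1] l) * r i l (n + 1)) (w : List (Fin 2)) :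
    walk m k (blockFun k r) w
      = (ω 0 (lab k w) + ω 1 (lab k w) - (g (lab k w))⁻¹) * blockFun k r w
        - (g k)⁻¹ * nilFun w := by
  rw [walk_apply, step_blockFun k hr hrec0 hrec, step_blockFun k hr hrec0 hrec]
  rcases w with _ | ⟨j, v⟩
  · simp [run, nilFun, lab, blockFun]; ring
  · have hj : j = 0 ∨ j = 1 := by omega
    rcases hj with rfl | rfl
    · simp [run, nilFun]; ring
    · simp [run, nilFun]; ring

/-- The generating function of the moments of the sum of two free elements. -/
lemma tendsto_sum_walkMoment {R L u z₁ z₂ : ℝ} (hm : ∀ i l, SymmBdd (m i l) R) (hL : 1 ≤ L)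
    (hr : ∀ i l, r i l 0 = 1) (hrL : ∀ i l n, |r i l (n + 1)| ≤ L ^ (n + 1))
    (hrec0 : ∀ i l, r i l 1 = ω i l - (g l)⁻¹)
    (hrec : ∀ i l n, r i l (n + 2) + jacobi (m i l) n * r i l n
      = ω i (not^[n + 1] l) * r i l (n + 1))
    (hz₁ : z₁ = ω 0 k + ω 1 k - (g k)⁻¹) (hz₂ : z₂ = ω 0 (!k) + ω 1 (!k) - (g (!k))⁻¹)
    (hu : 0 < u) (hz : z₁ * z₂ = -u⁻¹) (huL : u * (2 * L + 2 * R ^ 2) ^ 2 < 1) :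
    Tendsto (fun J => (-(u * z₂ * (g k)⁻¹)) *
      ∑ j ∈ Finset.range J, (-u) ^ j * walkMoment m k (2 * j)) atTop (𝓝 1) := by
  set f := blockFun k r with hf
  set c := -(u * z₂ * (g k)⁻¹) with hc
  have hwalk := walk_blockFun (k := k) hr hrec0 hrec
  -- On words of label k two steps of the walk multiply f by z₁z₂ = -u⁻¹, up to the source at the
  -- empty word: a fixed point equation for f.
  have h1 : ∀ w, lab k w = k → f w = (c • nilFun + (-u) • (walk m k ^ 2) f) w := by
    intro w hw
    have h2 : (walk m k ^ 2) f w = z₂ * walk m k f w := by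
      rw [sq, Module.End.mul_apply]
      refine walk_eq_mul m k fun v hv => ?_
      rw [hw] at hv
      -- The source sits at label k, so the first of the two steps, taken at label `!k`, does not
      -- see it.
      have hv0 : v ≠ [] := by
        rintro rfl
        simp [lab] at hv
      rw [hwalk, hv, ← hz₂]
      simp [nilFun, hv0, hf]
    simp only [Pi.add_apply, Pi.smul_apply, smul_eq_mul]
    rw [h2, hwalk, hw, ← hz₁, hc]
    have h3 : u * (z₁ * z₂) = -1 := by rw [hz]; field_simp
    linear_combination (f w) * h3
  -- Iterating gives a truncated Neumann series; the remainder decays geometrically since u times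
  -- the squared growth rate of the walk is below 1.
  have h2 : ∀ J, ∀ w, lab k w = k → f w = c * ∑ j ∈ Finset.range J,
      (-u) ^ j * ((walk m k ^ 2) ^ j) nilFun w + (-u) ^ J * ((walk m k ^ 2) ^ J) f w := by
    intro J
    induction J with
    | zero => intro w _; simp
    | succ J ih =>
      intro w hw
      have h3 := walk_sq_pow_congr m k J h1 w hw
      rw [map_add, map_smul, map_smul] at h3
      simp only [Pi.add_apply, Pi.smul_apply, smul_eq_mul] at h3
      rw [← Module.End.mul_apply, ← pow_succ] at h3
      rw [Finset.sum_range_succ, pow_succ (-u)]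
      have h4 := ih w hw
      rw [h3] at h4
      rw [h4]
      ring
  have h3 : ∀ J, c * ∑ j ∈ Finset.range J, (-u) ^ j * walkMoment m k (2 * j)
      = 1 - (-u) ^ J * ((walk m k ^ 2) ^ J) f [] := by
    intro J
    have h4 := h2 J [] rfl
    have h5 : f [] = 1 := by rw [hf, blockFun]
    rw [h5] at h4
    simp only [walkMoment, pow_mul]
    linarith
  simp_rw [h3]
  set K := (2 * L + 2 * R ^ 2) ^ 2 with hK
  have hK0 : 0 ≤ K := sq_nonneg _
  have h4 : Tendsto (fun J : ℕ => (-u) ^ J * ((walk m k ^ 2) ^ J) f []) atTop (𝓝 0) := by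
    refine squeeze_zero_norm (a := fun J => (u * K) ^ J) (fun J => ?_)
      (tendsto_pow_atTop_nhds_zero_of_lt_one (by positivity) huL)
    have h5 := abs_walk_sq_pow_le (k := k) hm hL J zero_le_one
      (f := f) (fun w => by rw [one_mul]; exact abs_blockFun_le k (by linarith) hrL w) []
    simp only [List.length_nil, pow_zero, mul_one, one_mul] at h5
    rw [norm_mul, norm_pow, norm_neg, Real.norm_of_nonneg hu.le, mul_pow, hK,
      ← pow_mul (2 * L + 2 * R ^ 2)]
    exact mul_le_mul_of_nonneg_left h5 (by positivity)
  simpa using (tendsto_const_nhds (x := (1 : ℝ))).sub h4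

end Multiplicative

end RectConv

/-! ### Entries of the resolvent and the defect of a sum of free elements -/

namespace RectConv

lemma integrable_mul_res {m : Measure ℝ} {R u : ℝ} (h : SymmBdd m R) (hu : 0 ≤ u) {f : ℝ → ℝ}
    (hf : Continuous f) : Integrable (fun x => f x * (1 + u * x ^ 2)⁻¹) m :=
  h.integrable (hf.mul (continuous_res hu))

/-- The normalised entries of the first column of a resolvent in the orthogonal polynomials. -/
noncomputable def resEntry (m : Measure ℝ) (u g : ℝ) (n : ℕ) : ℝ :=
  if Even n then (resMean m u)⁻¹ * ∫ x, orthoFun m n x * (1 + u * x ^ 2)⁻¹ ∂m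
  else -(u / g) * ∫ x, (x * orthoFun m n x) * (1 + u * x ^ 2)⁻¹ ∂m

section

variable {m : Measure ℝ} {R u g : ℝ}

lemma resEntry_zero (hQ : resMean m u ≠ 0) : resEntry m u g 0 = 1 := by
  have : ∫ x, orthoFun m 0 x * (1 + u * x ^ 2)⁻¹ ∂m = resMean m u := by simp [orthoFun, resMean]
  rw [resEntry, if_pos Even.zero, this, inv_mul_cancel₀ hQ]

/-- Integrate u x² (1 + u x²)⁻¹ = 1 - (1 + u x²)⁻¹ against p_n, whose mean vanishes unless n = 0. -/
lemma mul_integral_sq_mul (h : SymmBdd m R) (hu : 0 < u) (n : ℕ) :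
    u * ∫ x, (x * (x * orthoFun m n x)) * (1 + u * x ^ 2)⁻¹ ∂m
      = (if n = 0 then 1 else 0) - ∫ x, orthoFun m n x * (1 + u * x ^ 2)⁻¹ ∂m := by
  rw [← h.integral_orthoFun n, ← integral_const_mul, ← integral_sub
    (h.integrable (continuous_orthoFun m n)) (integrable_mul_res h hu.le (continuous_orthoFun m n))]
  congr 1; ext x
  have := (one_add_pos hu.le x).ne'
  field_simp
  ring

lemma resEntry_one (h : SymmBdd m R) (hu : 0 < u) (hg : g ≠ 0) :
    resEntry m u g 1 = resMean m u / g - g⁻¹ := by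
  have h1 := mul_integral_sq_mul h hu 0
  have h2 : ∫ x, orthoFun m 0 x * (1 + u * x ^ 2)⁻¹ ∂m = resMean m u := by simp [orthoFun, resMean]
  rw [if_pos rfl, h2] at h1
  simp_rw [mul_orthoFun_zero] at h1
  rw [resEntry, if_neg (by decide)]
  have h3 : -(u / g) * ∫ x, (x * orthoFun m 1 x) * (1 + u * x ^ 2)⁻¹ ∂m
      = -(u * ∫ x, (x * orthoFun m 1 x) * (1 + u * x ^ 2)⁻¹ ∂m) / g := by ring
  rw [h3, h1]
  field_simp
  ring

/-- The relation x p_{n+1} = p_{n+2} + c p_n integrated against the resolvent; the factor on the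
right is the ratio of the two normalisations in `resEntry`. -/
lemma resEntry_rec_odd (h : SymmBdd m R) (hu : 0 < u) (hQ : resMean m u ≠ 0) (hg : g ≠ 0) {n : ℕ}
    (hn : Even n) : resEntry m u g (n + 2) + jacobi m n * resEntry m u g n
      = -(g / (u * resMean m u)) * resEntry m u g (n + 1) := by
  have h1 : ¬ Even (n + 1) := by simpa [Nat.even_add_one] using hn
  have h2 : Even (n + 2) := by simpa [Nat.even_add] using hn
  rw [resEntry, if_pos h2, resEntry, if_pos hn, resEntry, if_neg h1]
  simp_rw [mul_orthoFun_succ, add_mul]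
  rw [integral_add (integrable_mul_res h hu.le (continuous_orthoFun m _))
    (by simp_rw [mul_assoc]
        exact (integrable_mul_res h hu.le (continuous_orthoFun m _)).const_mul _)]
  simp_rw [mul_assoc (jacobi m n)]
  rw [integral_const_mul]
  field_simp

/-- Here the relation is multiplied by x, and the resulting x² is removed by `mul_integral_sq_mul`,
with no constant term because n + 1 is positive. -/
lemma resEntry_rec_even (h : SymmBdd m R) (hu : 0 < u) (hQ : resMean m u ≠ 0) (hg : g ≠ 0) {n : ℕ}
    (hn : ¬ Even n) : resEntry m u g (n + 2) + jacobi m n * resEntry m u g n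
      = (resMean m u / g) * resEntry m u g (n + 1) := by
  have h1 : Even (n + 1) := by simpa [Nat.even_add_one] using hn
  have h2 : ¬ Even (n + 2) := by simpa [Nat.even_add] using hn
  rw [resEntry, if_neg h2, resEntry, if_neg hn, resEntry, if_pos h1]
  have h3 := mul_integral_sq_mul h hu (n + 1)
  rw [if_neg (Nat.succ_ne_zero n), zero_sub] at h3
  have e : ∀ x, (x * (x * orthoFun m (n + 1) x)) * (1 + u * x ^ 2)⁻¹
      = (x * orthoFun m (n + 2) x) * (1 + u * x ^ 2)⁻¹
        + jacobi m n * ((x * orthoFun m n x) * (1 + u * x ^ 2)⁻¹) := by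
    intro x; rw [mul_orthoFun_succ]; ring
  have hi : ∀ j, Integrable (fun x => (x * orthoFun m j x) * (1 + u * x ^ 2)⁻¹) m := fun j =>
    integrable_mul_res h hu.le (continuous_id.mul (continuous_orthoFun m j))
  rw [integral_congr_ae (ae_of_all _ e), integral_add (hi _) ((hi _).const_mul _),
    integral_const_mul] at h3
  have key : ∀ A B Z : ℝ, u * (A + jacobi m n * B) = -Z →
      -(u / g) * A + jacobi m n * (-(u / g) * B) = resMean m u / g * ((resMean m u)⁻¹ * Z) := by
    intro A B Z hZ
    field_simp
    linear_combination -hZ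
  exact key _ _ _ h3

lemma abs_integral_mul_res_le (h : SymmBdd m R) (hu : 0 ≤ u) {f : ℝ → ℝ} {C : ℝ}
    (hC : ∀ x, |x| ≤ R → |f x| ≤ C) : |∫ x, f x * (1 + u * x ^ 2)⁻¹ ∂m| ≤ C := by
  have := h.prob
  have h1 : ∀ᵐ x ∂m, ‖f x * (1 + u * x ^ 2)⁻¹‖ ≤ C := by
    filter_upwards [h.bdd] with x hx
    rw [norm_mul, Real.norm_of_nonneg (res_nonneg hu x), Real.norm_eq_abs]
    exact (mul_le_of_le_one_right (abs_nonneg _) (res_le_one hu x)).trans (hC x hx)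
  simpa using norm_integral_le_of_norm_le_const h1

/-- The normalising factor is at most 2 and is absorbed by a spare power of 2R ≥ 2. -/
lemma abs_resEntry_le (h : SymmBdd m R) (hu : 0 ≤ u) (hQ : 1 / 2 ≤ resMean m u)
    (hug : u ≤ 2 * |g|) (n : ℕ) : |resEntry m u g (n + 1)| ≤ (4 * R ^ 2) ^ (n + 1) := by
  have hR := h.one_le
  have hpow : (2 * R) ^ (n + 1) * (2 * R) ≤ (4 * R ^ 2) ^ (n + 1) := by
    have e : (4 * R ^ 2) ^ (n + 1) = (2 * R) ^ (n + 1) * (2 * R) ^ (n + 1) := by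
      rw [← mul_pow]; ring
    rw [e]
    have : 2 * R ≤ (2 * R) ^ (n + 1) := le_self_pow₀ (by linarith) (Nat.succ_ne_zero n)
    gcongr
  rw [resEntry]
  split_ifs
  · have h1 := abs_integral_mul_res_le h hu (f := orthoFun m (n + 1))
      fun x hx => h.abs_orthoFun_le (n + 1) hx
    have h2 : |(resMean m u)⁻¹| ≤ 2 := by
      rw [abs_inv, abs_of_nonneg (by linarith)]
      exact (inv_anti₀ (by norm_num) hQ).trans (by norm_num)
    rw [abs_mul]
    calc _ ≤ 2 * (2 * R) ^ (n + 1) := mul_le_mul h2 h1 (abs_nonneg _) (by norm_num)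
      _ ≤ (2 * R) ^ (n + 1) * (2 * R) := by
        rw [mul_comm]; gcongr; linarith
      _ ≤ _ := hpow
  · have h1 := abs_integral_mul_res_le h hu (f := fun x => x * orthoFun m (n + 1) x)
      (C := R * (2 * R) ^ (n + 1)) fun x hx => by
        rw [abs_mul]
        exact mul_le_mul hx (h.abs_orthoFun_le (n + 1) hx) (abs_nonneg _) (by linarith)
    have h2 : |(-(u / g))| ≤ 2 := by
      rw [abs_neg, abs_div, abs_of_nonneg hu]
      exact div_le_of_le_mul₀ (abs_nonneg g) (by norm_num) hug
    rw [abs_mul]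
    calc _ ≤ 2 * (R * (2 * R) ^ (n + 1)) := mul_le_mul h2 h1 (abs_nonneg _) (by norm_num)
      _ = (2 * R) ^ (n + 1) * (2 * R) := by ring
      _ ≤ _ := hpow

end

/-- The distribution `lam μ + (1 - lam) δ₀`. -/
noncomputable def dilute (lam : ℝ) (μ : Measure ℝ) : Measure ℝ :=
  ENNReal.ofReal lam • μ + ENNReal.ofReal (1 - lam) • Measure.dirac 0

/-- The distributions of an element with respect to the two functionals. -/
noncomputable def cornerLaw (lam : ℝ) (μ : Fin 2 → Measure ℝ) (i : Fin 2) : Bool → Measure ℝ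
  | true => μ i
  | false => dilute lam (μ i)

section

variable {lam : ℝ} {m : Measure ℝ} {R : ℝ}

lemma integral_dilute (h0 : 0 ≤ lam) (h1 : lam ≤ 1) {f : ℝ → ℝ} (hf : Integrable f m) :
    ∫ x, f x ∂(dilute lam m) = lam * ∫ x, f x ∂m + (1 - lam) * f 0 := by
  have hd : Integrable f (Measure.dirac (0 : ℝ)) := integrable_dirac (by simp)
  unfold dilute
  rw [integral_add_measure (hf.smul_measure ENNReal.ofReal_ne_top)
    (hd.smul_measure ENNReal.ofReal_ne_top), integral_smul_measure, integral_smul_measure,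
    integral_dirac, ENNReal.toReal_ofReal h0, ENNReal.toReal_ofReal (by linarith)]
  simp

lemma SymmBdd.dilute (h : SymmBdd m R) (h0 : 0 ≤ lam) (h1 : lam ≤ 1) :
    SymmBdd (dilute lam m) R where
  prob := by
    have := h.prob
    constructor
    simp only [RectConv.dilute, Measure.coe_add, Measure.coe_smul, Pi.add_apply, Pi.smul_apply,
      measure_univ, smul_eq_mul, mul_one]
    rw [← ENNReal.ofReal_add h0 (by linarith)]
    simp
  symm := by
    have := h.symm
    constructor
    rw [RectConv.dilute, Measure.neg, Measure.map_add _ _ measurable_neg, Measure.map_smul,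
      Measure.map_smul, Measure.map_neg_eq_self m, Measure.map_dirac' measurable_neg, neg_zero]
  bdd := by
    have hR := h.one_le
    rw [RectConv.dilute, ae_add_measure_iff]
    refine ⟨Measure.ae_smul_measure h.bdd _, Measure.ae_smul_measure ?_ _⟩
    rw [ae_dirac_iff (measurableSet_le (by fun_prop) measurable_const)]
    simp; linarith
  one_le := h.one_le

lemma resMean_dilute [IsProbabilityMeasure m] (h0 : 0 ≤ lam) (h1 : lam ≤ 1) {u : ℝ} (hu : 0 ≤ u) :
    resMean (dilute lam m) u = 1 - lam * defect m u := by
  unfold resMean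
  rw [integral_dilute h0 h1 (integrable_res hu)]
  unfold defect resMean
  simp
  ring

lemma SymmBdd.cornerLaw {μ : Fin 2 → Measure ℝ} (h : ∀ i, SymmBdd (μ i) R) (h0 : 0 ≤ lam)
    (h1 : lam ≤ 1) (i : Fin 2) (l : Bool) : SymmBdd (cornerLaw lam μ i l) R := by
  cases l
  · exact (h i).dilute h0 h1
  · exact h i

lemma SymmBdd.mono (h : SymmBdd m R) {R' : ℝ} (hR : R ≤ R') : SymmBdd m R' where
  prob := h.prob
  symm := h.symm
  bdd := h.bdd.mono fun _ hx => hx.trans hR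
  one_le := h.one_le.trans hR

end

/-- The resolvent mean of the sum of two free elements, as a power series. -/
lemma tendsto_sum_walkMoment_of_defect {lam R y u : ℝ} {μ : Fin 2 → Measure ℝ} {v : Fin 2 → ℝ}
    (hμ : ∀ i, SymmBdd (μ i) R) (h0 : 0 ≤ lam) (h1 : lam ≤ 1) (hy : 0 < y)
    (hv : ∀ i, 0 < v i) (hv1 : ∀ i, v i ≤ 2) (hvy : ∀ i, v i ≤ 2 * y)
    (hd : ∀ i, defect (μ i) (v i) ≤ 1 / 4)
    (hvi : ∀ i, v i * ((1 - defect (μ i) (v i)) * (1 - lam * defect (μ i) (v i))) = y)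
    (hu : u = y / ((1 - (defect (μ 0) (v 0) + defect (μ 1) (v 1))) *
      (1 - lam * (defect (μ 0) (v 0) + defect (μ 1) (v 1)))))
    (huR : u * (2 * (4 * R ^ 2) + 2 * R ^ 2) ^ 2 < 1) :
    Tendsto (fun J => ∑ j ∈ Finset.range J, (-u) ^ j * walkMoment (cornerLaw lam μ) true (2 * j))
      atTop (𝓝 (1 - (defect (μ 0) (v 0) + defect (μ 1) (v 1)))) := by
  have hprob : ∀ i, IsProbabilityMeasure (μ i) := fun i => (hμ i).prob
  set d := fun i => defect (μ i) (v i) with hdd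
  have hd0 : ∀ i, 0 ≤ d i := fun i => by have := hprob i; exact defect_nonneg (hv i).le
  set D := d 0 + d 1 with hD
  have hD0 : 0 ≤ D := add_nonneg (hd0 0) (hd0 1)
  have hD1 : D ≤ 1 / 2 := by have := hd 0; have := hd 1; simp only [hD, hdd]; linarith
  have hlD : lam * D ≤ 1 / 2 := by nlinarith
  have hp1 : 0 < 1 - D := by linarith
  have hp2 : 0 < 1 - lam * D := by linarith
  have hu' : u = y / ((1 - D) * (1 - lam * D)) := hu
  have hu0 : 0 < u := by rw [hu']; positivity
  -- The two diagonal entries of the common 𝒟-valued Cauchy transform. Rescaling the corners against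
  -- each other leaves only their product -y invariant, so one entry is normalised to 1.
  set g : Bool → ℝ := fun l => if l then 1 else -y with hg
  have hgt : g true = 1 := rfl
  have hgf : g false = -y := rfl
  have hg0 : ∀ l, g l ≠ 0 := by rintro (_ | _) <;> simp [hg, hy.ne']
  set m := cornerLaw lam μ with hm
  have hQt : ∀ i, resMean (m i true) (v i) = 1 - d i := fun i => by
    simp [hm, cornerLaw, hdd, defect]
  have hQf : ∀ i, resMean (m i false) (v i) = 1 - lam * d i := fun i => by
    have := hprob i
    exact resMean_dilute h0 h1 (hv i).le
  have hQ : ∀ i l, 1 / 2 ≤ resMean (m i l) (v i) := by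
    intro i l
    have h2 := hd i
    have h3 := hd0 i
    cases l
    · rw [hQf]; simp only [hdd] at *; nlinarith
    · rw [hQt]; simp only [hdd] at *; linarith
  have hQ0 : ∀ i l, resMean (m i l) (v i) ≠ 0 := fun i l => by
    have := hQ i l
    intro h; rw [h] at this; norm_num at this
  have hmS : ∀ i l, SymmBdd (m i l) R := fun i l => SymmBdd.cornerLaw hμ h0 h1 i l
  have hR : 1 ≤ R := (hμ 0).one_le
  -- With ω = resMean/g this says ω_i(l) ω_i(!l) = -1/v_i, so the constants of the odd and even
  -- recurrences are the values of a single ω at the two labels.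
  have hprod : ∀ i l, -(g l / (v i * resMean (m i l) (v i))) = resMean (m i (!l)) (v i) / g (!l) := by
    intro i l
    have h2 := hvi i
    have h3 := hQ0 i true
    have h4 := hQ0 i false
    rw [hQt] at h3
    rw [hQf] at h4
    have h5 := (hv i).ne'
    cases l
    · rw [Bool.not_false, hQf, hQt, hgt, hgf]
      field_simp
      rw [← h2]; ring
    · rw [Bool.not_true, hQf, hQt, hgt, hgf]
      field_simp
      rw [← h2]; ring
  -- Now z₁z₂ = -(1 - D)(1 - λD)/y, which equals -u⁻¹ exactly for the prescribed u.
  have key := tendsto_sum_walkMoment (m := m) (k := true)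
    (r := fun i l => resEntry (m i l) (v i) (g l))
    (ω := fun i l => resMean (m i l) (v i) / g l) (g := g) (R := R) (L := 4 * R ^ 2) (u := u)
    (z₁ := 1 - D) (z₂ := -(1 - lam * D) / y) hmS (by nlinarith)
    (fun i l => resEntry_zero (hQ0 i l))
    (fun i l n => abs_resEntry_le (hmS i l) (hv i).le (hQ i l) (by
      cases l
      · rw [hgf, abs_neg, abs_of_pos hy]; exact hvy i
      · rw [hgt, abs_one]; linarith [hv1 i]) n)
    (fun i l => resEntry_one (hmS i l) (hv i) (hg0 l))
    (fun i l n => by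
      by_cases hn : Even n
      · rw [resEntry_rec_odd (hmS i l) (hv i) (hQ0 i l) (hg0 l) hn, hprod,
          Function.iterate_succ_apply', (Bool.involutive_not.iterate_even hn)]
        rfl
      · have hn' : Even (n + 1) := by simpa [Nat.even_add_one] using hn
        rw [resEntry_rec_even (hmS i l) (hv i) (hQ0 i l) (hg0 l) hn,
          Bool.involutive_not.iterate_even hn']
        rfl)
    (by rw [hQt, hQt, hgt]; simp only [hD]; ring)
    (by simp only [Bool.not_true]; rw [hQf, hQf, hgf]; simp only [hD]; field_simp; ring) hu0
    (by rw [hu']; field_simp) huR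
  rw [hgt] at key
  have hc : -(u * (-(1 - lam * D) / y) * (1 : ℝ)⁻¹) = (1 - D)⁻¹ := by
    rw [hu']
    have : 1 - D * lam ≠ 0 := by rw [mul_comm]; exact hp2.ne'
    have := hp1.ne'
    have := hy.ne'
    field_simp
  rw [hc] at key
  have := key.const_mul (1 - D)
  simp only [mul_one] at this
  refine this.congr fun J => ?_
  rw [← mul_assoc, mul_inv_cancel₀ hp1.ne', one_mul]

end RectConv

/-! ### Free letters: the distribution of the sum of two free elements -/

namespace RectConv

/-- Two letters `X i` which are odd for the grading by the complementary projections `p true`,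
`p false`. -/
structure LetterSystem (A : Type*) [Ring A] where
  p : Bool → A
  X : Fin 2 → A
  p_mul_self : ∀ l, p l * p l = p l
  p_mul_not : ∀ l, p l * p (!l) = 0
  p_add : p true + p false = 1
  X_mul_p : ∀ i l, X i * p l = p (!l) * X i

/-- The common structure of models of two self-adjoint letters `X i` which are odd for the grading
by the projections `p true`, `p false` and free with amalgamation over their span. -/
structure FreeLetters (m : Fin 2 → Bool → Measure ℝ) (A : Type*) [Ring A] [Algebra ℂ A]
    extends LetterSystem A where
  φ : Bool → A →ₗ[ℂ] ℂ
  B : Fin 2 → Subalgebra ℂ A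
  corner : ∀ l x, φ l x = φ l (p l * x * p l)
  unit : ∀ l, φ l (p l) = 1
  moment : ∀ i l n, φ l (X i ^ n) = ((∫ x, x ^ n ∂(m i l) : ℝ) : ℂ)
  p_mem : ∀ i l, p l ∈ B i
  X_mem : ∀ i, X i ∈ B i
  free : ∀ w : List (Fin 2 × A), w ≠ [] → (∀ x ∈ w, x.2 ∈ B x.1 ∧ ∀ l, φ l x.2 = 0) →
    w.IsChain (fun x y => x.1 ≠ y.1) → ∀ l, φ l (w.map Prod.snd).prod = 0

lemma head?_rest_ne (i : Fin 2) (w : List (Fin 2)) : ∀ j ∈ (rest i w).head?, i ≠ j := by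
  induction w with
  | nil => simp [rest]
  | cons a w ih =>
    simp only [rest]
    split_ifs with h
    · exact ih
    · intro j hj
      simp only [List.head?_cons, Option.mem_some_iff] at hj
      rw [← hj]; exact fun e => h e.symm

/-- A subspace which contains `1` and is stable under left multiplication by a set contains the
algebra generated by that set. -/
lemma adjoin_le_of_mul_mem {A : Type*} [Ring A] [Algebra ℂ A] {s : Set A} {M : Submodule ℂ A}
    (h1 : 1 ∈ M) (h : ∀ a ∈ s, ∀ x ∈ M, a * x ∈ M) {z : A} (hz : z ∈ Algebra.adjoin ℂ s) :
    z ∈ M := by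
  suffices h : ∀ x ∈ M, z * x ∈ M by simpa using h 1 h1
  induction hz using Algebra.adjoin_induction with
  | mem y hy => exact h y hy
  | algebraMap r =>
    intro x hx
    rw [← Algebra.smul_def]
    exact M.smul_mem r hx
  | add a b _ _ ha hb =>
    intro x hx
    rw [add_mul]
    exact add_mem (ha x hx) (hb x hx)
  | mul a b _ _ ha hb =>
    intro x hx
    rw [mul_assoc]
    exact ha _ (hb x hx)

namespace LetterSystem

variable {A : Type*} [Ring A] (S : LetterSystem A)

lemma p_mul (l l' : Bool) : S.p l * S.p l' = if l = l' then S.p l else 0 := by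
  split_ifs with h
  · subst h; exact S.p_mul_self l
  · have : l' = !l := by cases l <;> cases l' <;> simp_all
    rw [this]; exact S.p_mul_not l

lemma X_pow_mul_p (i : Fin 2) (n : ℕ) (l : Bool) : S.X i ^ n * S.p l = S.p (not^[n] l) * S.X i ^ n := by
  induction n generalizing l with
  | zero => simp
  | succ n ih =>
    rw [pow_succ, mul_assoc, S.X_mul_p, ← mul_assoc, ih, mul_assoc, Function.iterate_succ_apply]

/-- The product of the letters of a word. -/
def wordProd (w : List (Fin 2)) : A := (w.map S.X).prod

lemma wordProd_cons (i : Fin 2) (w : List (Fin 2)) :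
    S.wordProd (i :: w) = S.X i * S.wordProd w := by simp [wordProd]

lemma wordProd_mul_p (w : List (Fin 2)) (l : Bool) :
    S.wordProd w * S.p l = S.p (lab l w) * S.wordProd w := by
  induction w with
  | nil => simp [wordProd, lab]
  | cons i w ih => rw [wordProd_cons, mul_assoc, ih, ← mul_assoc, S.X_mul_p, mul_assoc, lab]

lemma p_mul_wordProd_mul_p (w : List (Fin 2)) (l₁ l₂ l : Bool) :
    S.p l₁ * (S.wordProd w * S.p l) * S.p l₂
      = if l = l₂ ∧ lab l₂ w = l₁ then S.wordProd w * S.p l₂ else 0 := by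
  rw [← mul_assoc, mul_assoc _ (S.p l), p_mul]
  by_cases h : l = l₂
  · subst h
    rw [if_pos rfl, mul_assoc, wordProd_mul_p, ← mul_assoc, p_mul]
    by_cases h' : lab l w = l₁
    · subst h'; simp
    · rw [if_neg (Ne.symm h'), if_neg (by tauto), zero_mul]
  · rw [if_neg h, if_neg (by tauto), mul_zero]

variable [Algebra ℂ A]

/-- The linear span of the `X i ^ n * p l`. -/
def letterSpan (i : Fin 2) : Submodule ℂ A :=
  Submodule.span ℂ (range fun q : ℕ × Bool => S.X i ^ q.1 * S.p q.2)

variable {S} in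
lemma letterSpan_induction {i : Fin 2} {P : A → Prop} (hX : ∀ n l, P (S.X i ^ n * S.p l))
    (h0 : P 0) (hadd : ∀ x y, P x → P y → P (x + y)) (hsmul : ∀ (c : ℂ) x, P x → P (c • x))
    {b : A} (hb : b ∈ S.letterSpan i) : P b := by
  induction hb using Submodule.span_induction with
  | mem x hx => obtain ⟨q, rfl⟩ := hx; exact hX _ _
  | zero => exact h0
  | add x y _ _ hx hy => exact hadd x y hx hy
  | smul c x _ hx => exact hsmul c x hx

lemma pow_mul_p_mem (i : Fin 2) (n : ℕ) (l : Bool) : S.X i ^ n * S.p l ∈ S.letterSpan i :=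
  Submodule.subset_span ⟨(n, l), rfl⟩

lemma p_mem_letterSpan (i : Fin 2) (l : Bool) : S.p l ∈ S.letterSpan i := by
  simpa using S.pow_mul_p_mem i 0 l

lemma pow_mem_letterSpan (i : Fin 2) (n : ℕ) : S.X i ^ n ∈ S.letterSpan i := by
  have := add_mem (S.pow_mul_p_mem i n true) (S.pow_mul_p_mem i n false)
  rwa [← mul_add, S.p_add, mul_one] at this

lemma X_mem_letterSpan (i : Fin 2) : S.X i ∈ S.letterSpan i := by
  simpa using S.pow_mem_letterSpan i 1

lemma X_mul_mem {i : Fin 2} {b : A} (hb : b ∈ S.letterSpan i) : S.X i * b ∈ S.letterSpan i := by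
  refine letterSpan_induction (P := fun b => S.X i * b ∈ S.letterSpan i) ?_ ?_ ?_ ?_ hb
  · intro n l; rw [← mul_assoc, ← pow_succ']; exact S.pow_mul_p_mem i _ l
  · simp
  · intro x y hx hy; rw [mul_add]; exact add_mem hx hy
  · intro c x hx; rw [mul_smul_comm]; exact Submodule.smul_mem _ c hx

lemma p_mul_mem {i : Fin 2} {b : A} (l : Bool) (hb : b ∈ S.letterSpan i) :
    S.p l * b ∈ S.letterSpan i := by
  refine letterSpan_induction (P := fun b => S.p l * b ∈ S.letterSpan i) ?_ ?_ ?_ ?_ hb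
  · intro n l'
    rw [X_pow_mul_p, ← mul_assoc, p_mul]
    split_ifs
    · rename_i h; rw [h, ← X_pow_mul_p]; exact S.pow_mul_p_mem i n l'
    · simp
  · simp
  · intro x y hx hy; rw [mul_add]; exact add_mem hx hy
  · intro c x hx; rw [mul_smul_comm]; exact Submodule.smul_mem _ c hx

lemma mul_mem_letterSpan {i : Fin 2} {b c : A} (hb : b ∈ S.letterSpan i)
    (hc : c ∈ S.letterSpan i) : b * c ∈ S.letterSpan i := by
  refine letterSpan_induction (P := fun b => b * c ∈ S.letterSpan i) ?_ ?_ ?_ ?_ hb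
  · intro n l
    rw [mul_assoc]
    have := S.p_mul_mem l hc
    induction n with
    | zero => simpa using this
    | succ n ih => rw [pow_succ', mul_assoc]; exact S.X_mul_mem ih
  · simp
  · intro x y hx hy; rw [add_mul]; exact add_mem hx hy
  · intro a x hx; rw [smul_mul_assoc]; exact Submodule.smul_mem _ a hx

/-- The algebra generated by the projections and the letters. -/
def generated : Subalgebra ℂ A := Algebra.adjoin ℂ (range S.p ∪ range S.X)

lemma p_mem_generated (l : Bool) : S.p l ∈ S.generated :=
  Algebra.subset_adjoin (Or.inl ⟨l, rfl⟩)

lemma X_mem_generated (i : Fin 2) : S.X i ∈ S.generated :=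
  Algebra.subset_adjoin (Or.inr ⟨i, rfl⟩)

variable {S}

lemma generated_le {M : Submodule ℂ A} (h1 : 1 ∈ M) (hp : ∀ l, ∀ x ∈ M, S.p l * x ∈ M)
    (hX : ∀ i, ∀ x ∈ M, S.X i * x ∈ M) {z : A} (hz : z ∈ S.generated) : z ∈ M := by
  refine adjoin_le_of_mul_mem h1 (fun a ha => ?_) hz
  rcases ha with ⟨l, rfl⟩ | ⟨i, rfl⟩
  · exact hp l
  · exact hX i

lemma mem_letterSpan_of_mem_adjoin {i : Fin 2} {z : A}
    (hz : z ∈ Algebra.adjoin ℂ (range S.p ∪ {S.X i})) : z ∈ S.letterSpan i := by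
  refine adjoin_le_of_mul_mem (by simpa using S.pow_mem_letterSpan i 0) (fun a ha x hx => ?_) hz
  rcases ha with ⟨l, rfl⟩ | rfl
  · exact S.p_mul_mem l hx
  · exact S.X_mul_mem hx

variable (S)

lemma wordProd_mem (w : List (Fin 2)) : S.wordProd w ∈ S.generated := by
  induction w with
  | nil => exact one_mem _
  | cons i w ih => rw [wordProd_cons]; exact mul_mem (S.X_mem_generated i) ih

/-- Projections can be pushed to the right through the letters, so words followed by one projection
span the algebra. -/
lemma generated_induction {P : A → Prop} (hw : ∀ w l, P (S.wordProd w * S.p l))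
    (h0 : P 0) (hadd : ∀ x y, P x → P y → P (x + y)) (hsmul : ∀ (c : ℂ) x, P x → P (c • x))
    {z : A} (hz : z ∈ S.generated) : P z := by
  let M : Submodule ℂ A := Submodule.span ℂ {x | ∃ w l, x = S.wordProd w * S.p l}
  have hM : z ∈ M := by
    refine generated_le ?_ (fun l x hx => ?_) (fun i x hx => ?_) hz
    · rw [← S.p_add]
      exact add_mem (Submodule.subset_span ⟨[], true, by simp [wordProd]⟩)
        (Submodule.subset_span ⟨[], false, by simp [wordProd]⟩)
    · induction hx using Submodule.span_induction with
      | mem x hx =>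
        obtain ⟨w, l', rfl⟩ := hx
        rw [wordProd_mul_p, ← mul_assoc, p_mul]
        split_ifs with h
        · rw [h, ← wordProd_mul_p]; exact Submodule.subset_span ⟨w, l', rfl⟩
        · simp
      | zero => simp
      | add x y _ _ hx hy => rw [mul_add]; exact add_mem hx hy
      | smul c x _ hx => rw [mul_smul_comm]; exact Submodule.smul_mem _ c hx
    · induction hx using Submodule.span_induction with
      | mem x hx =>
        obtain ⟨w, l', rfl⟩ := hx
        rw [← mul_assoc, ← wordProd_cons]
        exact Submodule.subset_span ⟨_, l', rfl⟩
      | zero => simp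
      | add x y _ _ hx hy => rw [mul_add]; exact add_mem hx hy
      | smul c x _ hx => rw [mul_smul_comm]; exact Submodule.smul_mem _ c hx
  clear hz
  induction hM using Submodule.span_induction with
  | mem x hx => obtain ⟨w, l, rfl⟩ := hx; exact hw w l
  | zero => exact h0
  | add x y _ _ hx hy => exact hadd x y hx hy
  | smul c x _ hx => exact hsmul c x hx

end LetterSystem

namespace FreeLetters

variable {m : Fin 2 → Bool → Measure ℝ} {A : Type*} [Ring A] [Algebra ℂ A] (S : FreeLetters m A)

lemma φ_mul_p (l l' : Bool) (x : A) : S.φ l (x * S.p l') = if l = l' then S.φ l x else 0 := by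
  rw [S.corner, mul_assoc, mul_assoc, S.p_mul]
  by_cases h : l = l'
  · subst h
    rw [if_pos rfl, if_pos rfl, ← mul_assoc, ← S.corner]
  · rw [if_neg (Ne.symm h), if_neg h]; simp

lemma φ_p_mul (l l' : Bool) (x : A) : S.φ l (S.p l' * x) = if l = l' then S.φ l x else 0 := by
  rw [S.corner, ← mul_assoc, S.p_mul]
  by_cases h : l = l'
  · subst h
    rw [if_pos rfl, if_pos rfl, ← S.corner]
  · rw [if_neg h, if_neg h]; simp

/-- The orthogonal polynomials, evaluated at a letter. -/
noncomputable def chain (i : Fin 2) (l : Bool) : ℕ → A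
  | 0 => 1
  | 1 => S.X i
  | n + 2 => S.X i * chain i l (n + 1) - ((jacobi (m i l) n : ℝ) : ℂ) • chain i l n

lemma chain_mem (i : Fin 2) (l : Bool) (n : ℕ) : S.chain i l n ∈ S.B i := by
  induction n using Nat.twoStepInduction with
  | zero => exact one_mem _
  | one => exact S.X_mem i
  | more n h0 h1 => exact sub_mem (mul_mem (S.X_mem i) h1) (Subalgebra.smul_mem _ h0 _)

/-- The recursion defining `chain` is that of `orthoMoment`, and the starting values are moments of
the letter. -/
lemma φ_pow_mul_chain {R : ℝ} (hm : ∀ i l, SymmBdd (m i l) R) (i : Fin 2) (l : Bool) (n : ℕ) :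
    ∀ k, S.φ l (S.X i ^ k * S.chain i l n) = (orthoMoment (m i l) k n : ℂ) := by
  induction n using Nat.twoStepInduction with
  | zero =>
    intro k
    rw [chain, mul_one, S.moment, orthoMoment_zero_right]
  | one =>
    intro k
    rw [chain, ← pow_succ, S.moment, ← orthoMoment_succ_zero, orthoMoment_zero_right]
  | more n h0 h1 =>
    intro k
    rw [chain, mul_sub, ← mul_assoc, ← pow_succ, map_sub, h1, mul_smul_comm, map_smul, h0,
      (hm i l).orthoMoment_succ_succ]
    push_cast
    simp

/-- The polynomial is orthogonal to 1 for the law of the corner `l` only; the factor `p l` silences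
the other corner. -/
lemma φ_chain_mul_p {R : ℝ} (hm : ∀ i l, SymmBdd (m i l) R) (i : Fin 2) (l : Bool) (n : ℕ)
    (l' : Bool) : S.φ l' (S.chain i l (n + 1) * S.p l) = 0 := by
  rw [S.φ_mul_p]
  split_ifs with h
  · subst h
    have := S.φ_pow_mul_chain hm i l' (n + 1) 0
    rw [pow_zero, one_mul] at this
    rw [this, (hm i l').orthoMoment_zero_left]
    simp
  · rfl

/-- The element of the model attached to a word. -/
noncomputable def wordElt (k : Bool) : List (Fin 2) → A
  | [] => S.p k
  | i :: w => S.X i * wordElt k w - match w with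
    | [] => 0
    | j :: v => if j = i then ((weight m k i v : ℝ) : ℂ) • wordElt k v else 0

lemma wordElt_singleton (k : Bool) (i : Fin 2) : S.wordElt k [i] = S.X i * S.wordElt k [] := by
  simp [wordElt]

lemma wordElt_cons_cons (k : Bool) (i j : Fin 2) (v : List (Fin 2)) :
    S.wordElt k (i :: j :: v) = S.X i * S.wordElt k (j :: v)
      - if j = i then ((weight m k i v : ℝ) : ℂ) • S.wordElt k v else 0 := by
  rw [wordElt.eq_def]

/-- Along the leading block the recursion of `wordElt` is that of `chain`, because `weight` depends
only on the length of the block and the label beneath it. -/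
lemma wordElt_eq (k : Bool) (i : Fin 2) (w : List (Fin 2)) :
    S.wordElt k w = S.chain i (lab k (rest i w)) (run i w) * S.wordElt k (rest i w) := by
  induction h : w.length using Nat.strong_induction_on generalizing w with
  | _ n ih =>
  rcases w with _ | ⟨j, v⟩
  · simp [run, rest, chain]
  by_cases hj : j = i
  swap
  · rw [run_cons_ne hj, rest_cons_ne hj, chain, one_mul]
  subst hj
  rw [run_cons_self, rest_cons_self]
  have ih1 := ih _ (by rw [← h]; simp) v rfl
  rcases v with _ | ⟨j', v'⟩
  · simp [wordElt, run, rest, chain]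
  by_cases hj' : j' = j
  swap
  · rw [wordElt]
    simp only [if_neg hj', sub_zero, run_cons_ne hj', rest_cons_ne hj']
    rfl
  subst hj'
  have ih2 := ih _ (by rw [← h]; simp) v' rfl
  rw [run_cons_self, rest_cons_self] at *
  rw [wordElt]
  simp only [if_true]
  rw [ih1, chain, sub_mul, mul_assoc, smul_mul_assoc, ← ih2]
  rfl

lemma p_mul_wordElt (k : Bool) (w : List (Fin 2)) :
    S.p (lab k w) * S.wordElt k w = S.wordElt k w := by
  induction h : w.length using Nat.strong_induction_on generalizing w with
  | _ n ih =>
  rcases w with _ | ⟨i, v⟩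
  · exact S.p_mul_self k
  have ih1 := ih _ (by rw [← h]; simp) v rfl
  rcases v with _ | ⟨j, v'⟩
  · rw [wordElt_singleton, lab, ← mul_assoc, ← S.X_mul_p, mul_assoc, ih1]
  rw [wordElt_cons_cons, mul_sub, lab, ← mul_assoc, ← S.X_mul_p, mul_assoc, ih1]
  congr 1
  have ih2 := ih _ (by rw [← h]; simp) v' rfl
  split_ifs
  · rw [lab, Bool.not_not, mul_smul_comm, ih2]
  · simp

/-- Each block gives a polynomial of positive degree in its letter, cut by a projection; it is
centred by orthogonality, and neighbouring blocks carry different letters. -/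
lemma exists_factors {R : ℝ} (hm : ∀ i l, SymmBdd (m i l) R) (k : Bool) (w : List (Fin 2)) :
    ∃ L : List (Fin 2 × A), S.wordElt k w = (L.map Prod.snd).prod * S.p k ∧
      (∀ x ∈ L, x.2 ∈ S.B x.1 ∧ ∀ l, S.φ l x.2 = 0) ∧ L.IsChain (fun x y => x.1 ≠ y.1) ∧
      L.head?.map Prod.fst = w.head? := by
  induction h : w.length using Nat.strong_induction_on generalizing w with
  | _ n ih =>
  rcases w with _ | ⟨i, v⟩
  · exact ⟨[], by simp [wordElt], by simp, List.isChain_nil, rfl⟩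
  obtain ⟨L, h1, h2, h3, h4⟩ := ih _ (by
    rw [← h, List.length_cons]; exact Nat.lt_succ_of_le (length_rest_le i v)) (rest i v) rfl
  refine ⟨(i, S.chain i (lab k (rest i v)) (run i v + 1) * S.p (lab k (rest i v))) :: L,
    ?_, ?_, ?_, rfl⟩
  · rw [S.wordElt_eq k i, run_cons_self, rest_cons_self, List.map_cons, List.prod_cons, mul_assoc,
      mul_assoc, ← h1, p_mul_wordElt]
  · intro x hx
    rcases List.mem_cons.1 hx with rfl | hx
    · exact ⟨mul_mem (S.chain_mem _ _ _) (S.p_mem _ _), S.φ_chain_mul_p hm _ _ _⟩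
    · exact h2 x hx
  · rw [List.isChain_cons]
    refine ⟨fun y hy => ?_, h3⟩
    refine head?_rest_ne i v _ ?_
    rw [← h4, Option.mem_def.1 hy]
    rfl

lemma φ_wordElt {R : ℝ} (hm : ∀ i l, SymmBdd (m i l) R) (k : Bool) (w : List (Fin 2)) :
    S.φ k (S.wordElt k w) = (nilFun w : ℂ) := by
  by_cases hw : w = []
  · subst hw
    simp [wordElt, nilFun, S.unit]
  · obtain ⟨L, h1, h2, h3, h4⟩ := S.exists_factors hm k w
    rw [h1, S.φ_mul_p, if_pos rfl, S.free L ?_ h2 h3]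
    · simp [nilFun, hw]
    · rintro rfl
      rcases w with _ | ⟨i, v⟩
      · exact hw rfl
      · simp at h4

/-- A letter times a word element is the longer word element plus a weight times a shorter one. The
walk acts on the functions w ↦ φ(Sⁿ e_w), S being the sum of the letters and e_w the word element,
which explains the dual form of `step`. -/
lemma φ_pow_mul_wordElt {R : ℝ} (hm : ∀ i l, SymmBdd (m i l) R) (k : Bool) (n : ℕ) :
    ∀ w, S.φ k ((S.X 0 + S.X 1) ^ n * S.wordElt k w) = (((walk m k ^ n) nilFun w : ℝ) : ℂ) := by
  induction n with
  | zero => intro w; simpa using S.φ_wordElt hm k w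
  | succ n ih =>
    intro w
    have hs : ∀ i, S.φ k ((S.X 0 + S.X 1) ^ n * (S.X i * S.wordElt k w))
        = ((step m k i ((walk m k ^ n) nilFun) w : ℝ) : ℂ) := by
      intro i
      rcases w with _ | ⟨j, v⟩
      · rw [← wordElt_singleton, ih, step_nil]
      · have h1 : S.X i * S.wordElt k (j :: v) = S.wordElt k (i :: j :: v)
            + if j = i then ((weight m k i v : ℝ) : ℂ) • S.wordElt k v else 0 := by
          rw [wordElt_cons_cons, sub_add_cancel]
        rw [h1, mul_add, map_add, ih, step_cons]
        push_cast
        congr 1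
        split_ifs
        · rw [mul_smul_comm, map_smul, ih]; simp
        · simp
    rw [pow_succ, pow_succ', mul_assoc, add_mul, mul_add, map_add, hs, hs, Module.End.mul_apply,
      walk_apply]
    push_cast
    rfl

/-- The moments of the sum of two free letters do not depend on the model. -/
lemma φ_pow {R : ℝ} (hm : ∀ i l, SymmBdd (m i l) R) (k : Bool) (n : ℕ) :
    S.φ k ((S.X 0 + S.X 1) ^ n) = (walkMoment m k n : ℂ) := by
  have := S.φ_pow_mul_wordElt hm k n []
  rw [wordElt, S.φ_mul_p, if_pos rfl] at this
  exact this

end FreeLetters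

end RectConv

/-! ### Every free model gives the same moments -/

namespace RectConv

section Corner

variable {ρ₁ ρ₂ : ℝ} {A : Type*} [Ring A] [StarRing A] [Algebra ℂ A] [StarModule ℂ A]
  (S : RectProbSpace ρ₁ ρ₂ A) {a : A}

lemma φ₁_mul_p₁ (x : A) : S.φ₁ (x * S.p₁) = S.φ₁ x := by
  rw [S.corner₁, S.corner₁ x, ← mul_assoc, mul_assoc (S.p₁ * x), S.proj₁.isIdempotentElem.eq]

lemma φ₂_mul_p₂ (x : A) : S.φ₂ (x * S.p₂) = S.φ₂ x := by
  rw [S.corner₂, S.corner₂ x, ← mul_assoc, mul_assoc (S.p₂ * x), S.proj₂.isIdempotentElem.eq]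

variable (ha : S.p₁ * a * S.p₂ = a)
include ha

lemma star_corner : S.p₂ * star a * S.p₁ = star a := by
  conv_rhs => rw [← ha]
  rw [star_mul, star_mul, S.proj₁.isSelfAdjoint.star_eq, S.proj₂.isSelfAdjoint.star_eq, mul_assoc]

lemma p₁_mul : S.p₁ * a = a := by
  rw [← ha, ← mul_assoc, ← mul_assoc, S.proj₁.isIdempotentElem.eq]

lemma mul_p₂ : a * S.p₂ = a := by
  rw [← ha, mul_assoc, S.proj₂.isIdempotentElem.eq]

lemma mul_p₁ : a * S.p₁ = 0 := by
  rw [← ha, mul_assoc, S.orth₂₁, mul_zero]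

lemma p₂_mul : S.p₂ * a = 0 := by
  rw [← ha, ← mul_assoc, ← mul_assoc, S.orth₂₁, zero_mul, zero_mul]

lemma star_mul_p₁ : star a * S.p₁ = star a := by
  rw [← star_corner S ha, mul_assoc, S.proj₁.isIdempotentElem.eq]

lemma star_mul_p₂ : star a * S.p₂ = 0 := by
  rw [← star_corner S ha, mul_assoc, S.orth₁₂, mul_zero]

lemma p₁_mul_star : S.p₁ * star a = 0 := by
  rw [← star_corner S ha, ← mul_assoc, ← mul_assoc, S.orth₁₂, zero_mul, zero_mul]

lemma p₂_mul_star : S.p₂ * star a = star a := by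
  rw [← star_corner S ha, ← mul_assoc, ← mul_assoc, S.proj₂.isIdempotentElem.eq]

lemma add_star_mul_p₁ : (a + star a) * S.p₁ = S.p₂ * (a + star a) := by
  rw [add_mul, mul_add, mul_p₁ S ha, p₂_mul S ha, star_mul_p₁ S ha, p₂_mul_star S ha]

lemma add_star_mul_p₂ : (a + star a) * S.p₂ = S.p₁ * (a + star a) := by
  rw [add_mul, mul_add, mul_p₂ S ha, p₁_mul S ha, star_mul_p₂ S ha, p₁_mul_star S ha]

/-- The letter a + a* exchanges the corners, and its square acts on the first one as a a*. -/
lemma add_star_pow_mul_p₁ (j : ℕ) :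
    (a + star a) ^ (2 * j) * S.p₁ = (a * star a) ^ j * S.p₁ := by
  induction j with
  | zero => simp
  | succ j ih =>
    have h1 : (a + star a) ^ 2 * S.p₁ = S.p₁ * (a * star a) * S.p₁ := by
      have h0 : (a + star a) * star a = a * star a := by
        have hz : star a * star a = 0 := by
          nth_rw 1 [← star_mul_p₁ S ha]
          rw [mul_assoc, p₁_mul_star S ha, mul_zero]
        rw [add_mul, hz, add_zero]
      rw [sq, mul_assoc, add_mul a (star a) S.p₁, mul_p₁ S ha, zero_add, star_mul_p₁ S ha, h0, ← mul_assoc,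
        p₁_mul S ha, mul_assoc, star_mul_p₁ S ha]
    rw [mul_add, pow_add, mul_one, mul_assoc, h1, ← mul_assoc, ← mul_assoc, ih, pow_succ,
      mul_assoc _ S.p₁, ← mul_assoc S.p₁, p₁_mul S ha]

lemma add_star_pow_mul_p₂ (j : ℕ) :
    (a + star a) ^ (2 * j) * S.p₂ = (star a * a) ^ j * S.p₂ := by
  induction j with
  | zero => simp
  | succ j ih =>
    have h1 : (a + star a) ^ 2 * S.p₂ = S.p₂ * (star a * a) * S.p₂ := by
      have h0 : (a + star a) * a = star a * a := by
        have hz : a * a = 0 := by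
          nth_rw 1 [← mul_p₂ S ha]
          rw [mul_assoc, p₂_mul S ha, mul_zero]
        rw [add_mul, hz, zero_add]
      rw [sq, mul_assoc, add_mul a (star a) S.p₂, mul_p₂ S ha, star_mul_p₂ S ha, add_zero, h0, ← mul_assoc,
        p₂_mul_star S ha, mul_assoc, mul_p₂ S ha]
    rw [mul_add, pow_add, mul_one, mul_assoc, h1, ← mul_assoc, ← mul_assoc, ih, pow_succ,
      mul_assoc _ S.p₂, ← mul_assoc S.p₂, p₂_mul_star S ha]

lemma φ₁_add_star_pow (j : ℕ) : S.φ₁ ((a + star a) ^ (2 * j)) = S.φ₁ ((a * star a) ^ j) := by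
  rw [← φ₁_mul_p₁, add_star_pow_mul_p₁ S ha, φ₁_mul_p₁]

lemma φ₂_add_star_pow (j : ℕ) : S.φ₂ ((a + star a) ^ (2 * j)) = S.φ₂ ((star a * a) ^ j) := by
  rw [← φ₂_mul_p₂, add_star_pow_mul_p₂ S ha, φ₂_mul_p₂]

lemma φ_add_star_odd_pow (j : ℕ) :
    S.φ₁ ((a + star a) ^ (2 * j + 1)) = 0 ∧ S.φ₂ ((a + star a) ^ (2 * j + 1)) = 0 := by
  have h1 : ∀ j, (a + star a) ^ (2 * j) * S.p₁ = S.p₁ * (a + star a) ^ (2 * j) := by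
    intro j
    rw [pow_mul]
    refine (Commute.pow_left ?_ j).eq
    rw [sq]
    change _ * _ * _ = _
    rw [mul_assoc, add_star_mul_p₁ S ha, ← mul_assoc, add_star_mul_p₂ S ha, mul_assoc]
  have h2 : ∀ j, (a + star a) ^ (2 * j) * S.p₂ = S.p₂ * (a + star a) ^ (2 * j) := by
    intro j
    have : S.p₂ = 1 - S.p₁ := by rw [← S.add_eq_one]; abel
    rw [this, mul_sub, sub_mul, h1]; simp
  constructor
  · rw [S.corner₁, pow_succ, mul_assoc, mul_assoc, add_star_mul_p₁ S ha, ← mul_assoc _ S.p₂, h2,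
      ← mul_assoc, ← mul_assoc, S.orth₁₂]
    simp
  · rw [S.corner₂, pow_succ, mul_assoc, mul_assoc, add_star_mul_p₂ S ha, ← mul_assoc _ S.p₁, h1,
      ← mul_assoc, ← mul_assoc, S.orth₂₁]
    simp

end Corner

section Model

variable {lam : ℝ} {A : Type*} [Ring A] [StarRing A] [Algebra ℂ A] [StarModule ℂ A]
  (S : RectProbSpace (lam / (1 + lam)) (1 / (1 + lam)) A) {a : A}

/-- The trace relation for a and a*(a a*)^j, with ρ₁/ρ₂ = λ. The exponent 0 is excluded, as φ₂(1) =
1; this accounts for the atom (1 - λ)δ₀ of the second law. -/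
lemma φ₂_star_mul_pow (h0 : 0 ≤ lam) (ha : S.p₁ * a * S.p₂ = a) (j : ℕ) :
    S.φ₂ ((star a * a) ^ (j + 1)) = lam * S.φ₁ ((a * star a) ^ (j + 1)) := by
  have h1 := S.trace₁₂ a (star a * (a * star a) ^ j) ha (by
    rw [← mul_assoc, p₂_mul_star S ha]
    rcases j with _ | j
    · rw [pow_zero, mul_one, star_mul_p₁ S ha]
    · rw [pow_succ, mul_assoc, mul_assoc _ (a * star a), mul_assoc a, star_mul_p₁ S ha])
  have h2 : star a * (a * star a) ^ j * a = (star a * a) ^ (j + 1) := by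
    rw [← mul_pow_mul, mul_assoc, ← pow_succ]
  rw [← mul_assoc, ← pow_succ', h2] at h1
  have h3 : ((1 + lam : ℝ) : ℂ) ≠ 0 := by
    have : (1 + lam : ℝ) ≠ 0 := by positivity
    exact_mod_cast this
  push_cast at h1 h3
  field_simp at h1
  exact h1.symm

lemma φ_add_star_pow_eq (h0 : 0 ≤ lam) (h1 : lam ≤ 1) {R : ℝ} {μ : SymmProb}
    (hμ : SymmBdd μ.toMeasure R) (ha : HasRectDistribution S a μ) (n : ℕ) :
    S.φ₁ ((a + star a) ^ n) = ((∫ x, x ^ n ∂μ.toMeasure : ℝ) : ℂ) ∧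
    S.φ₂ ((a + star a) ^ n) = ((∫ x, x ^ n ∂(dilute lam μ.toMeasure) : ℝ) : ℂ) := by
  obtain ⟨ha, hk⟩ := ha
  rw [integral_dilute h0 h1 (hμ.integrable (continuous_pow n))]
  rcases Nat.even_or_odd' n with ⟨j, rfl | rfl⟩
  · rw [φ₁_add_star_pow S ha, φ₂_add_star_pow S ha]
    refine ⟨hk j, ?_⟩
    rcases j with _ | j
    · have h2 : S.φ₂ 1 = 1 := by
        rw [← φ₂_mul_p₂, one_mul, S.unit₂]
      have := hμ.prob
      simp [h2]
    · rw [φ₂_star_mul_pow S h0 ha, hk]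
      simp
  · rw [(φ_add_star_odd_pow S ha j).1, (φ_add_star_odd_pow S ha j).2,
      hμ.integral_odd fun x => by rw [Odd.neg_pow ⟨j, rfl⟩]]
    simp

lemma condExp_eq_zero_iff (x : A) : S.condExp x = 0 ↔ S.φ₁ x = 0 ∧ S.φ₂ x = 0 := by
  constructor
  · intro h
    have h1 : S.φ₁ (S.condExp x) = 0 := by rw [h, map_zero]
    have h2 : S.φ₂ (S.condExp x) = 0 := by rw [h, map_zero]
    have e1 : S.φ₁ S.p₂ = 0 := by rw [S.corner₁, S.orth₁₂]; simp
    have e2 : S.φ₂ S.p₁ = 0 := by rw [S.corner₂, S.orth₂₁]; simp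
    simp only [RectProbSpace.condExp, map_add, map_smul, S.unit₁, S.unit₂, e1, e2, smul_eq_mul,
      mul_one, mul_zero, add_zero, zero_add] at h1 h2
    exact ⟨h1, h2⟩
  · rintro ⟨h1, h2⟩
    simp [RectProbSpace.condExp, h1, h2]

/-- The letters attached to a free model. -/
noncomputable def modelLetters {a₁ a₂ : A} (h0 : 0 ≤ lam) (h1 : lam ≤ 1) {R : ℝ}
    {μ₁ μ₂ : SymmProb} (hμ₁ : SymmBdd μ₁.toMeasure R) (hμ₂ : SymmBdd μ₂.toMeasure R)
    (ha₁ : HasRectDistribution S a₁ μ₁) (ha₂ : HasRectDistribution S a₂ μ₂)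
    {B : Fin 2 → StarSubalgebra ℂ A} (hB : S.FreeSubalgebras B) (hB₁ : a₁ ∈ B 0) (hB₂ : a₂ ∈ B 1) :
    FreeLetters (cornerLaw lam ![μ₁.toMeasure, μ₂.toMeasure]) A where
  p l := bif l then S.p₁ else S.p₂
  φ l := bif l then S.φ₁ else S.φ₂
  X := ![a₁ + star a₁, a₂ + star a₂]
  B i := (B i).toSubalgebra
  p_mul_self := by
    rintro (_ | _)
    · exact S.proj₂.isIdempotentElem.eq
    · exact S.proj₁.isIdempotentElem.eq
  p_mul_not := by
    rintro (_ | _)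
    · exact S.orth₂₁
    · exact S.orth₁₂
  p_add := S.add_eq_one
  X_mul_p := by
    intro i l
    fin_cases i <;> cases l
    · exact add_star_mul_p₂ S ha₁.1
    · exact add_star_mul_p₁ S ha₁.1
    · exact add_star_mul_p₂ S ha₂.1
    · exact add_star_mul_p₁ S ha₂.1
  corner := by
    rintro (_ | _)
    · exact S.corner₂
    · exact S.corner₁
  unit := by
    rintro (_ | _)
    · exact S.unit₂
    · exact S.unit₁
  moment := by
    intro i l n
    fin_cases i <;> cases l
    · exact (φ_add_star_pow_eq S h0 h1 hμ₁ ha₁ n).2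
    · exact (φ_add_star_pow_eq S h0 h1 hμ₁ ha₁ n).1
    · exact (φ_add_star_pow_eq S h0 h1 hμ₂ ha₂ n).2
    · exact (φ_add_star_pow_eq S h0 h1 hμ₂ ha₂ n).1
  p_mem := by
    intro i l
    cases l
    · exact (hB.1 i).2
    · exact (hB.1 i).1
  X_mem := by
    intro i
    fin_cases i
    · exact (B 0).add_mem hB₁ (star_mem (s := B 0) hB₁)
    · exact (B 1).add_mem hB₂ (star_mem (s := B 1) hB₂)
  free := by
    intro w hw hx hc l
    have h := hB.2 w hw (fun x hxw => ⟨(hx x hxw).1,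
      (condExp_eq_zero_iff S _).2 ⟨(hx x hxw).2 true, (hx x hxw).2 false⟩⟩) hc
    rw [condExp_eq_zero_iff] at h
    cases l
    · exact h.2
    · exact h.1

/-- Adding its adjoint to a₁ + a₂ gives the sum of the two letters, whose even powers in the first
corner are those of (a₁ + a₂)(a₁ + a₂)*. -/
lemma φ₁_pow_of_isFreeModel {a₁ a₂ : A} (h0 : 0 ≤ lam) (h1 : lam ≤ 1) {R : ℝ}
    {μ₁ μ₂ : SymmProb} (hμ₁ : SymmBdd μ₁.toMeasure R) (hμ₂ : SymmBdd μ₂.toMeasure R)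
    (h : IsFreeModel lam μ₁ μ₂ S a₁ a₂) (j : ℕ) :
    S.φ₁ (((a₁ + a₂) * star (a₁ + a₂)) ^ j)
      = (walkMoment (cornerLaw lam ![μ₁.toMeasure, μ₂.toMeasure]) true (2 * j) : ℂ) := by
  obtain ⟨ha₁, ha₂, B, hB, hB₁, hB₂⟩ := h
  have hm : ∀ i l, SymmBdd (cornerLaw lam ![μ₁.toMeasure, μ₂.toMeasure] i l) R :=
    SymmBdd.cornerLaw (fun i => by fin_cases i <;> assumption) h0 h1
  have := (modelLetters S h0 h1 hμ₁ hμ₂ ha₁ ha₂ hB hB₁ hB₂).φ_pow hm true (2 * j)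
  rw [← this, ← φ₁_add_star_pow S (by rw [mul_add, add_mul, ha₁.1, ha₂.1])]
  change _ = S.φ₁ ((a₁ + star a₁ + (a₂ + star a₂)) ^ (2 * j))
  rw [star_add, add_add_add_comm]

end Model

end RectConv

/-! ### The trace property of free letters -/

namespace RectConv

namespace FreeLetters

section ListProd

variable {A : Type*} [Ring A]

/-- The product of a word. -/
def listProd (L : List (Fin 2 × A)) : A := (L.map Prod.snd).prod

@[simp] lemma listProd_nil : listProd ([] : List (Fin 2 × A)) = 1 := rfl

@[simp] lemma listProd_cons (x : Fin 2 × A) (L : List (Fin 2 × A)) :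
    listProd (x :: L) = x.2 * listProd L := by simp [listProd]

@[simp] lemma listProd_append (L L' : List (Fin 2 × A)) :
    listProd (L ++ L') = listProd L * listProd L' := by simp [listProd]

end ListProd

variable {m : Fin 2 → Bool → Measure ℝ} {A : Type*} [Ring A] [Algebra ℂ A] (S : FreeLetters m A)

lemma letterSpan_le (i : Fin 2) {b : A} (hb : b ∈ S.letterSpan i) : b ∈ S.B i :=
  LetterSystem.letterSpan_induction (P := fun b => b ∈ S.B i)
    (fun n l => mul_mem (pow_mem (S.X_mem i) n) (S.p_mem i l)) (zero_mem _)
    (fun _ _ => add_mem) (fun c _ hx => Subalgebra.smul_mem _ hx c) hb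

/-- The centered part of an element. -/
def center (b : A) : A := b - S.φ true b • S.p true - S.φ false b • S.p false

lemma eq_center_add (b : A) :
    b = S.center b + (S.φ true b • S.p true + S.φ false b • S.p false) := by
  unfold center; abel

lemma φ_center (b : A) (l : Bool) : S.φ l (S.center b) = 0 := by
  have h : ∀ l l', S.φ l (S.p l') = if l = l' then 1 else 0 := by
    intro l l'
    have h1 := S.φ_mul_p l l 1
    rw [one_mul, if_pos rfl, S.unit] at h1
    have h2 := S.φ_mul_p l l' 1
    rwa [one_mul, ← h1] at h2
  unfold center
  rw [map_sub, map_sub, map_smul, map_smul, h, h]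
  cases l <;> simp

lemma center_mem {i : Fin 2} {b : A} (hb : b ∈ S.letterSpan i) : S.center b ∈ S.letterSpan i :=
  sub_mem (sub_mem hb (Submodule.smul_mem _ _ (S.p_mem_letterSpan i _)))
    (Submodule.smul_mem _ _ (S.p_mem_letterSpan i _))

/-- Alternating words of centered elements. -/
def Alternating (L : List (Fin 2 × A)) : Prop :=
  (∀ x ∈ L, x.2 ∈ S.letterSpan x.1 ∧ ∀ l, S.φ l x.2 = 0) ∧ L.IsChain fun x y => x.1 ≠ y.1

variable {S}

lemma Alternating.φ_eq_zero {L : List (Fin 2 × A)} (h : S.Alternating L) (hL : L ≠ []) (l : Bool) :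
    S.φ l (listProd L) = 0 :=
  S.free L hL (fun x hx => ⟨S.letterSpan_le _ (h.1 x hx).1, (h.1 x hx).2⟩) h.2 l

lemma Alternating.tail {x : Fin 2 × A} {L : List (Fin 2 × A)} (h : S.Alternating (x :: L)) :
    S.Alternating L :=
  ⟨fun y hy => h.1 y (List.mem_cons_of_mem _ hy), (List.isChain_cons.1 h.2).2⟩

lemma Alternating.cons {i : Fin 2} {b : A} {L : List (Fin 2 × A)} (h : S.Alternating L)
    (hb : b ∈ S.letterSpan i) (hb0 : ∀ l, S.φ l b = 0) (hi : ∀ x ∈ L.head?, i ≠ x.1) :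
    S.Alternating ((i, b) :: L) := by
  refine ⟨fun y hy => ?_, List.isChain_cons.2 ⟨hi, h.2⟩⟩
  rcases List.mem_cons.1 hy with rfl | hy
  · exact ⟨hb, hb0⟩
  · exact h.1 y hy

lemma Alternating.init {x : Fin 2 × A} {L : List (Fin 2 × A)} (h : S.Alternating (L ++ [x])) :
    S.Alternating L :=
  ⟨fun y hy => h.1 y (List.mem_append_left _ hy), (List.isChain_append.1 h.2).1⟩

lemma Alternating.snoc {i : Fin 2} {b : A} {L : List (Fin 2 × A)} (h : S.Alternating L)
    (hb : b ∈ S.letterSpan i) (hb0 : ∀ l, S.φ l b = 0) (hi : ∀ x ∈ L.getLast?, x.1 ≠ i) :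
    S.Alternating (L ++ [(i, b)]) := by
  refine ⟨fun y hy => ?_, List.isChain_append.2 ⟨h.2, List.isChain_singleton _, ?_⟩⟩
  · rcases List.mem_append.1 hy with hy | hy
    · exact h.1 y hy
    · rw [List.mem_singleton] at hy; subst hy; exact ⟨hb, hb0⟩
  · intro x hx y hy
    simp only [List.head?_cons, Option.mem_some_iff] at hy
    subst hy
    exact hi x hx

/-- The centred part of b prolongs the alternating word, and its 𝒟-part is absorbed by the corner
functional; both contributions vanish. -/
lemma Alternating.φ_mul_of_head_ne {i : Fin 2} {b : A} {L : List (Fin 2 × A)}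
    (h : S.Alternating L) (hL : L ≠ []) (hb : b ∈ S.letterSpan i)
    (hi : ∀ x ∈ L.head?, i ≠ x.1) (l : Bool) : S.φ l (b * listProd L) = 0 := by
  rw [S.eq_center_add b, add_mul, add_mul, smul_mul_assoc, smul_mul_assoc, map_add, map_add,
    map_smul, map_smul, φ_p_mul, φ_p_mul, h.φ_eq_zero hL]
  have := (h.cons (S.center_mem hb) (S.φ_center b) hi).φ_eq_zero (by simp) l
  rw [listProd_cons] at this
  rw [this]
  simp

lemma Alternating.φ_mul_of_last_ne {i : Fin 2} {b : A} {L : List (Fin 2 × A)}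
    (h : S.Alternating L) (hL : L ≠ []) (hb : b ∈ S.letterSpan i)
    (hi : ∀ x ∈ L.getLast?, x.1 ≠ i) (l : Bool) : S.φ l (listProd L * b) = 0 := by
  rw [S.eq_center_add b, mul_add, mul_add, mul_smul_comm, mul_smul_comm, map_add, map_add,
    map_smul, map_smul, φ_mul_p, φ_mul_p, h.φ_eq_zero hL]
  have := (h.snoc (S.center_mem hb) (S.φ_center b) hi).φ_eq_zero (by simp) l
  rw [listProd_append, listProd_cons, listProd_nil, mul_one] at this
  rw [this]
  simp

lemma Alternating.head_ne {x : Fin 2 × A} {L : List (Fin 2 × A)} (h : S.Alternating (x :: L)) :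
    ∀ y ∈ L.head?, x.1 ≠ y.1 := (List.isChain_cons.1 h.2).1

lemma Alternating.last_ne {x : Fin 2 × A} {L : List (Fin 2 × A)} (h : S.Alternating (L ++ [x])) :
    ∀ y ∈ L.getLast?, y.1 ≠ x.1 := fun y hy => (List.isChain_append.1 h.2).2.2 y hy x (by simp)

/-- An element of one of the algebras times an alternating word of length at least two. -/
lemma Alternating.φ_mul {i : Fin 2} {b : A} {x : Fin 2 × A} {L : List (Fin 2 × A)}
    (h : S.Alternating (x :: L)) (hL : L ≠ []) (hb : b ∈ S.letterSpan i) (l : Bool) :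
    S.φ l (b * listProd (x :: L)) = 0 := by
  by_cases hi : i = x.1
  · subst hi
    rw [listProd_cons, ← mul_assoc]
    exact h.tail.φ_mul_of_head_ne hL (S.mul_mem_letterSpan hb (h.1 x (by simp)).1) h.head_ne l
  · exact h.φ_mul_of_head_ne (by simp) hb (by simpa using hi) l

lemma Alternating.φ_mul' {i : Fin 2} {b : A} {x : Fin 2 × A} {L : List (Fin 2 × A)}
    (h : S.Alternating (L ++ [x])) (hL : L ≠ []) (hb : b ∈ S.letterSpan i) (l : Bool) :
    S.φ l (listProd (L ++ [x]) * b) = 0 := by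
  by_cases hi : x.1 = i
  · subst hi
    rw [listProd_append, listProd_cons, listProd_nil, mul_one, mul_assoc]
    exact h.init.φ_mul_of_last_ne hL (S.mul_mem_letterSpan (h.1 x (by simp)).1 hb) h.last_ne l
  · exact h.φ_mul_of_last_ne (by simp) hb (by simpa using hi) l

section Trace

variable {lam : ℂ} (hX : ∀ i l, S.φ l (S.X i) = 0)
  (hlam : ∀ i n, S.φ false (S.X i ^ (n + 1)) = lam * S.φ true (S.X i ^ (n + 1)))

include hX in
lemma alternating_X (i : Fin 2) : S.Alternating [(i, S.X i)] :=
  Alternating.cons ⟨by simp, List.isChain_nil⟩ (S.X_mem_letterSpan i) (hX i) (by simp)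

-- On the spanning elements X^n p_l this is the relation `hlam` between the moments of the corners.
include hlam in
lemma φ_false_X_mul {i : Fin 2} {b : A} (hb : b ∈ S.letterSpan i) :
    S.φ false (S.X i * b) = lam * S.φ true (b * S.X i) := by
  refine LetterSystem.letterSpan_induction
    (P := fun b => S.φ false (S.X i * b) = lam * S.φ true (b * S.X i)) ?_ ?_ ?_ ?_ hb
  · intro n l
    have h1 : S.p l * S.X i = S.X i * S.p (!l) := by rw [S.X_mul_p, Bool.not_not]
    rw [← mul_assoc, ← pow_succ', mul_assoc, h1, ← mul_assoc, ← pow_succ, φ_mul_p, φ_mul_p]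
    cases l
    · simpa using hlam i n
    · simp
  · simp
  · intro x y hx hy; rw [mul_add, add_mul, map_add, map_add, hx, hy]; ring
  · intro c x hx; rw [mul_smul_comm, smul_mul_assoc, map_smul, map_smul, hx]
    simp only [smul_eq_mul]; ring

include hlam in
lemma φ_false_mul_X {i : Fin 2} {b : A} (hb : b ∈ S.letterSpan i) :
    S.φ false (b * S.X i) = lam * S.φ true (S.X i * b) := by
  refine LetterSystem.letterSpan_induction
    (P := fun b => S.φ false (b * S.X i) = lam * S.φ true (S.X i * b)) ?_ ?_ ?_ ?_ hb
  · intro n l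
    have h1 : S.p l * S.X i = S.X i * S.p (!l) := by rw [S.X_mul_p, Bool.not_not]
    rw [← mul_assoc, ← pow_succ', mul_assoc, h1, ← mul_assoc, ← pow_succ, φ_mul_p, φ_mul_p]
    cases l
    · simp
    · simpa using hlam i n
  · simp
  · intro x y hx hy; rw [mul_add, add_mul, map_add, map_add, hx, hy]; ring
  · intro c x hx; rw [mul_smul_comm, smul_mul_assoc, map_smul, map_smul, hx]
    simp only [smul_eq_mul]; ring

lemma φ_sq_mul {i : Fin 2} {b : A} (hb : b ∈ S.letterSpan i) :
    S.φ true (S.X i * S.X i * b) = S.φ true (b * (S.X i * S.X i)) := by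
  refine LetterSystem.letterSpan_induction
    (P := fun b => S.φ true (S.X i * S.X i * b) = S.φ true (b * (S.X i * S.X i))) ?_ ?_ ?_ ?_ hb
  · intro n l
    have h1 : S.p l * (S.X i * S.X i) = S.X i * S.X i * S.p l := by
      have e : ∀ l, S.p l * S.X i = S.X i * S.p (!l) := fun l => by rw [S.X_mul_p, Bool.not_not]
      rw [← mul_assoc, e, mul_assoc, e, Bool.not_not, ← mul_assoc]
    rw [mul_assoc _ (S.p l), h1, ← mul_assoc, ← mul_assoc, ← sq, ← pow_add, ← pow_add, add_comm]
  · simp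
  · intro x y hx hy; rw [mul_add, add_mul, map_add, map_add, hx, hy]
  · intro c x hx; rw [mul_smul_comm, smul_mul_assoc, map_smul, map_smul, hx]

include hX hlam in
/-- The trace relation between the corners, for a letter and an alternating word. -/
lemma Alternating.trace_X {L : List (Fin 2 × A)} (h : S.Alternating L) (i : Fin 2) :
    S.φ false (S.X i * listProd L) = lam * S.φ true (listProd L * S.X i) := by
  rcases L with _ | ⟨x, L⟩
  · simp [hX]
  rcases eq_or_ne L [] with rfl | hL
  · rw [listProd_cons, listProd_nil, mul_one]
    have hx := h.1 x (by simp)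
    by_cases hi : i = x.1
    · subst hi; exact φ_false_X_mul hlam hx.1
    · have h1 := h.φ_mul_of_head_ne (by simp) (S.X_mem_letterSpan i) (by simpa using hi) false
      have h2 := h.φ_mul_of_last_ne (by simp) (S.X_mem_letterSpan i)
        (by simpa using Ne.symm hi) true
      rw [listProd_cons, listProd_nil, mul_one] at h1 h2
      rw [h1, h2, mul_zero]
  · rw [h.φ_mul hL (S.X_mem_letterSpan i)]
    obtain ⟨L', y, hy⟩ := (List.eq_nil_or_concat (x :: L)).resolve_left (by simp)
    rw [List.concat_eq_append] at hy
    rw [hy] at h ⊢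
    rw [h.φ_mul' ?_ (S.X_mem_letterSpan i), mul_zero]
    rintro rfl
    have := congrArg List.length hy
    simp only [List.length_cons, List.nil_append, List.length_nil] at this
    exact hL (List.length_eq_zero_iff.1 (by omega))

-- If the first factor belongs to j it merges with X_j. The centred part of the product still gives
-- an alternating word and vanishes; the 𝒟-part is read in the opposite corner because X_i stands
-- before it.
include hX in
lemma Alternating.φ_true_XX_mul {i j : Fin 2} (hij : i ≠ j) {x : Fin 2 × A}
    {L : List (Fin 2 × A)} (h : S.Alternating (x :: L)) :
    S.φ true (S.X i * S.X j * listProd (x :: L))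
      = if x.1 = j then S.φ false (S.X j * x.2) * S.φ true (S.X i * listProd L) else 0 := by
  split_ifs with hx
  · subst hx
    have hc := S.mul_mem_letterSpan (S.X_mem_letterSpan x.1) (h.1 x (by simp)).1
    have h1 := ((h.tail.cons (S.center_mem hc) (S.φ_center _) h.head_ne).cons
      (S.X_mem_letterSpan i) (hX i) (by simpa using hij)).φ_eq_zero (by simp) true
    rw [listProd_cons, listProd_cons] at h1
    rw [listProd_cons, mul_assoc, ← mul_assoc (S.X x.1), S.eq_center_add (S.X x.1 * x.2), add_mul,
      mul_add, map_add, h1, zero_add, add_mul, mul_add, smul_mul_assoc, smul_mul_assoc,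
      mul_smul_comm, mul_smul_comm, ← mul_assoc, ← mul_assoc, S.X_mul_p, S.X_mul_p, mul_assoc,
      mul_assoc, map_add, map_smul, map_smul, φ_p_mul, φ_p_mul, ← S.eq_center_add]
    simp
  · have h1 := ((h.cons (S.X_mem_letterSpan j) (hX j) (by simpa using Ne.symm hx)).cons
      (S.X_mem_letterSpan i) (hX i) (by simpa using hij)).φ_eq_zero (by simp) true
    rwa [listProd_cons, listProd_cons, ← mul_assoc] at h1

include hX in
lemma Alternating.φ_true_mul_XX {i j : Fin 2} (hij : i ≠ j) {x : Fin 2 × A}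
    {L : List (Fin 2 × A)} (h : S.Alternating (L ++ [x])) :
    S.φ true (listProd (L ++ [x]) * (S.X i * S.X j))
      = if x.1 = i then S.φ false (x.2 * S.X i) * S.φ true (listProd L * S.X j) else 0 := by
  split_ifs with hx
  · subst hx
    have hc := S.mul_mem_letterSpan (h.1 x (by simp)).1 (S.X_mem_letterSpan x.1)
    have h1 := ((h.init.snoc (S.center_mem hc) (S.φ_center _) h.last_ne).snoc
      (S.X_mem_letterSpan j) (hX j) (by simpa using hij)).φ_eq_zero (by simp) true
    have hp : ∀ l, S.p l * S.X j = S.X j * S.p (!l) := fun l => by rw [S.X_mul_p, Bool.not_not]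
    simp only [listProd_append, listProd_cons, listProd_nil, mul_one] at h1 ⊢
    rw [mul_assoc, ← mul_assoc x.2, S.eq_center_add (x.2 * S.X x.1), add_mul,
      mul_add, map_add, ← mul_assoc, h1, zero_add, add_mul, mul_add, smul_mul_assoc, smul_mul_assoc,
      mul_smul_comm, mul_smul_comm, hp, hp, ← mul_assoc, ← mul_assoc,
      map_add, map_smul, map_smul, φ_mul_p, φ_mul_p, ← S.eq_center_add]
    simp
  · have h1 := ((h.snoc (S.X_mem_letterSpan i) (hX i) (by simpa using hx)).snoc
      (S.X_mem_letterSpan j) (hX j) (by simpa using hij)).φ_eq_zero (by simp) true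
    simpa [mul_assoc] using h1

include hX hlam in
/-- Cyclicity for a product of two letters and an alternating word. -/
lemma Alternating.trace_XX {L : List (Fin 2 × A)} (h : S.Alternating L) (i j : Fin 2) :
    S.φ true (S.X i * S.X j * listProd L) = S.φ true (listProd L * (S.X i * S.X j)) := by
  rcases L with _ | ⟨x, L⟩
  · simp
  obtain ⟨L', y, hy⟩ := (List.eq_nil_or_concat (x :: L)).resolve_left (by simp)
  rw [List.concat_eq_append] at hy
  have hlen := congrArg List.length hy
  simp only [List.length_cons, List.length_append, List.length_nil, zero_add] at hlen
  have h' := h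
  rw [hy] at h'
  by_cases hij : i = j
  · subst hij
    have hc := S.mul_mem_letterSpan (S.X_mem_letterSpan i) (S.X_mem_letterSpan i)
    rcases eq_or_ne L [] with rfl | hL
    · rw [listProd_cons, listProd_nil, mul_one]
      have hx := h.1 x (by simp)
      by_cases hi : i = x.1
      · subst hi; exact φ_sq_mul hx.1
      · have h1 := h.φ_mul_of_head_ne (by simp) hc (by simpa using hi) true
        have h2 := h.φ_mul_of_last_ne (by simp) hc (by simpa using Ne.symm hi) true
        rw [listProd_cons, listProd_nil, mul_one] at h1 h2
        rw [h1, h2]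
    · rw [h.φ_mul hL hc, hy, h'.φ_mul' ?_ hc]
      rintro rfl
      exact hL (List.length_eq_zero_iff.1 (by simpa using hlen))
  · rcases eq_or_ne L [] with rfl | hL
    · rw [listProd_cons, listProd_nil, mul_one]
      have hx := h.1 x (by simp)
      have hxi : x.1 = i ∨ x.1 = j := by omega
      rcases hxi with hxi | hxj
      · subst hxi
        have h1 := ((h.cons (S.X_mem_letterSpan j) (hX j) (by simpa using Ne.symm hij)).cons
          (S.X_mem_letterSpan x.1) (hX x.1) (by simpa using hij)).φ_eq_zero (by simp) true
        have h2 := (alternating_X hX j).φ_mul_of_head_ne (by simp)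
          (S.mul_mem_letterSpan hx.1 (S.X_mem_letterSpan x.1)) (by simpa using hij) true
        simp only [listProd_cons, listProd_nil, mul_one, ← mul_assoc] at h1 h2 ⊢
        rw [h1, h2]
      · subst hxj
        have h1 := ((h.snoc (S.X_mem_letterSpan i) (hX i) (by simpa using Ne.symm hij)).snoc
          (S.X_mem_letterSpan x.1) (hX x.1) (by simpa using hij)).φ_eq_zero (by simp) true
        have h2 := (alternating_X hX i).φ_mul_of_last_ne (by simp)
          (S.mul_mem_letterSpan (S.X_mem_letterSpan x.1) hx.1) (by simpa using hij) true
        simp only [listProd_append, listProd_cons, listProd_nil, mul_one, ← mul_assoc] at h1 h2 ⊢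
        rw [h1, h2]
    · have hL' : L' ≠ [] := by
        rintro rfl
        exact hL (List.length_eq_zero_iff.1 (by simpa using hlen))
      rw [h.φ_true_XX_mul hX hij, hy, h'.φ_true_mul_XX hX hij]
      rcases L with _ | ⟨x', L⟩
      · exact absurd rfl hL
      -- Both sides are now products of two values of the functionals. For words of length two the
      -- scalar relations turn each into λ times the same product; for longer words a factor
      -- vanishes.
      rcases eq_or_ne L [] with rfl | hL2
      · have e : L' = [x] ∧ y = x' := by
          rcases L' with _ | ⟨a, _ | ⟨b, t⟩⟩
          · exact absurd rfl hL'
          · simp only [List.cons_append, List.nil_append, List.cons.injEq, and_true] at hy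
            exact ⟨by rw [hy.1], hy.2.symm⟩
          · simp at hlen
        obtain ⟨rfl, rfl⟩ := e
        have hne : x.1 ≠ y.1 := h.head_ne y (by simp)
        have hx := h.1 x (by simp)
        have hy' := h.1 y (by simp)
        by_cases hxj : x.1 = j
        · have hyi : y.1 = i := by omega
          subst hxj; subst hyi
          rw [if_pos rfl, if_pos rfl, φ_false_X_mul hlam hx.1, φ_false_mul_X hlam hy'.1]
          simp only [listProd_cons, listProd_nil, mul_one]
          ring
        · have hyi : y.1 ≠ i := by omega
          rw [if_neg hxj, if_neg hyi]
      · have h1 := h.tail.φ_mul hL2 (S.X_mem_letterSpan i) true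
        obtain ⟨L'', z, hz⟩ := (List.eq_nil_or_concat L').resolve_left hL'
        rw [List.concat_eq_append] at hz
        subst hz
        have hL'' : L'' ≠ [] := by
          rintro rfl
          simp only [List.length_cons, List.nil_append, List.length_nil] at hlen
          exact hL2 (List.length_eq_zero_iff.1 (by omega))
        have h2 := h'.init.φ_mul' hL'' (S.X_mem_letterSpan j) true
        rw [h1, h2]
        simp

end Trace

end FreeLetters

end RectConv

/-! ### The trace relations on the algebra generated by free letters -/

namespace RectConv

namespace FreeLetters

variable {m : Fin 2 → Bool → Measure ℝ} {A : Type*} [Ring A] [Algebra ℂ A] (S : FreeLetters m A)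

variable {S}

variable (S) in
/-- The span of the alternating words and their products with the projections. -/
def alternatingSpan : Submodule ℂ A :=
  Submodule.span ℂ {x | ∃ l L, S.Alternating L ∧ x = S.p l * listProd L}

lemma p_mul_mem_alternatingSpan (l : Bool) {x : A} (hx : x ∈ S.alternatingSpan) :
    S.p l * x ∈ S.alternatingSpan := by
  induction hx using Submodule.span_induction with
  | mem x hx =>
    obtain ⟨l', L, hL, rfl⟩ := hx
    rw [← mul_assoc, S.p_mul]
    split_ifs
    · exact Submodule.subset_span ⟨l, L, hL, rfl⟩
    · simp
  | zero => simp
  | add x y _ _ hx hy => rw [mul_add]; exact add_mem hx hy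
  | smul c x _ hx => rw [mul_smul_comm]; exact Submodule.smul_mem _ c hx

lemma Alternating.mem_alternatingSpan {L : List (Fin 2 × A)} (hL : S.Alternating L) :
    listProd L ∈ S.alternatingSpan := by
  rw [← one_mul (listProd L), ← S.p_add, add_mul]
  exact add_mem (Submodule.subset_span ⟨true, L, hL, rfl⟩)
    (Submodule.subset_span ⟨false, L, hL, rfl⟩)

section Trace

variable {lam : ℂ} (hX : ∀ i l, S.φ l (S.X i) = 0)
  (hlam : ∀ i n, S.φ false (S.X i ^ (n + 1)) = lam * S.φ true (S.X i ^ (n + 1)))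

-- If the first letter is the same, the product splits into a centred factor, again alternating, and
-- a 𝒟-part times the tail.
include hX in
lemma Alternating.X_mul_mem {L : List (Fin 2 × A)} (hL : S.Alternating L) (i : Fin 2) :
    S.X i * listProd L ∈ S.alternatingSpan := by
  by_cases hi : ∀ x ∈ L.head?, i ≠ x.1
  · have := (hL.cons (S.X_mem_letterSpan i) (hX i) hi).mem_alternatingSpan
    rwa [listProd_cons] at this
  · push Not at hi
    obtain ⟨x, hx, rfl⟩ := hi
    rcases L with _ | ⟨y, L⟩
    · simp at hx
    simp only [List.head?_cons, Option.mem_some_iff] at hx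
    subst hx
    have hc := S.mul_mem_letterSpan (S.X_mem_letterSpan y.1) (hL.1 y (by simp)).1
    have h1 := (hL.tail.cons (S.center_mem hc) (S.φ_center _) hL.head_ne).mem_alternatingSpan
    rw [listProd_cons] at h1
    rw [listProd_cons, ← mul_assoc, S.eq_center_add (S.X y.1 * y.2), add_mul, add_mul,
      smul_mul_assoc, smul_mul_assoc]
    exact add_mem h1 (add_mem
      (Submodule.smul_mem _ _ (Submodule.subset_span ⟨true, L, hL.tail, rfl⟩))
      (Submodule.smul_mem _ _ (Submodule.subset_span ⟨false, L, hL.tail, rfl⟩)))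

include hX in
lemma generated_le_alternatingSpan {z : A} (hz : z ∈ S.generated) : z ∈ S.alternatingSpan := by
  refine LetterSystem.generated_le ?_ (fun l x => p_mul_mem_alternatingSpan l) (fun i x hx => ?_) hz
  · exact Alternating.mem_alternatingSpan (S := S) (L := []) ⟨by simp, List.isChain_nil⟩
  · induction hx using Submodule.span_induction with
    | mem x hx =>
      obtain ⟨l, L, hL, rfl⟩ := hx
      rw [← mul_assoc, S.X_mul_p, mul_assoc]
      exact p_mul_mem_alternatingSpan _ (hL.X_mul_mem hX i)
    | zero => simp
    | add x y _ _ hx hy => rw [mul_add]; exact add_mem hx hy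
    | smul c x _ hx => rw [mul_smul_comm]; exact Submodule.smul_mem _ c hx

include hX hlam in
lemma trace_X {z : A} (hz : z ∈ S.generated) (i : Fin 2) :
    S.φ false (S.X i * z) = lam * S.φ true (z * S.X i) := by
  replace hz := generated_le_alternatingSpan hX hz
  induction hz using Submodule.span_induction with
  | mem x hx =>
    obtain ⟨l, L, hL, rfl⟩ := hx
    rw [← mul_assoc, S.X_mul_p, mul_assoc, mul_assoc, φ_p_mul, φ_p_mul, hL.trace_X hX hlam]
    cases l <;> simp
  | zero => simp
  | add x y _ _ hx hy => rw [mul_add, add_mul, map_add, map_add, hx, hy]; ring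
  | smul c x _ hx =>
    rw [mul_smul_comm, smul_mul_assoc, map_smul, map_smul, hx]; simp only [smul_eq_mul]; ring

include hX hlam in
lemma trace_XX {z : A} (hz : z ∈ S.generated) (i j : Fin 2) :
    S.φ true (S.X i * S.X j * z) = S.φ true (z * (S.X i * S.X j)) := by
  replace hz := generated_le_alternatingSpan hX hz
  induction hz using Submodule.span_induction with
  | mem x hx =>
    obtain ⟨l, L, hL, rfl⟩ := hx
    have e : S.X i * S.X j * (S.p l * listProd L) = S.p l * (S.X i * S.X j * listProd L) := by
      rw [← mul_assoc, mul_assoc (S.X i), S.X_mul_p, ← mul_assoc, S.X_mul_p, Bool.not_not]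
      simp only [mul_assoc]
    rw [e, mul_assoc (S.p l), φ_p_mul, φ_p_mul, hL.trace_XX hX hlam]
  | zero => simp
  | add x y _ _ hx hy => rw [mul_add, add_mul, map_add, map_add, hx, hy]
  | smul c x _ hx => rw [mul_smul_comm, smul_mul_assoc, map_smul, map_smul, hx]

-- A word that returns to its corner has even length, so it can be carried around two letters at a
-- time.
include hX hlam in
lemma φ_true_wordProd_mul : ∀ (w : List (Fin 2)), lab true w = true → ∀ z ∈ S.generated,
    S.φ true (S.wordProd w * z) = S.φ true (z * S.wordProd w)
  | [], _, z, _ => by simp [LetterSystem.wordProd]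
  | [_], h, _, _ => by simp [lab] at h
  | i :: j :: w, h, z, hz => by
    have ih := φ_true_wordProd_mul w (by simpa [lab] using h) (z * (S.X i * S.X j))
      (mul_mem hz (mul_mem (S.X_mem_generated i) (S.X_mem_generated j)))
    rw [S.wordProd_cons, S.wordProd_cons, ← mul_assoc, mul_assoc,
      trace_XX hX hlam (mul_mem (S.wordProd_mem w) hz), mul_assoc, ih]
    simp only [mul_assoc]

include hX hlam in
/-- The functional of the first corner is a trace. -/
lemma trace_true {y z : A} (hy : y ∈ S.generated) (hz : z ∈ S.generated) :
    S.φ true (S.p true * y * S.p true * z) = S.φ true (z * (S.p true * y * S.p true)) := by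
  refine S.generated_induction (P := fun y => S.φ true (S.p true * y * S.p true * z)
    = S.φ true (z * (S.p true * y * S.p true))) ?_ ?_ ?_ ?_ hy
  · intro w l
    rw [S.p_mul_wordProd_mul_p]
    split_ifs with h
    · rw [mul_assoc, φ_true_wordProd_mul hX hlam w h.2 _ (mul_mem (S.p_mem_generated _) hz),
        mul_assoc, φ_p_mul, if_pos rfl, ← mul_assoc, φ_mul_p, if_pos rfl]
    · simp
  · simp
  · intro x y hx hy; simp only [mul_add, add_mul, map_add, hx, hy]
  · intro c x hx; simp only [mul_smul_comm, smul_mul_assoc, map_smul, hx]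

include hX hlam in
/-- The trace relation between the two corners. -/
lemma trace_false_true {y z : A} (hy : y ∈ S.generated) (hz : z ∈ S.generated) :
    S.φ false (S.p false * y * S.p true * z)
      = lam * S.φ true (z * (S.p false * y * S.p true)) := by
  refine S.generated_induction (P := fun y => S.φ false (S.p false * y * S.p true * z)
    = lam * S.φ true (z * (S.p false * y * S.p true))) ?_ ?_ ?_ ?_ hy
  · intro w l
    rw [S.p_mul_wordProd_mul_p]
    split_ifs with h
    · rcases w with _ | ⟨i, w⟩
      · simp [lab] at h
      have hpz := mul_mem (S.p_mem_generated true) hz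
      rw [S.wordProd_cons, mul_assoc, mul_assoc,
        trace_X hX hlam (mul_mem (S.wordProd_mem w) hpz), mul_assoc,
        φ_true_wordProd_mul hX hlam w (by simpa [lab] using h.2) _
          (mul_mem hpz (S.X_mem_generated i)), mul_assoc, mul_assoc, φ_p_mul, if_pos rfl,
        ← mul_assoc z (S.X i * _), φ_mul_p, if_pos rfl]
    · simp
  · simp
  · intro x y hx hy; simp only [mul_add, add_mul, map_add, hx, hy]
  · intro c x hx; simp only [mul_smul_comm, smul_mul_assoc, map_smul, hx, smul_eq_mul]; ring

include hX hlam in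
/-- The functional of the second corner is a trace. -/
lemma trace_false {y z : A} (hy : y ∈ S.generated) (hz : z ∈ S.generated) :
    S.φ false (S.p false * y * S.p false * z) = S.φ false (z * (S.p false * y * S.p false)) := by
  refine S.generated_induction (P := fun y => S.φ false (S.p false * y * S.p false * z)
    = S.φ false (z * (S.p false * y * S.p false))) ?_ ?_ ?_ ?_ hy
  · intro w l
    rw [S.p_mul_wordProd_mul_p]
    split_ifs with h
    · rcases w with _ | ⟨i, w⟩
      · simp [LetterSystem.wordProd, φ_p_mul, φ_mul_p]
      have hw : lab false w = true := by simpa [lab] using h.2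
      have hpz := mul_mem (S.p_mem_generated false) hz
      -- Both sides are compared in the first corner: `trace_X` moves the leading letter there, and
      -- this relation moves the remaining word.
      have h1 := trace_false_true hX hlam (mul_mem hz (S.X_mem_generated i)) (S.wordProd_mem w)
      have h2 : S.p true * S.wordProd w = S.wordProd w * S.p false := by
        rw [S.wordProd_mul_p, hw]
      rw [mul_assoc _ (S.p true), h2, ← mul_assoc, φ_mul_p, if_pos rfl, mul_assoc, φ_p_mul,
        if_pos rfl, ← mul_assoc, φ_mul_p, if_pos rfl] at h1
      rw [S.wordProd_cons, mul_assoc, mul_assoc,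
        trace_X hX hlam (mul_mem (S.wordProd_mem w) hpz), ← mul_assoc z, φ_mul_p, if_pos rfl,
        ← mul_assoc z, h1]
      simp only [mul_assoc]
    · simp
  · simp
  · intro x y hx hy; simp only [mul_add, add_mul, map_add, hx, hy]
  · intro c x hx; simp only [mul_smul_comm, smul_mul_assoc, map_smul, hx]

end Trace

end FreeLetters

end RectConv

/-! ### A Hilbert space model of free letters -/

namespace RectConv

/-! ### Weighted composition operators on ℓ². -/

section WeightedComp

open scoped ENNReal lp InnerProductSpace

variable {ι : Type*} {σ : ι → ι} {c : ι → ℝ} {C : ℝ}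

lemma tsum_norm_weightedComp_le (hσ : Function.Injective σ) (hc : ∀ i, |c i| ≤ C)
    (f : ℓ²(ι, ℂ)) :
    (Summable fun i => ‖(c i : ℂ) * f (σ i)‖ ^ (2 : ℝ≥0∞).toReal) ∧
      ∑' i, ‖(c i : ℂ) * f (σ i)‖ ^ (2 : ℝ≥0∞).toReal ≤ (C * ‖f‖) ^ (2 : ℝ≥0∞).toReal := by
  have h2 : (0 : ℝ) < (2 : ℝ≥0∞).toReal := by norm_num
  have hs := (lp.memℓp f).summable h2
  have hs' := (hs.comp_injective hσ).mul_left (C ^ 2)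
  have hle : ∀ i, ‖(c i : ℂ) * f (σ i)‖ ^ (2 : ℝ≥0∞).toReal
      ≤ C ^ 2 * ((fun i => ‖f i‖ ^ (2 : ℝ≥0∞).toReal) ∘ σ) i := by
    intro i
    simp only [ENNReal.toReal_ofNat, Real.rpow_ofNat, Function.comp, norm_mul, Complex.norm_real,
      Real.norm_eq_abs, mul_pow]
    gcongr
    exact hc i
  have hsum := Summable.of_nonneg_of_le (fun i => by positivity) hle hs'
  refine ⟨hsum, (hsum.tsum_le_tsum hle hs').trans ?_⟩
  rw [tsum_mul_left, ENNReal.toReal_ofNat, Real.rpow_ofNat, mul_pow]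
  have := lp.norm_rpow_eq_tsum h2 f
  rw [ENNReal.toReal_ofNat, Real.rpow_ofNat] at this
  rw [this]
  refine mul_le_mul_of_nonneg_left ?_ (sq_nonneg C)
  have := tsum_comp_le_tsum_of_inj hs (fun i => by positivity) hσ
  simpa only [ENNReal.toReal_ofNat, Real.rpow_ofNat, Function.comp_def] using this

/-- The weighted composition operator `f ↦ c * (f ∘ σ)` on `ℓ²`. -/
noncomputable def weightedComp (hσ : Function.Injective σ) (hc : ∀ i, |c i| ≤ C) (hC : 0 ≤ C) :
    ℓ²(ι, ℂ) →L[ℂ] ℓ²(ι, ℂ) :=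
  LinearMap.mkContinuous
    { toFun := fun f => ⟨fun i => (c i : ℂ) * f (σ i),
        memℓp_gen (tsum_norm_weightedComp_le hσ hc f).1⟩
      map_add' := fun f g => by ext i; exact mul_add _ _ _
      map_smul' := fun a f => by ext i; exact mul_left_comm _ _ _ } C
    fun f => lp.norm_le_of_tsum_le (by norm_num) (by positivity)
      (tsum_norm_weightedComp_le hσ hc f).2

lemma weightedComp_apply (hσ : Function.Injective σ) (hc : ∀ i, |c i| ≤ C) (hC : 0 ≤ C)
    (f : ℓ²(ι, ℂ)) (i : ι) : weightedComp hσ hc hC f i = c i * f (σ i) := rfl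

variable [DecidableEq ι]

lemma star_weightedComp_single (hσ : Function.Injective σ) (hc : ∀ i, |c i| ≤ C) (hC : 0 ≤ C)
    (j : ι) : star (weightedComp hσ hc hC) (lp.single 2 j 1) = (c j : ℂ) • lp.single 2 (σ j) 1 := by
  ext i
  have h1 := lp.inner_single_left (𝕜 := ℂ) i (1 : ℂ)
    (star (weightedComp hσ hc hC) (lp.single 2 j 1) : ℓ²(ι, ℂ))
  rw [ContinuousLinearMap.star_eq_adjoint, ContinuousLinearMap.adjoint_inner_right,
    lp.inner_single_right, weightedComp_apply] at h1
  have h2 : (lp.single 2 i (1 : ℂ) : ℓ²(ι, ℂ)) (σ j) = (lp.single 2 (σ j) (1 : ℂ) : ℓ²(ι, ℂ)) i := by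
    simp [Pi.single_apply, eq_comm]
  rw [h2] at h1
  simp only [RCLike.inner_apply, map_one, mul_one, one_mul, map_mul] at h1
  rw [ContinuousLinearMap.star_eq_adjoint, ← h1, lp.coeFn_smul, Pi.smul_apply]
  simp [Pi.single_apply]

lemma weightedComp_single (hσ : Function.Injective σ) (hc : ∀ i, |c i| ≤ C) (hC : 0 ≤ C) (j : ι) :
    weightedComp hσ hc hC (lp.single 2 (σ j) 1) = (c j : ℂ) • lp.single 2 j 1 := by
  ext i
  rw [weightedComp_apply, lp.coeFn_smul, Pi.smul_apply]
  by_cases h : i = j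
  · subst h; simp
  · have : σ i ≠ σ j := fun e => h (hσ e)
    simp [h, this]

lemma weightedComp_single_of_notMem (hσ : Function.Injective σ) (hc : ∀ i, |c i| ≤ C)
    (hC : 0 ≤ C) {k : ι} (hk : ∀ j, σ j ≠ k) : weightedComp hσ hc hC (lp.single 2 k 1) = 0 := by
  ext i
  rw [weightedComp_apply]
  simp [hk i]

end WeightedComp

/-! ### Creation and annihilation operators on labelled words. -/

section Fock

open scoped ENNReal lp InnerProductSpace

/-- The Hilbert space with an orthonormal basis indexed by the labelled words. -/
abbrev Fock : Type := ℓ²(Bool × List (Fin 2), ℂ)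

/-- The basis vector of a word. -/
noncomputable def basisVec (k : Bool) (w : List (Fin 2)) : Fock := lp.single 2 (k, w) 1

/-- The projection onto the words with label `l`. -/
noncomputable def labProj (l : Bool) : Fock →L[ℂ] Fock :=
  weightedComp (σ := id) (c := fun q => if lab q.1 q.2 = l then 1 else 0) (C := 1)
    Function.injective_id (fun q => by split_ifs <;> simp) zero_le_one

lemma labProj_apply (l : Bool) (f : Fock) (q : Bool × List (Fin 2)) :
    labProj l f q = if lab q.1 q.2 = l then f q else 0 := by
  rw [labProj, weightedComp_apply]
  split_ifs <;> simp

lemma isStarProjection_labProj (l : Bool) : IsStarProjection (labProj l) := by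
  refine ⟨?_, ?_⟩
  · ext f q
    simp only [mul_apply_eq_comp, labProj_apply]
    split_ifs <;> rfl
  · rw [ContinuousLinearMap.isSelfAdjoint_iff_isSymmetric]
    intro f g
    simp only [ContinuousLinearMap.coe_coe, lp.inner_eq_tsum, labProj_apply]
    refine tsum_congr fun q => ?_
    split_ifs <;> simp

lemma labProj_basisVec (l k : Bool) (w : List (Fin 2)) :
    labProj l (basisVec k w) = if lab k w = l then basisVec k w else 0 := by
  ext q
  rw [labProj_apply]
  by_cases h : q = (k, w)
  · subst h; split_ifs <;> simp
  · simp only [basisVec]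
    split_ifs <;> simp [h]

variable {m : Fin 2 → Bool → Measure ℝ} {R : ℝ} (hm : ∀ i l, SymmBdd (m i l) R)

lemma injective_cons (i : Fin 2) :
    Function.Injective fun q : Bool × List (Fin 2) => (q.1, i :: q.2) := by
  intro q q' h
  simp only [Prod.mk.injEq, List.cons.injEq, true_and] at h
  exact Prod.ext h.1 h.2

include hm in
lemma abs_sqrt_weight_le (i : Fin 2) (q : Bool × List (Fin 2)) : |√(weight m q.1 i q.2)| ≤ |R| := by
  rw [abs_of_nonneg (Real.sqrt_nonneg _), ← Real.sqrt_sq_eq_abs]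
  exact Real.sqrt_le_sqrt (weight_le hm i q.2)

/-- The annihilation operator of a letter. -/
noncomputable def annih (i : Fin 2) : Fock →L[ℂ] Fock :=
  weightedComp (injective_cons i) (abs_sqrt_weight_le hm i) (abs_nonneg R)

lemma annih_apply (i : Fin 2) (f : Fock) (q : Bool × List (Fin 2)) :
    annih hm i f q = (√(weight m q.1 i q.2) : ℝ) * f (q.1, i :: q.2) :=
  weightedComp_apply (injective_cons i) (abs_sqrt_weight_le hm i) (abs_nonneg R) f q

/-- The field operator of a letter. -/
noncomputable def field (i : Fin 2) : Fock →L[ℂ] Fock := annih hm i + star (annih hm i)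

lemma isSelfAdjoint_field (i : Fin 2) : IsSelfAdjoint (field hm i) := by
  rw [field]; exact IsSelfAdjoint.add_star_self _

lemma annih_mul_labProj (i : Fin 2) (l : Bool) :
    annih hm i * labProj l = labProj (!l) * annih hm i := by
  ext f q
  simp only [mul_apply_eq_comp, labProj_apply, annih_apply]
  by_cases h : lab q.1 q.2 = !l
  · have h' : lab q.1 (i :: q.2) = l := by rw [lab, h, Bool.not_not]
    rw [if_pos h, if_pos h']
  · have h' : ¬ lab q.1 (i :: q.2) = l := fun e => h (by rw [← e, lab, Bool.not_not])
    rw [if_neg h, if_neg h', mul_zero]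

lemma field_mul_labProj (i : Fin 2) (l : Bool) :
    field hm i * labProj l = labProj (!l) * field hm i := by
  have h := congrArg star (annih_mul_labProj hm i (!l))
  rw [star_mul, star_mul, (isStarProjection_labProj _).isSelfAdjoint.star_eq,
    (isStarProjection_labProj _).isSelfAdjoint.star_eq, Bool.not_not] at h
  rw [field, add_mul, mul_add, annih_mul_labProj, h]

/-- The letter system of the model. -/
noncomputable def fockSystem : LetterSystem (Fock →L[ℂ] Fock) where
  p := labProj
  X := field hm
  p_mul_self l := (isStarProjection_labProj l).isIdempotentElem.eq
  p_mul_not l := by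
    ext f q
    simp only [mul_apply_eq_comp, labProj_apply]
    cases lab q.1 q.2 <;> cases l <;> simp
  p_add := by
    ext f q
    simp only [add_apply, lp.coeFn_add, Pi.add_apply, labProj_apply]
    cases lab q.1 q.2 <;> simp
  X_mul_p := field_mul_labProj hm

variable (m) in
/-- The norm of the monic word vector. -/
noncomputable def wordNorm (k : Bool) : List (Fin 2) → ℝ
  | [] => 1
  | i :: w => √(weight m k i w) * wordNorm k w

variable (m) in
/-- The monic word vector. -/
noncomputable def wordVec (k : Bool) (w : List (Fin 2)) : Fock :=
  ((wordNorm m k w : ℝ) : ℂ) • basisVec k w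

lemma labProj_wordVec (l k : Bool) (w : List (Fin 2)) :
    labProj l (wordVec m k w) = if lab k w = l then wordVec m k w else 0 := by
  rw [wordVec, map_smul, labProj_basisVec]
  split_ifs <;> simp

lemma star_annih_wordVec (i : Fin 2) (k : Bool) (w : List (Fin 2)) :
    star (annih hm i) (wordVec m k w) = wordVec m k (i :: w) := by
  have h := star_weightedComp_single (injective_cons i) (abs_sqrt_weight_le hm i) (abs_nonneg R)
    (k, w)
  change star (annih hm i) (basisVec k w) = _ • basisVec k (i :: w) at h
  rw [wordVec, map_smul, h, wordVec, wordNorm, smul_smul]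
  push_cast
  rw [mul_comm]

lemma annih_wordVec_nil (i : Fin 2) (k : Bool) : annih hm i (wordVec m k []) = 0 := by
  have h : annih hm i (basisVec k []) = 0 := weightedComp_single_of_notMem (injective_cons i)
    (abs_sqrt_weight_le hm i) (abs_nonneg R) (by simp)
  rw [wordVec, map_smul, h, smul_zero]

lemma annih_wordVec_cons (i j : Fin 2) (k : Bool) (w : List (Fin 2)) :
    annih hm i (wordVec m k (j :: w))
      = if j = i then ((weight m k i w : ℝ) : ℂ) • wordVec m k w else 0 := by
  split_ifs with h
  · subst h
    have h := weightedComp_single (injective_cons j) (abs_sqrt_weight_le hm j) (abs_nonneg R) (k, w)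
    change annih hm j (basisVec k (j :: w)) = _ • basisVec k w at h
    rw [wordVec, map_smul, h, wordVec, wordNorm, smul_smul, smul_smul]
    congr 1
    norm_cast
    rw [mul_comm, ← mul_assoc, Real.mul_self_sqrt (weight_nonneg _ _)]
  · have h : annih hm i (basisVec k (j :: w)) = 0 := by
      refine weightedComp_single_of_notMem (injective_cons i)
        (abs_sqrt_weight_le hm i) (abs_nonneg R) fun q hq => ?_
      simp only [Prod.mk.injEq, List.cons.injEq] at hq
      exact h hq.2.1.symm
    rw [wordVec, map_smul, h, smul_zero]

lemma field_wordVec_of_run_eq_zero {i : Fin 2} {w : List (Fin 2)} (hw : run i w = 0) (k : Bool) :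
    field hm i (wordVec m k w) = wordVec m k (i :: w) := by
  rw [field, add_apply, star_annih_wordVec]
  rcases w with _ | ⟨j, w⟩
  · rw [annih_wordVec_nil, zero_add]
  · have : j ≠ i := by rintro rfl; rw [run_cons_self] at hw; omega
    rw [annih_wordVec_cons, if_neg this, zero_add]

lemma field_wordVec_cons (i : Fin 2) (k : Bool) (w : List (Fin 2)) :
    field hm i (wordVec m k (i :: w))
      = wordVec m k (i :: i :: w) + ((weight m k i w : ℝ) : ℂ) • wordVec m k w := by
  rw [field, add_apply, star_annih_wordVec, annih_wordVec_cons, if_pos rfl,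
    add_comm]

variable (m) in
/-- The span of the vectors of the words which start with a letter. -/
noncomputable def startSpan (k : Bool) (i : Fin 2) : Submodule ℂ Fock :=
  Submodule.span ℂ (range fun w => wordVec m k (i :: w))

lemma wordVec_mem_startSpan (k : Bool) (i : Fin 2) (w : List (Fin 2)) :
    wordVec m k (i :: w) ∈ startSpan m k i := Submodule.subset_span ⟨w, rfl⟩

lemma rest_eq_self {i : Fin 2} {w : List (Fin 2)} (hw : run i w = 0) : rest i w = w := by
  rcases w with _ | ⟨j, w⟩
  · rfl
  · refine rest_cons_ne ?_ w
    rintro rfl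
    rw [run_cons_self] at hw
    omega

lemma run_replicate_append {i : Fin 2} {v : List (Fin 2)} (hv : run i v = 0) (n : ℕ) :
    run i (List.replicate n i ++ v) = n ∧ rest i (List.replicate n i ++ v) = v := by
  induction n with
  | zero => exact ⟨hv, rest_eq_self hv⟩
  | succ n ih =>
    rw [List.replicate_succ, List.cons_append, run_cons_self, rest_cons_self]
    exact ⟨by rw [ih.1], ih.2⟩

/-- Powers of a letter, modulo the words which start with that letter. -/
lemma field_pow_wordVec {i : Fin 2} {v : List (Fin 2)} (hv : run i v = 0) (k : Bool) (n : ℕ) :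
    ∀ j, (field hm i ^ n) (wordVec m k (List.replicate j i ++ v))
      - ((orthoMoment (m i (lab k v)) n j : ℝ) : ℂ) • wordVec m k v ∈ startSpan m k i := by
  induction n with
  | zero =>
    intro j
    rw [(hm i _).orthoMoment_zero_left]
    rcases j with _ | j
    · simp
    · simpa [List.replicate_succ] using wordVec_mem_startSpan k i _
  | succ n ih =>
    intro j
    rw [pow_succ, mul_apply_eq_comp]
    rcases j with _ | j
    · have h1 : field hm i (wordVec m k v) = wordVec m k (List.replicate 1 i ++ v) :=
        field_wordVec_of_run_eq_zero hm hv k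
      rw [List.replicate_zero, List.nil_append, h1, orthoMoment_succ_zero]
      exact ih 1
    · have h1 := field_wordVec_cons hm i k (List.replicate j i ++ v)
      rw [weight, (run_replicate_append hv j).1, (run_replicate_append hv j).2] at h1
      rw [List.replicate_succ, List.cons_append, h1, map_add, map_smul,
        (hm i _).orthoMoment_succ_succ]
      have h2 := add_mem (ih (j + 2)) (Submodule.smul_mem _
        ((jacobi (m i (lab k v)) j : ℝ) : ℂ) (ih j))
      convert h2 using 1
      rw [List.replicate_succ, List.replicate_succ, List.cons_append, List.cons_append, smul_sub,
        smul_smul]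
      push_cast
      rw [add_smul]
      abel

/-- The vacuum vectors. -/
noncomputable def vacuum (k : Bool) : Fock := basisVec k []

lemma wordVec_nil (k : Bool) : wordVec m k [] = vacuum k := by simp [wordVec, wordNorm, vacuum]

lemma labProj_vacuum (l k : Bool) : labProj l (vacuum k) = if k = l then vacuum k else 0 :=
  labProj_basisVec l k []

/-- The vector functionals of the vacuum vectors. -/
noncomputable def vacuumState (k : Bool) : (Fock →L[ℂ] Fock) →ₗ[ℂ] ℂ where
  toFun T := ⟪vacuum k, T (vacuum k)⟫_ℂ
  map_add' S T := inner_add_right _ _ _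
  map_smul' c T := by simp

lemma vacuumState_apply (k : Bool) (T : Fock →L[ℂ] Fock) :
    vacuumState k T = ⟪vacuum k, T (vacuum k)⟫_ℂ := rfl

lemma inner_vacuum_self (k : Bool) : ⟪vacuum k, vacuum k⟫_ℂ = 1 := by
  rw [vacuum, basisVec, lp.inner_single_left]
  simp

lemma inner_vacuum_startSpan (k : Bool) (i : Fin 2) {f : Fock} (hf : f ∈ startSpan m k i) :
    ⟪vacuum k, f⟫_ℂ = 0 := by
  induction hf using Submodule.span_induction with
  | mem f hf =>
    obtain ⟨w, rfl⟩ := hf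
    simp [vacuum, wordVec, basisVec, lp.inner_single_left]
  | zero => simp
  | add f g _ _ hf hg => rw [inner_add_right, hf, hg, add_zero]
  | smul c f _ hf => rw [inner_smul_right, hf, mul_zero]

lemma vacuumState_field_pow (i : Fin 2) (k : Bool) (n : ℕ) :
    vacuumState k (field hm i ^ n) = ((∫ x, x ^ n ∂(m i k) : ℝ) : ℂ) := by
  have := inner_vacuum_startSpan k i (field_pow_wordVec hm (v := []) rfl k n 0)
  rw [List.replicate_zero, List.nil_append, wordVec_nil, inner_sub_right, inner_smul_right,
    inner_vacuum_self, mul_one, sub_eq_zero] at this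
  rw [vacuumState_apply, this, orthoMoment_zero_right]
  rfl

lemma vacuumState_mul_labProj (k l : Bool) (T : Fock →L[ℂ] Fock) :
    vacuumState k (T * labProj l) = if k = l then vacuumState k T else 0 := by
  rw [vacuumState_apply, mul_apply_eq_comp, labProj_vacuum]
  split_ifs
  · rfl
  · simp

/-- Elements of the span of a letter act diagonally, modulo the words which start with it. -/
lemma letterSpan_wordVec {i : Fin 2} {b : Fock →L[ℂ] Fock}
    (hb : b ∈ (fockSystem hm).letterSpan i) (k : Bool) {v : List (Fin 2)} (hv : run i v = 0) :
    b (wordVec m k v) - vacuumState (lab k v) b • wordVec m k v ∈ startSpan m k i := by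
  refine LetterSystem.letterSpan_induction (P := fun b =>
    b (wordVec m k v) - vacuumState (lab k v) b • wordVec m k v ∈ startSpan m k i) ?_ ?_ ?_ ?_ hb
  · intro n l
    have h := field_pow_wordVec hm hv k n 0
    rw [orthoMoment_zero_right, List.replicate_zero, List.nil_append] at h
    change (field hm i ^ n * labProj l) _ - vacuumState _ (field hm i ^ n * labProj l) • _ ∈ _
    rw [vacuumState_mul_labProj, mul_apply_eq_comp, labProj_wordVec,
      vacuumState_field_pow]
    split_ifs
    · exact h
    · simp
  · simp
  · intro x y hx hy
    have := add_mem hx hy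
    convert this using 1
    rw [add_apply, map_add, add_smul]
    abel
  · intro c x hx
    have := Submodule.smul_mem _ c hx
    convert this using 1
    rw [smul_apply, map_smul, smul_sub, smul_assoc]

/-- A centred factor has no diagonal part, so it sends words not starting with its letter to the
span of words that do. Applied from the right, an alternating product never returns to the vacuum.
-/
lemma prod_vacuum_mem_startSpan (k : Bool) :
    ∀ (w : List (Fin 2 × (Fock →L[ℂ] Fock))), (∀ x ∈ w, x.2 ∈ (fockSystem hm).letterSpan x.1 ∧
      ∀ l, vacuumState l x.2 = 0) → w.IsChain (fun x y => x.1 ≠ y.1) → ∀ x ∈ w.head?,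
      (w.map Prod.snd).prod (vacuum k) ∈ startSpan m k x.1
  | [], _, _, x, hx => by simp at hx
  | y :: w, h, hc, x, hx => by
    simp only [List.head?_cons, Option.mem_some_iff] at hx
    subst hx
    obtain ⟨hy, hy0⟩ := h y (by simp)
    have key : ∀ v, run y.1 v = 0 → y.2 (wordVec m k v) ∈ startSpan m k y.1 := by
      intro v hv
      have := letterSpan_wordVec hm hy k hv
      rwa [hy0, zero_smul, sub_zero] at this
    rw [List.map_cons, List.prod_cons, mul_apply_eq_comp]
    rcases w with _ | ⟨z, w⟩
    · simpa [wordVec_nil] using key [] rfl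
    · have ih := prod_vacuum_mem_startSpan k (z :: w)
        (fun x hx => h x (List.mem_cons_of_mem _ hx)) (List.isChain_cons.1 hc).2 z (by simp)
      have hne : z.1 ≠ y.1 := Ne.symm ((List.isChain_cons.1 hc).1 z (by simp))
      generalize ((z :: w).map Prod.snd).prod (vacuum k) = f at ih
      induction ih using Submodule.span_induction with
      | mem f hf => obtain ⟨v, rfl⟩ := hf; exact key _ (run_cons_ne hne v)
      | zero => simp
      | add f g _ _ hf hg => rw [map_add]; exact add_mem hf hg
      | smul c f _ hf => rw [map_smul]; exact Submodule.smul_mem _ c hf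

/-- The free letters of the model. -/
noncomputable def fockLetters : FreeLetters m (Fock →L[ℂ] Fock) where
  toLetterSystem := fockSystem hm
  φ := vacuumState
  B i := Algebra.adjoin ℂ (range labProj ∪ {field hm i})
  corner l T := by
    have h : labProj l (vacuum l) = vacuum l := by rw [labProj_vacuum, if_pos rfl]
    change _ = ⟪vacuum l, labProj l (T (labProj l (vacuum l)))⟫_ℂ
    rw [← (isStarProjection_labProj l).isSelfAdjoint.star_eq,
      ContinuousLinearMap.star_eq_adjoint, ContinuousLinearMap.adjoint_inner_right,
      ← ContinuousLinearMap.star_eq_adjoint,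
      (isStarProjection_labProj l).isSelfAdjoint.star_eq, h]
    rfl
  unit l := by
    change ⟪vacuum l, labProj l (vacuum l)⟫_ℂ = 1
    rw [labProj_vacuum, if_pos rfl]
    exact inner_vacuum_self l
  moment i l n := vacuumState_field_pow hm i l n
  p_mem i l := Algebra.subset_adjoin (Or.inl ⟨l, rfl⟩)
  X_mem i := Algebra.subset_adjoin (Or.inr rfl)
  free w hw hx hc l := by
    obtain ⟨x, w, rfl⟩ := List.exists_cons_of_ne_nil hw
    exact inner_vacuum_startSpan l x.1 (prod_vacuum_mem_startSpan hm l _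
      (fun y hy => ⟨LetterSystem.mem_letterSpan_of_mem_adjoin (S := fockSystem hm) (hx y hy).1,
        (hx y hy).2⟩) hc x (by simp))

end Fock

end RectConv

/-! ### Existence of the convolution of compactly supported measures -/

namespace RectConv

/-! ### Spectral measures. -/

section Spectral

open scoped InnerProductSpace CompactlySupported

/-- The spectral measure of a bounded self-adjoint operator at a unit vector. -/
lemma exists_spectral_measure {H : Type*} [NormedAddCommGroup H] [InnerProductSpace ℂ H]
    [CompleteSpace H] {T : H →L[ℂ] H} (hT : IsSelfAdjoint T) {v : H} (hv : ‖v‖ = 1) :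
    ∃ ν : Measure ℝ, IsProbabilityMeasure ν ∧ (∃ r, ∀ᵐ x ∂ν, |x| ≤ r) ∧
      ∀ n, ∫ x, x ^ n ∂ν = (⟪v, (T ^ n) v⟫_ℂ).re := by
  -- By functional calculus f ↦ Re⟨v, f(T)v⟩ is a positive functional on functions on the compact
  -- spectrum, to which the Riesz–Markov theorem applies.
  let L : C_c(spectrum ℝ T, ℝ) →ₗ[ℝ] ℝ :=
    { toFun := fun f => (⟪v, cfcHom hT (f : C(spectrum ℝ T, ℝ)) v⟫_ℂ).re
      map_add' := fun f g => by
        have : ((f + g : C_c(spectrum ℝ T, ℝ)) : C(spectrum ℝ T, ℝ)) = f + g := rfl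
        rw [this, map_add, add_apply, inner_add_right, Complex.add_re]
      map_smul' := fun c f => by
        have : ((c • f : C_c(spectrum ℝ T, ℝ)) : C(spectrum ℝ T, ℝ)) = c • (f : C(spectrum ℝ T, ℝ)) :=
          rfl
        rw [this, map_smul, smul_apply, ← Complex.coe_smul, inner_smul_right, Complex.re_ofReal_mul]
        rfl }
  have hL : ∀ f, 0 ≤ f → 0 ≤ L f := by
    intro f hf
    have h1 : 0 ≤ cfcHom hT (f : C(spectrum ℝ T, ℝ)) := (cfcHom_nonneg_iff hT).2 hf
    exact ((ContinuousLinearMap.nonneg_iff_isPositive _).1 h1).re_inner_nonneg_right v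
  let Λ := PositiveLinearMap.mk₀ L hL
  set ν₀ := RealRMK.rieszMeasure Λ
  have hint : ∀ f : C(spectrum ℝ T, ℝ), ∫ x, f x ∂ν₀ = (⟪v, cfcHom hT f v⟫_ℂ).re := fun f =>
    RealRMK.integral_rieszMeasure Λ (CompactlySupportedContinuousMap.continuousMapEquiv f)
  have hprob : IsProbabilityMeasure ν₀ := by
    have h1 := hint 1
    rw [map_one, one_apply_eq_self] at h1
    simp only [ContinuousMap.one_apply, integral_const, smul_eq_mul, mul_one] at h1
    rw [inner_self_eq_norm_sq_to_K, hv] at h1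
    constructor
    have h2 : (ν₀ univ).toReal = 1 := by simpa [Measure.real] using h1
    rw [← ENNReal.toReal_eq_one_iff]
    exact h2
  have hm : Measurable (Subtype.val : spectrum ℝ T → ℝ) := measurable_subtype_coe
  refine ⟨ν₀.map Subtype.val, Measure.isProbabilityMeasure_map hm.aemeasurable, ⟨‖T‖, ?_⟩, ?_⟩
  · rw [ae_map_iff hm.aemeasurable (measurableSet_le measurable_abs measurable_const)]
    refine Filter.Eventually.of_forall fun x => ?_
    have := spectrum.norm_le_norm_mul_of_mem x.2
    refine this.trans (mul_le_of_le_one_right (norm_nonneg _) ?_)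
    exact ContinuousLinearMap.norm_id_le
  · intro n
    rw [integral_map hm.aemeasurable (by fun_prop)]
    have h1 := hint ((ContinuousMap.restrict (spectrum ℝ T) (ContinuousMap.id ℝ)) ^ n)
    rw [map_pow, cfcHom_id] at h1
    exact h1

end Spectral

/-- A symmetric measure with prescribed even moments. -/
lemma exists_symmetrization {ν : Measure ℝ} (hν : IsProbabilityMeasure ν) {r : ℝ}
    (hr : ∀ᵐ x ∂ν, |x| ≤ r) : ∃ ξ : SymmProb, ξ.CompactlySupported ∧
      ∀ j : ℕ, ∫ x, x ^ (2 * j) ∂ξ.toMeasure = ∫ x, x ^ (2 * j) ∂ν := by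
  let ν' : Measure ℝ := ν.map Neg.neg
  have hν' : IsProbabilityMeasure ν' := Measure.isProbabilityMeasure_map measurable_neg.aemeasurable
  let κ : Measure ℝ := (2 : ENNReal)⁻¹ • (ν + ν')
  have hκ : IsProbabilityMeasure κ := by
    constructor
    simp only [κ, Measure.smul_apply, Measure.add_apply, measure_univ, smul_eq_mul]
    rw [one_add_one_eq_two, ENNReal.inv_mul_cancel (by norm_num) (by norm_num)]
  have hr' : ∀ᵐ x ∂ν', |x| ≤ r := by
    rw [ae_map_iff measurable_neg.aemeasurable (measurableSet_le measurable_abs measurable_const)]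
    simpa using hr
  have hs : κ.IsNegInvariant := by
    constructor
    rw [Measure.neg_def, Measure.map_smul, Measure.map_add _ _ measurable_neg,
      Measure.map_map measurable_neg measurable_neg]
    have : (Neg.neg ∘ Neg.neg : ℝ → ℝ) = id := by ext; simp
    rw [this, Measure.map_id, add_comm]
  refine ⟨⟨⟨κ, hκ⟩, hs⟩, ⟨Icc (-r) r, isCompact_Icc, ?_⟩, fun j => ?_⟩
  · change κ _ = 0
    have h1 : ν (Icc (-r) r)ᶜ = 0 := hr.mono fun x hx => abs_le.1 hx
    have h2 : ν' (Icc (-r) r)ᶜ = 0 := hr'.mono fun x hx => abs_le.1 hx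
    simp [κ, h1, h2]
  · change ∫ x, x ^ (2 * j) ∂κ = _
    have hi : ∀ {ρ : Measure ℝ} (hρ : IsProbabilityMeasure ρ), (∀ᵐ x ∂ρ, |x| ≤ r) →
        Integrable (fun x : ℝ => x ^ (2 * j)) ρ := by
      intro ρ hρ h
      refine Integrable.of_bound (by fun_prop) (r ^ (2 * j)) (h.mono fun x hx => ?_)
      rw [norm_pow]
      exact pow_le_pow_left₀ (norm_nonneg x) hx _
    have h1 : ∫ x, x ^ (2 * j) ∂ν' = ∫ x, x ^ (2 * j) ∂ν := by
      rw [integral_map measurable_neg.aemeasurable (by fun_prop)]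
      simp [pow_mul]
    rw [integral_smul_measure, integral_add_measure (hi hν hr) (hi hν' hr'), h1]
    simp only [ENNReal.toReal_inv, ENNReal.toReal_ofNat, smul_eq_mul]
    ring

/-! ### The operator model as a rectangular probability space. -/

section Model

variable {m : Fin 2 → Bool → Measure ℝ} {R : ℝ} (hm : ∀ i l, SymmBdd (m i l) R)

/-- The `*`-algebra generated by the model. -/
noncomputable def fockAlg : StarSubalgebra ℂ (Fock →L[ℂ] Fock) :=
  StarAlgebra.adjoin ℂ (range labProj ∪ range (field hm))

lemma star_range_eq {s : Set (Fock →L[ℂ] Fock)} (hs : ∀ x ∈ s, IsSelfAdjoint x) : star s = s := by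
  ext x
  rw [Set.mem_star]
  constructor
  · intro h; rw [← star_star x, (hs _ h).star_eq]; exact h
  · intro h; rwa [(hs _ h).star_eq]

lemma mem_adjoin_of_mem_starAdjoin {s : Set (Fock →L[ℂ] Fock)} (hs : ∀ x ∈ s, IsSelfAdjoint x)
    {x : Fock →L[ℂ] Fock} (hx : x ∈ StarAlgebra.adjoin ℂ s) : x ∈ Algebra.adjoin ℂ s := by
  rw [← StarSubalgebra.mem_toSubalgebra, StarAlgebra.adjoin_toSubalgebra, star_range_eq hs,
    union_self] at hx
  exact hx

lemma mem_generated_of_mem_fockAlg {x : Fock →L[ℂ] Fock} (hx : x ∈ fockAlg hm) :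
    x ∈ (fockLetters hm).generated := by
  refine mem_adjoin_of_mem_starAdjoin ?_ hx
  rintro _ (⟨l, rfl⟩ | ⟨i, rfl⟩)
  · exact (isStarProjection_labProj l).isSelfAdjoint
  · exact isSelfAdjoint_field hm i

lemma labProj_mem_fockAlg (l : Bool) : labProj l ∈ fockAlg hm :=
  StarAlgebra.subset_adjoin _ _ (Or.inl ⟨l, rfl⟩)

lemma field_mem_fockAlg (i : Fin 2) : field hm i ∈ fockAlg hm :=
  StarAlgebra.subset_adjoin _ _ (Or.inr ⟨i, rfl⟩)

/-- The projections, as elements of the model. -/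
noncomputable def modelProj (l : Bool) : fockAlg hm := ⟨labProj l, labProj_mem_fockAlg hm l⟩

/-- The letters, as elements of the model. -/
noncomputable def modelField (i : Fin 2) : fockAlg hm := ⟨field hm i, field_mem_fockAlg hm i⟩

/-- The functionals of the model. -/
noncomputable def modelState (l : Bool) : fockAlg hm →ₗ[ℂ] ℂ :=
  vacuumState l ∘ₗ (fockAlg hm).toSubalgebra.val.toLinearMap

lemma modelState_apply (l : Bool) (x : fockAlg hm) : modelState hm l x = vacuumState l x := rfl

lemma isStarProjection_modelProj (l : Bool) : IsStarProjection (modelProj hm l) :=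
  ⟨Subtype.ext (isStarProjection_labProj l).isIdempotentElem.eq,
    Subtype.ext (isStarProjection_labProj l).isSelfAdjoint.star_eq⟩

variable {lam : ℝ} (hX : ∀ i l, vacuumState l (field hm i) = 0)
  (hlam : ∀ i n, vacuumState false (field hm i ^ (n + 1))
    = (lam : ℂ) * vacuumState true (field hm i ^ (n + 1)))

/-- The rectangular probability space of the model. -/
noncomputable def modelSpace : RectProbSpace (lam / (1 + lam)) (1 / (1 + lam)) (fockAlg hm) where
  p₁ := modelProj hm true
  p₂ := modelProj hm false
  φ₁ := modelState hm true
  φ₂ := modelState hm false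
  proj₁ := isStarProjection_modelProj hm true
  proj₂ := isStarProjection_modelProj hm false
  orth₁₂ := Subtype.ext ((fockLetters hm).p_mul_not true)
  orth₂₁ := Subtype.ext ((fockLetters hm).p_mul_not false)
  add_eq_one := Subtype.ext (fockLetters hm).p_add
  corner₁ x := (fockLetters hm).corner true x
  corner₂ x := (fockLetters hm).corner false x
  unit₁ := (fockLetters hm).unit true
  unit₂ := (fockLetters hm).unit false
  trace₁ x y hx hy := by
    have h := FreeLetters.trace_true (S := fockLetters hm) hX hlam
      (mem_generated_of_mem_fockAlg hm x.2) (mem_generated_of_mem_fockAlg hm y.2)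
    have hx' : labProj true * (x : Fock →L[ℂ] Fock) * labProj true = x := congrArg Subtype.val hx
    change vacuumState true (labProj true * x * labProj true * y)
      = vacuumState true (y * (labProj true * x * labProj true)) at h
    rw [hx'] at h
    exact h
  trace₂ x y hx hy := by
    have h := FreeLetters.trace_false (S := fockLetters hm) hX hlam
      (mem_generated_of_mem_fockAlg hm x.2) (mem_generated_of_mem_fockAlg hm y.2)
    have hx' : labProj false * (x : Fock →L[ℂ] Fock) * labProj false = x := congrArg Subtype.val hx
    change vacuumState false (labProj false * x * labProj false * y)
      = vacuumState false (y * (labProj false * x * labProj false)) at h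
    rw [hx'] at h
    exact h
  trace₁₂ x y hx hy := by
    have h := FreeLetters.trace_false_true (S := fockLetters hm) hX hlam
      (mem_generated_of_mem_fockAlg hm y.2) (mem_generated_of_mem_fockAlg hm x.2)
    have hy' : labProj false * (y : Fock →L[ℂ] Fock) * labProj true = y := congrArg Subtype.val hy
    change vacuumState false (labProj false * y * labProj true * x)
      = lam * vacuumState true (x * (labProj false * y * labProj true)) at h
    rw [hy'] at h
    rw [modelState_apply, modelState_apply]
    change _ * vacuumState true (x * y) = _ * vacuumState false (y * x)
    rw [h]
    push_cast
    ring

/-- The rectangular element of a letter of the model. -/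
noncomputable def modelElt (i : Fin 2) : fockAlg hm :=
  modelProj hm true * modelField hm i * modelProj hm false

lemma modelProj_mul_modelElt (i : Fin 2) :
    modelProj hm true * modelElt hm i * modelProj hm false = modelElt hm i := by
  rw [modelElt, ← mul_assoc, ← mul_assoc, (isStarProjection_modelProj hm true).isIdempotentElem.eq,
    mul_assoc, (isStarProjection_modelProj hm false).isIdempotentElem.eq]

/-- The letter exchanges the corners, so it is the sum of its two off-diagonal blocks, which are
adjoint to each other. -/
lemma modelElt_add_star (i : Fin 2) : modelElt hm i + star (modelElt hm i) = modelField hm i := by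
  have hs : star (modelField hm i) = modelField hm i := Subtype.ext (isSelfAdjoint_field hm i).star_eq
  have hc : ∀ l, modelField hm i * modelProj hm l = modelProj hm (!l) * modelField hm i := fun l =>
    Subtype.ext (field_mul_labProj hm i l)
  have h1 : modelProj hm true + modelProj hm false = 1 := Subtype.ext (fockLetters hm).p_add
  rw [modelElt, star_mul, star_mul, (isStarProjection_modelProj hm _).isSelfAdjoint.star_eq,
    (isStarProjection_modelProj hm _).isSelfAdjoint.star_eq, hs, mul_assoc, hc, hc, Bool.not_false,
    Bool.not_true, ← mul_assoc, ← mul_assoc, (isStarProjection_modelProj hm true).isIdempotentElem.eq,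
    (isStarProjection_modelProj hm false).isIdempotentElem.eq, ← add_mul, h1, one_mul]

/-- The `*`-algebra of a letter. -/
noncomputable def modelSub (i : Fin 2) : StarSubalgebra ℂ (fockAlg hm) :=
  (StarAlgebra.adjoin ℂ (range labProj ∪ {field hm i})).comap (fockAlg hm).subtype

lemma mem_B_of_mem_modelSub {i : Fin 2} {x : fockAlg hm} (hx : x ∈ modelSub hm i) :
    (x : Fock →L[ℂ] Fock) ∈ (fockLetters hm).B i := by
  refine mem_adjoin_of_mem_starAdjoin ?_ hx
  rintro _ (⟨l, rfl⟩ | rfl)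
  · exact (isStarProjection_labProj l).isSelfAdjoint
  · exact isSelfAdjoint_field hm i

lemma modelProj_mem_modelSub (i : Fin 2) (l : Bool) : modelProj hm l ∈ modelSub hm i :=
  StarAlgebra.subset_adjoin _ _ (Or.inl ⟨l, rfl⟩)

lemma modelElt_mem_modelSub (i : Fin 2) : modelElt hm i ∈ modelSub hm i :=
  mul_mem (mul_mem (modelProj_mem_modelSub hm i true)
    (show modelField hm i ∈ modelSub hm i from StarAlgebra.subset_adjoin _ _ (Or.inr rfl)))
    (modelProj_mem_modelSub hm i false)

lemma freeElements_modelElt :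
    (modelSpace hm hX hlam).FreeElements (modelElt hm 0) (modelElt hm 1) := by
  refine ⟨modelSub hm, ⟨fun i => ⟨modelProj_mem_modelSub hm i true,
    modelProj_mem_modelSub hm i false⟩, fun w hw hx hc => ?_⟩, modelElt_mem_modelSub hm 0,
    modelElt_mem_modelSub hm 1⟩
  have key : ∀ l, vacuumState l (((w.map Prod.snd).prod : fockAlg hm) : Fock →L[ℂ] Fock) = 0 := by
    intro l
    have h := (fockLetters hm).free (w.map fun q => (q.1, (q.2 : Fock →L[ℂ] Fock))) (by simpa)
      (by
        intro x hxm
        obtain ⟨q, hq, rfl⟩ := List.mem_map.1 hxm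
        refine ⟨mem_B_of_mem_modelSub hm (hx q hq).1, ?_⟩
        have h2 := (condExp_eq_zero_iff _ _).1 (hx q hq).2
        rintro (_ | _)
        · exact h2.2
        · exact h2.1)
      ((List.isChain_map _).2 hc) l
    rw [List.map_map] at h
    have e : (((w.map Prod.snd).prod : fockAlg hm) : Fock →L[ℂ] Fock)
        = (w.map (Prod.snd ∘ fun q : Fin 2 × fockAlg hm => (q.1, (q.2 : Fock →L[ℂ] Fock)))).prod := by
      clear hw hx hc h
      induction w with
      | nil => rfl
      | cons x w ih =>
        rw [List.map_cons, List.map_cons, List.prod_cons, List.prod_cons, ← ih]; rfl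
    rw [e]
    exact h
  exact (condExp_eq_zero_iff _ _).2 ⟨key true, key false⟩

end Model

lemma exists_symmBdd {μ : SymmProb} (h : μ.CompactlySupported) : ∃ R, SymmBdd μ.toMeasure R := by
  obtain ⟨K, hK, h0⟩ := h
  obtain ⟨r, hr⟩ := hK.isBounded.exists_norm_le
  refine ⟨max r 1, inferInstanceAs (IsProbabilityMeasure (μ.1 : Measure ℝ)), μ.2, ?_, le_max_right _ _⟩
  rw [measure_eq_zero_iff_ae_notMem] at h0
  filter_upwards [h0] with x hx
  rw [mem_compl_iff, not_not] at hx
  exact (hr x hx).trans (le_max_left _ _)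

/-! ### Existence and moments of the convolution. -/

section Existence

variable {lam R : ℝ} {μ₁ μ₂ : SymmProb}

lemma symmBdd_cornerLaw (h0 : 0 ≤ lam) (h1 : lam ≤ 1) (hμ₁ : SymmBdd μ₁.toMeasure R)
    (hμ₂ : SymmBdd μ₂.toMeasure R) (i : Fin 2) (l : Bool) :
    SymmBdd (cornerLaw lam ![μ₁.toMeasure, μ₂.toMeasure] i l) R :=
  SymmBdd.cornerLaw (fun i => by fin_cases i <;> assumption) h0 h1 i l

/-- Free models exist. -/
lemma exists_isFreeModel (h0 : 0 ≤ lam) (h1 : lam ≤ 1) (hμ₁ : SymmBdd μ₁.toMeasure R)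
    (hμ₂ : SymmBdd μ₂.toMeasure R) :
    ∃ (A : Type) (_ : Ring A) (_ : StarRing A) (_ : Algebra ℂ A) (_ : StarModule ℂ A)
      (S : RectProbSpace (lam / (1 + lam)) (1 / (1 + lam)) A) (a₁ a₂ : A),
      IsFreeModel lam μ₁ μ₂ S a₁ a₂ := by
  have hm := symmBdd_cornerLaw h0 h1 hμ₁ hμ₂
  have hX : ∀ i l, vacuumState l (field hm i) = 0 := by
    intro i l
    rw [← pow_one (field hm i), vacuumState_field_pow,
      (hm i l).integral_odd fun x => by simp]
    simp
  have hlam : ∀ i n, vacuumState false (field hm i ^ (n + 1))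
      = (lam : ℂ) * vacuumState true (field hm i ^ (n + 1)) := by
    intro i n
    rw [vacuumState_field_pow, vacuumState_field_pow]
    have hi : Integrable (fun x : ℝ => x ^ (n + 1)) (![μ₁.toMeasure, μ₂.toMeasure] i) :=
      (hm i true).integrable (continuous_pow _)
    rw [cornerLaw, cornerLaw, integral_dilute h0 h1 hi]
    simp
  have hd : ∀ i (μ : SymmProb), ![μ₁.toMeasure, μ₂.toMeasure] i = μ.toMeasure →
      HasRectDistribution (modelSpace hm hX hlam) (modelElt hm i) μ := by
    intro i μ hi
    have hp := modelProj_mul_modelElt hm i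
    refine ⟨hp, fun k => ?_⟩
    rw [← φ₁_add_star_pow (modelSpace hm hX hlam) hp, modelElt_add_star]
    have := vacuumState_field_pow hm i true (2 * k)
    rw [cornerLaw, hi] at this
    exact this
  exact ⟨fockAlg hm, inferInstance, inferInstance, inferInstance, inferInstance,
    modelSpace hm hX hlam, modelElt hm 0, modelElt hm 1, hd 0 μ₁ rfl, hd 1 μ₂ rfl,
    freeElements_modelElt hm hX hlam⟩

/-- The numbers are moments of a bounded self-adjoint operator at the vacuum, and symmetrising its
spectral measure keeps the even ones. -/
lemma exists_moments_eq_walkMoment (h0 : 0 ≤ lam) (h1 : lam ≤ 1) (hμ₁ : SymmBdd μ₁.toMeasure R)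
    (hμ₂ : SymmBdd μ₂.toMeasure R) : ∃ ξ : SymmProb, ξ.CompactlySupported ∧
      ∀ j : ℕ, ∫ x, x ^ (2 * j) ∂ξ.toMeasure
        = walkMoment (cornerLaw lam ![μ₁.toMeasure, μ₂.toMeasure]) true (2 * j) := by
  have hm := symmBdd_cornerLaw h0 h1 hμ₁ hμ₂
  have hv : ‖vacuum true‖ = 1 := by
    have h2 := inner_self_eq_norm_sq (𝕜 := ℂ) (vacuum true)
    rw [inner_vacuum_self, RCLike.one_re] at h2
    replace h2 := h2.symm
    exact (pow_eq_one_iff_of_nonneg (norm_nonneg _) two_ne_zero).1 h2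
  obtain ⟨ν, hν, ⟨r, hr⟩, hn⟩ := exists_spectral_measure
    ((isSelfAdjoint_field hm 0).add (isSelfAdjoint_field hm 1)) hv
  obtain ⟨ξ, hξ, hj⟩ := exists_symmetrization hν hr
  refine ⟨ξ, hξ, fun j => ?_⟩
  have h := (fockLetters hm).φ_pow hm true (2 * j)
  rw [hj, hn]
  exact congrArg Complex.re h

/-- The rectangular convolution of compactly supported measures exists. -/
lemma exists_isRectConv (h0 : 0 ≤ lam) (h1 : lam ≤ 1) (hμ₁ : μ₁.CompactlySupported)
    (hμ₂ : μ₂.CompactlySupported) : ∃ ξ, IsRectConv lam μ₁ μ₂ ξ := by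
  obtain ⟨R₁, hR₁⟩ := exists_symmBdd hμ₁
  obtain ⟨R₂, hR₂⟩ := exists_symmBdd hμ₂
  replace hR₁ := hR₁.mono (le_max_left R₁ R₂)
  replace hR₂ := hR₂.mono (le_max_right R₁ R₂)
  obtain ⟨ξ, hξ, hj⟩ := exists_moments_eq_walkMoment h0 h1 hR₁ hR₂
  refine ⟨ξ, hξ, exists_isFreeModel h0 h1 hR₁ hR₂, ?_⟩
  intro A _ _ _ _ S a₁ a₂ h
  refine ⟨by rw [mul_add, add_mul, h.1.1, h.2.1.1], fun j => ?_⟩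
  rw [φ₁_pow_of_isFreeModel S h0 h1 hR₁ hR₂ h, hj]

/-- The existence clause of `IsRectConv` supplies the model on which its universal clause is read.
-/
lemma integral_pow_of_isRectConv {ξ : SymmProb} (h0 : 0 ≤ lam) (h1 : lam ≤ 1)
    (hμ₁ : SymmBdd μ₁.toMeasure R) (hμ₂ : SymmBdd μ₂.toMeasure R) (h : IsRectConv lam μ₁ μ₂ ξ)
    (j : ℕ) : ∫ x, x ^ (2 * j) ∂ξ.toMeasure
      = walkMoment (cornerLaw lam ![μ₁.toMeasure, μ₂.toMeasure]) true (2 * j) := by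
  obtain ⟨-, ⟨A, _, _, _, _, S, a₁, a₂, hS⟩, h2⟩ := h
  have h3 := (h2 A S a₁ a₂ hS).2 j
  rw [φ₁_pow_of_isFreeModel S h0 h1 hμ₁ hμ₂ hS] at h3
  exact_mod_cast h3.symm

end Existence

end RectConv

/-! ### The rectangular R-transform on the negative half-line -/

namespace RectConv

/-- The factor `(1 - d) (1 - lam d)`. -/
noncomputable def rectFactor (lam d : ℝ) : ℝ := (1 - d) * (1 - lam * d)

/-- The function `u ↦ u (1 - d) (1 - lam d)` with `d` the defect at `u`, which is
`u ↦ -H_μ (-u)`. -/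
noncomputable def rectMap (lam : ℝ) (μ : Measure ℝ) (u : ℝ) : ℝ := u * rectFactor lam (defect μ u)

/-- The inverse of `rectMap` near `0`. -/
noncomputable def rectInv (lam : ℝ) (μ : Measure ℝ) (y : ℝ) : ℝ :=
  Classical.epsilon fun u => u ∈ Icc y (2 * y) ∧ rectMap lam μ u = y

/-- The defect at `rectInv`, which is the negative of the R-transform at `-y`. -/
noncomputable def rectDefect (lam : ℝ) (μ : Measure ℝ) (y : ℝ) : ℝ := defect μ (rectInv lam μ y)

/-- Additivity of `rectDefect` near `0`. -/
def RectAdd (lam : ℝ) (μ ν ξ : Measure ℝ) : Prop :=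
  ∀ y, 0 < y → defect μ (2 * y) < 1 / 32 → defect ν (2 * y) < 1 / 32 →
    defect ξ (2 * y) ≤ 1 / 8 ∧ rectDefect lam ξ y = rectDefect lam μ y + rectDefect lam ν y

variable {lam : ℝ} (h0 : 0 ≤ lam) (h1 : lam ≤ 1)

section Factor

include h0 h1

lemma rectFactor_le_one {d : ℝ} (hd : 0 ≤ d) (hd1 : d ≤ 1) : rectFactor lam d ≤ 1 := by
  unfold rectFactor
  have := mul_nonneg h0 hd
  nlinarith [mul_le_mul h1 hd1 hd zero_le_one]

/-- Both factors are at least 7/8, and 49/64 exceeds 3/4. -/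
lemma three_quarters_le_rectFactor {d : ℝ} (hd : 0 ≤ d) (hd1 : d ≤ 1 / 8) :
    3 / 4 ≤ rectFactor lam d := by
  unfold rectFactor
  have h2 : lam * d ≤ d := by nlinarith
  nlinarith [mul_nonneg h0 hd, mul_nonneg (mul_nonneg h0 hd) hd]

lemma rectFactor_sub_le {d d' : ℝ} (hd : 0 ≤ d) (hdd : d ≤ d') :
    rectFactor lam d - rectFactor lam d' ≤ 2 * (d' - d) := by
  unfold rectFactor
  have h2 : (d' - d) * (lam - lam * (d + d')) ≤ (d' - d) * 1 :=
    mul_le_mul_of_nonneg_left (by nlinarith [mul_nonneg h0 hd, mul_nonneg h0 (hd.trans hdd)])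
      (by linarith)
  nlinarith

end Factor

variable {μ ν : Measure ℝ} [IsProbabilityMeasure μ] [IsProbabilityMeasure ν]

section

include h0 h1

lemma rectMap_le {u : ℝ} (hu : 0 ≤ u) : rectMap lam μ u ≤ u :=
  mul_le_of_le_one_right hu (rectFactor_le_one h0 h1 (defect_nonneg hu) (defect_le_one hu))

lemma le_rectMap {u : ℝ} (hu : 0 ≤ u) (hd : defect μ u ≤ 1 / 8) : 3 / 4 * u ≤ rectMap lam μ u := by
  rw [mul_comm]
  exact mul_le_mul_of_nonneg_left (three_quarters_le_rectFactor h0 h1 (defect_nonneg hu) hd) hu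

/-- The increment is F(d(u))(v - u) minus v(F(d(u)) - F(d(v))), with F the factor. The first term is
at least 3/4 of v - u; the second is at most 2v(d(v) - d(u)) ≤ 2d(v)(v - u), a quarter of v - u. -/
lemma rectMap_sub_le {u v : ℝ} (hu : 0 < u) (huv : u ≤ v) (hd : defect μ v ≤ 1 / 8) :
    (v - u) / 2 ≤ rectMap lam μ v - rectMap lam μ u := by
  have hv := hu.trans_le huv
  have h2 := mul_defect_le (μ := μ) hu.le huv
  have h3 := defect_mono (μ := μ) hu.le huv
  have h4 := rectFactor_sub_le h0 h1 (defect_nonneg (μ := μ) hu.le) h3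
  have h5 := three_quarters_le_rectFactor h0 h1 (defect_nonneg (μ := μ) hu.le) (h3.trans hd)
  unfold rectMap
  have h6 : v * (rectFactor lam (defect μ u) - rectFactor lam (defect μ v))
      ≤ 2 * (defect μ v * (v - u)) := by
    refine (mul_le_mul_of_nonneg_left h4 hv.le).trans ?_
    nlinarith
  have h7 : defect μ v * (v - u) ≤ 1 / 8 * (v - u) :=
    mul_le_mul_of_nonneg_right hd (by linarith)
  have h8 : 3 / 4 * (v - u) ≤ rectFactor lam (defect μ u) * (v - u) :=
    mul_le_mul_of_nonneg_right h5 (by linarith)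
  nlinarith

lemma abs_sub_le_rectMap {u v : ℝ} (hu : 0 < u) (hv : 0 < v) (hdu : defect μ u ≤ 1 / 8)
    (hdv : defect μ v ≤ 1 / 8) : |u - v| ≤ 2 * |rectMap lam μ u - rectMap lam μ v| := by
  wlog h : u ≤ v generalizing u v
  · rw [abs_sub_comm, abs_sub_comm (rectMap lam μ u)]
    exact this hv hu hdv hdu (le_of_not_ge h)
  have h2 := rectMap_sub_le h0 h1 hu h hdv
  have h3 := neg_le_abs (rectMap lam μ u - rectMap lam μ v)
  rw [abs_of_nonpos (by linarith)]
  linarith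

lemma rectMap_injOn {u v : ℝ} (hu : 0 < u) (hv : 0 < v) (hdu : defect μ u ≤ 1 / 8)
    (hdv : defect μ v ≤ 1 / 8) (h : rectMap lam μ u = rectMap lam μ v) : u = v := by
  have := abs_sub_le_rectMap h0 h1 hu hv hdu hdv
  rw [h, sub_self, abs_zero, mul_zero] at this
  exact sub_eq_zero.1 (abs_eq_zero.1 (le_antisymm this (abs_nonneg _)))

end

lemma analyticAt_defect {u : ℝ} (hu : 0 < u) : AnalyticAt ℝ (defect μ) u :=
  analyticAt_const.sub (analyticAt_resMean hu)

lemma analyticAt_rectFactor (lam d : ℝ) : AnalyticAt ℝ (rectFactor lam) d := by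
  unfold rectFactor; fun_prop

lemma analyticAt_rectMap {u : ℝ} (hu : 0 < u) : AnalyticAt ℝ (rectMap lam μ) u :=
  analyticAt_id.mul ((analyticAt_rectFactor _ _).comp (analyticAt_defect hu))

lemma continuousAt_defect {u : ℝ} (hu : 0 < u) : ContinuousAt (defect μ) u :=
  (analyticAt_defect hu).continuousAt

section

include h0 h1

/-- Intermediate values: `rectMap` is at most y at y and at least 3y/2 at 2y. -/
lemma exists_rectMap_eq {y : ℝ} (hy : 0 < y) (hd : defect μ (2 * y) ≤ 1 / 8) :
    ∃ u ∈ Icc y (2 * y), rectMap lam μ u = y := by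
  have hc : ContinuousOn (rectMap lam μ) (Icc y (2 * y)) := fun u hu =>
    (analyticAt_rectMap (hy.trans_le hu.1)).continuousAt.continuousWithinAt
  have h := intermediate_value_Icc (by linarith) hc
  have h2 := le_rectMap h0 h1 (μ := μ) (by linarith) hd
  exact h ⟨rectMap_le h0 h1 hy.le, by linarith⟩

lemma rectInv_spec {y : ℝ} (hy : 0 < y) (hd : defect μ (2 * y) ≤ 1 / 8) :
    rectInv lam μ y ∈ Icc y (2 * y) ∧ rectMap lam μ (rectInv lam μ y) = y :=
  Classical.epsilon_spec (p := fun u => u ∈ Icc y (2 * y) ∧ rectMap lam μ u = y)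
    (exists_rectMap_eq h0 h1 hy hd)

lemma rectInv_pos {y : ℝ} (hy : 0 < y) (hd : defect μ (2 * y) ≤ 1 / 8) : 0 < rectInv lam μ y :=
  hy.trans_le (rectInv_spec h0 h1 hy hd).1.1

lemma defect_rectInv_le {y : ℝ} (hy : 0 < y) (hd : defect μ (2 * y) ≤ 1 / 8) :
    rectDefect lam μ y ≤ defect μ (2 * y) :=
  defect_mono (rectInv_pos h0 h1 hy hd).le (rectInv_spec h0 h1 hy hd).1.2

lemma rectDefect_nonneg {y : ℝ} (hy : 0 < y) (hd : defect μ (2 * y) ≤ 1 / 8) :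
    0 ≤ rectDefect lam μ y :=
  defect_nonneg (rectInv_pos h0 h1 hy hd).le

lemma rectInv_eq {u y : ℝ} (hy : 0 < y) (hd : defect μ (2 * y) ≤ 1 / 8) (hu : 0 < u)
    (hdu : defect μ u ≤ 1 / 8) (h : rectMap lam μ u = y) : rectInv lam μ y = u := by
  obtain ⟨h2, h3⟩ := rectInv_spec h0 h1 hy hd
  exact rectMap_injOn h0 h1 (hy.trans_le h2.1) hu ((defect_mono (hy.le.trans h2.1) h2.2).trans hd)
    hdu (h3.trans h.symm)

lemma rectInv_eq_div {y : ℝ} (hy : 0 < y) (hd : defect μ (2 * y) ≤ 1 / 8) :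
    rectInv lam μ y = y / rectFactor lam (rectDefect lam μ y) := by
  have h := three_quarters_le_rectFactor h0 h1 (rectDefect_nonneg h0 h1 hy hd)
    ((defect_rectInv_le h0 h1 hy hd).trans hd)
  rw [eq_div_iff (by linarith)]
  exact (rectInv_spec h0 h1 hy hd).2

lemma rectDefect_eq_of_defect_eq {y D : ℝ} (hy : 0 < y) (hd : defect μ (2 * y) ≤ 1 / 8)
    (hD : 0 ≤ D) (hD1 : D ≤ 1 / 8) (h : defect μ (y / rectFactor lam D) = D) :
    rectDefect lam μ y = D := by
  have h2 := three_quarters_le_rectFactor h0 h1 hD hD1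
  rw [rectDefect, rectInv_eq h0 h1 hy hd (u := y / rectFactor lam D) (by positivity)
    (by rw [h]; exact hD1) (by rw [rectMap, h]; field_simp), h]

/-- The slope of `rectMap` is at least 1/2, so analyticity may be tested after composing with it,
and the composite is the defect itself. -/
lemma analyticAt_rectDefect {y : ℝ} (hy : 0 < y) (hd : defect μ (2 * y) < 1 / 8) :
    AnalyticAt ℝ (rectDefect lam μ) y := by
  obtain ⟨h2, h3⟩ := rectInv_spec h0 h1 hy hd.le
  have hu := rectInv_pos h0 h1 hy hd.le
  set u := rectInv lam μ y with hu_def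
  have hdu : defect μ u < 1 / 8 := (defect_mono hu.le h2.2).trans_lt hd
  have ha := analyticAt_rectMap (lam := lam) (μ := μ) hu
  have hder : (1 : ℝ) / 2 ≤ deriv (rectMap lam μ) u := by
    have hs := (hasDerivAt_iff_tendsto_slope.1 ha.differentiableAt.hasDerivAt).mono_left
      (nhdsWithin_mono u (show Iio u ⊆ {u}ᶜ from fun x hx => ne_of_lt hx))
    refine ge_of_tendsto hs ?_
    filter_upwards [self_mem_nhdsWithin, mem_nhdsWithin_of_mem_nhds (Ioi_mem_nhds hu)]
      with v (hv : v < u) (hv0 : 0 < v)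
    rw [slope_def_field, le_div_iff_of_neg (by linarith)]
    have := rectMap_sub_le h0 h1 hv0 hv.le hdu.le
    linarith
  rw [← h3, ← analyticAt_comp_iff_of_deriv_ne_zero ha (by linarith)]
  refine (analyticAt_defect (μ := μ) hu).congr ?_
  have hc : ContinuousAt (fun v => defect μ (2 * rectMap lam μ v)) u := by
    have h4 : ContinuousAt (defect μ) (2 * rectMap lam μ u) := by
      rw [h3]; exact continuousAt_defect (by linarith)
    exact ContinuousAt.comp (f := fun v => 2 * rectMap lam μ v) h4
      (continuousAt_const.mul ha.continuousAt)
  have e1 := hc.eventually (gt_mem_nhds (show defect μ (2 * rectMap lam μ u) < 1 / 8 by rwa [h3]))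
  have e2 := (continuousAt_defect (μ := μ) hu).eventually (gt_mem_nhds hdu)
  have e3 := ha.continuousAt.eventually (lt_mem_nhds (show 0 < rectMap lam μ u by rwa [h3]))
  filter_upwards [e1, e2, e3, lt_mem_nhds hu] with v hv1 hv2 hv3 hv4
  rw [Function.comp_apply, rectDefect, rectInv_eq h0 h1 hv3 hv1.le hv4 hv2.le rfl]

end

lemma tendsto_two_mul_nhdsGT : Tendsto (fun y : ℝ => 2 * y) (𝓝[>] 0) (𝓝[>] 0) := by
  refine tendsto_nhdsWithin_iff.2 ⟨?_, ?_⟩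
  · have : Tendsto (fun y : ℝ => 2 * y) (𝓝 0) (𝓝 (2 * 0)) := tendsto_id.const_mul 2
    rw [mul_zero] at this
    exact this.mono_left nhdsWithin_le_nhds
  · filter_upwards [self_mem_nhdsWithin] with y hy
    exact mul_pos two_pos (mem_Ioi.1 hy)

lemma eventually_defect_lt (μ : Measure ℝ) [IsProbabilityMeasure μ] {ε : ℝ} (hε : 0 < ε) :
    ∀ᶠ y in 𝓝[>] 0, defect μ (2 * y) < ε :=
  (tendsto_defect_zero.comp tendsto_two_mul_nhdsGT).eventually (gt_mem_nhds hε)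

include h0 h1 in
/-- The function `rectDefect` near `0` determines a symmetric measure. -/
lemma eq_of_rectDefect_eq [μ.IsNegInvariant] [ν.IsNegInvariant]
    (h : ∀ᶠ y in 𝓝[>] 0, rectDefect lam μ y = rectDefect lam ν y) : μ = ν := by
  obtain ⟨b, hb, hb'⟩ := mem_nhdsGT_iff_exists_Ioo_subset.1
    (h.and ((eventually_defect_lt μ (ε := 1 / 8) (by norm_num)).and
      (eventually_defect_lt ν (ε := 1 / 8) (by norm_num))))
  refine ext_of_resMean (a := b / 4) (b := b / 2) (by simpa using hb)
    (by linarith [show 0 < b from hb]) fun u hu => ?_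
  have hu0 : 0 < u := by linarith [hu.1, show 0 < b from hb]
  have hub : u < b := by linarith [hu.2, show 0 < b from hb]
  have hd : defect μ (2 * u) < 1 / 8 := (hb' ⟨hu0, hub⟩).2.1
  have hdu : defect μ u ≤ 1 / 8 := (defect_mono hu0.le (by linarith)).trans hd.le
  have hy := le_rectMap h0 h1 hu0.le hdu
  have hy' := rectMap_le h0 h1 (μ := μ) hu0.le
  set y := rectMap lam μ u with hy_def
  have hy0 : 0 < y := by linarith
  obtain ⟨e, d1, d2⟩ := hb' (show y ∈ Ioo 0 b from ⟨hy0, by linarith⟩)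
  have e1 : rectInv lam μ y = u := rectInv_eq h0 h1 hy0 d1.le hu0 hdu rfl
  -- `rectInv` is a function of y and `rectDefect`, so equal values of the latter mean that both
  -- defects are taken at the same u.
  have e2 : rectInv lam ν y = u := by
    rw [rectInv_eq_div h0 h1 hy0 d2.le, ← e, ← rectInv_eq_div h0 h1 hy0 d1.le, e1]
  rw [rectDefect, rectDefect, e1, e2, defect, defect] at e
  linarith

end RectConv

/-! ### Additivity for compactly supported measures -/

namespace RectConv

instance (μ : SymmProb) : IsProbabilityMeasure μ.toMeasure :=
  inferInstanceAs (IsProbabilityMeasure (μ.1 : Measure ℝ))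

instance (μ : SymmProb) : μ.toMeasure.IsNegInvariant := μ.2

/-- The resolvent mean as the generating function of the even moments. -/
lemma SymmBdd.tendsto_sum_moments {m : Measure ℝ} {R u : ℝ} (hm : SymmBdd m R) (hu : 0 ≤ u)
    (huR : u * R ^ 2 < 1) :
    Tendsto (fun J => ∑ j ∈ Finset.range J, (-u) ^ j * ∫ x, x ^ (2 * j) ∂m) atTop
      (𝓝 (resMean m u)) := by
  have := hm.prob
  have h1 : ∀ J, ∑ j ∈ Finset.range J, (-u) ^ j * ∫ x, x ^ (2 * j) ∂m
      = ∫ x, ∑ j ∈ Finset.range J, (-(u * x ^ 2)) ^ j ∂m := by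
    intro J
    rw [integral_finsetSum _ fun j _ => hm.integrable (by fun_prop)]
    refine Finset.sum_congr rfl fun j _ => ?_
    rw [← integral_const_mul]
    congr 1
    ext x
    rw [pow_mul, ← mul_pow, neg_mul]
  simp only [h1]
  have ht : ∀ {x : ℝ}, |x| ≤ R → 0 ≤ u * x ^ 2 ∧ u * x ^ 2 < 1 := by
    intro x hx
    refine ⟨by positivity, lt_of_le_of_lt ?_ huR⟩
    rw [← sq_abs x]
    gcongr
  refine tendsto_integral_of_dominated_convergence (fun _ => 2)
    (fun J => (hm.integrable (by fun_prop)).aestronglyMeasurable) (integrable_const _) ?_ ?_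
  · intro J
    filter_upwards [hm.bdd] with x hx
    obtain ⟨h2, h3⟩ := ht hx
    have hg := mul_neg_geom_sum (-(u * x ^ 2)) J
    have h4 : |(-(u * x ^ 2)) ^ J| ≤ 1 := by
      rw [abs_pow, abs_neg, abs_of_nonneg h2]
      exact pow_le_one₀ h2 h3.le
    rw [sub_neg_eq_add] at hg
    have h5 : |∑ j ∈ Finset.range J, (-(u * x ^ 2)) ^ j|
        ≤ |(1 + u * x ^ 2) * ∑ j ∈ Finset.range J, (-(u * x ^ 2)) ^ j| := by
      rw [abs_mul, abs_of_nonneg (show (0 : ℝ) ≤ 1 + u * x ^ 2 by positivity)]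
      exact le_mul_of_one_le_left (abs_nonneg _) (by linarith)
    rw [Real.norm_eq_abs]
    refine h5.trans ?_
    rw [hg]
    have h6 := abs_le.1 h4
    rw [abs_le]
    constructor <;> linarith
  · filter_upwards [hm.bdd] with x hx
    obtain ⟨h2, h3⟩ := ht hx
    have := (hasSum_geometric_of_abs_lt_one (r := -(u * x ^ 2))
      (by rw [abs_neg, abs_of_nonneg h2]; exact h3)).tendsto_sum_nat
    rwa [sub_neg_eq_add] at this

variable {lam : ℝ} (h0 : 0 ≤ lam) (h1 : lam ≤ 1)

/-- The sum of the defects of two measures. -/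
noncomputable def defectSum (lam : ℝ) (μ ν : Measure ℝ) (y : ℝ) : ℝ :=
  rectDefect lam μ y + rectDefect lam ν y

section

variable {μ ν ξ : Measure ℝ} [IsProbabilityMeasure μ] [IsProbabilityMeasure ν]
  [IsProbabilityMeasure ξ]

include h0 h1

lemma defectSum_mem {y ε : ℝ} (hy : 0 < y) (hε : ε ≤ 1 / 16) (hμ : defect μ (2 * y) < ε)
    (hν : defect ν (2 * y) < ε) :
    defectSum lam μ ν y ∈ Icc 0 (2 * ε) := by
  have e1 := rectDefect_nonneg h0 h1 hy (show defect μ (2 * y) ≤ 1 / 8 by linarith)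
  have e2 := rectDefect_nonneg h0 h1 hy (show defect ν (2 * y) ≤ 1 / 8 by linarith)
  have e3 := defect_rectInv_le h0 h1 hy (show defect μ (2 * y) ≤ 1 / 8 by linarith)
  have e4 := defect_rectInv_le h0 h1 hy (show defect ν (2 * y) ≤ 1 / 8 by linarith)
  unfold defectSum
  constructor <;> linarith

lemma div_rectFactor_mem {y D : ℝ} (hy : 0 < y) (hD : D ∈ Icc (0 : ℝ) (1 / 8)) :
    y / rectFactor lam D ∈ Icc y (2 * y) := by
  have h2 := three_quarters_le_rectFactor h0 h1 hD.1 hD.2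
  have h3 := rectFactor_le_one h0 h1 hD.1 (hD.2.trans (by norm_num))
  constructor
  · rw [le_div_iff₀ (by linarith)]; nlinarith
  · rw [div_le_iff₀ (by linarith)]; nlinarith

lemma analyticAt_defectSum {y : ℝ} (hy : 0 < y) (hμ : defect μ (2 * y) < 1 / 32)
    (hν : defect ν (2 * y) < 1 / 32) : AnalyticAt ℝ (defectSum lam μ ν) y :=
  (analyticAt_rectDefect h0 h1 hy (hμ.trans (by norm_num))).add
    (analyticAt_rectDefect h0 h1 hy (hν.trans (by norm_num)))

/-- The additivity relation propagates from a neighbourhood of `0`. -/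
lemma rectAdd_of_eventually
    (h : ∀ᶠ y in 𝓝[>] 0, defect ξ (y / rectFactor lam (defectSum lam μ ν y))
      = defectSum lam μ ν y) : RectAdd lam μ ν ξ := by
  intro y hy hμ hν
  have hc : ∀ {κ : Measure ℝ} [IsProbabilityMeasure κ], defect κ (2 * y) < 1 / 32 →
      ∀ᶠ b in 𝓝 y, defect κ (2 * b) < 1 / 32 := by
    intro κ _ hκ
    have : ContinuousAt (fun b => defect κ (2 * b)) y :=
      ContinuousAt.comp (f := fun b => 2 * b)
        (continuousAt_defect (μ := κ) (show 0 < 2 * y by linarith)) (by fun_prop)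
    exact this.eventually (gt_mem_nhds hκ)
  -- Some room to the right of y makes it an interior point of an interval reaching 0, on which the
  -- identity theorem is applied.
  obtain ⟨b, ⟨hμb, hνb⟩, hyb⟩ := ((((hc hμ).and (hc hν)).filter_mono nhdsWithin_le_nhds).and
    (self_mem_nhdsWithin : Ioi y ∈ 𝓝[>] y)).exists
  replace hyb : y < b := hyb
  have hdom : ∀ t ∈ Ioo 0 b, defect μ (2 * t) < 1 / 32 ∧ defect ν (2 * t) < 1 / 32 := by
    intro t ht
    have h2 : 0 ≤ 2 * t := by linarith [ht.1]
    have h3 : 2 * t ≤ 2 * b := by linarith [ht.2]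
    exact ⟨(defect_mono h2 h3).trans_lt hμb, (defect_mono h2 h3).trans_lt hνb⟩
  have hmem : ∀ t ∈ Ioo 0 b, defectSum lam μ ν t ∈ Icc (0 : ℝ) (1 / 8) := by
    intro t ht
    have := defectSum_mem h0 h1 (ε := 1 / 32) ht.1 (by norm_num) (hdom t ht).1 (hdom t ht).2
    exact ⟨this.1, this.2.trans (by norm_num)⟩
  have han : AnalyticOnNhd ℝ (fun t => defect ξ (t / rectFactor lam (defectSum lam μ ν t))
      - defectSum lam μ ν t) (Ioo 0 b) := by
    intro t ht
    have hD := analyticAt_defectSum h0 h1 ht.1 (hdom t ht).1 (hdom t ht).2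
    have hpos := three_quarters_le_rectFactor h0 h1 (hmem t ht).1 (hmem t ht).2
    have hw : AnalyticAt ℝ (fun t => t / rectFactor lam (defectSum lam μ ν t)) t :=
      analyticAt_id.div ((analyticAt_rectFactor lam _).comp hD) (by
        change rectFactor lam (defectSum lam μ ν t) ≠ 0; linarith)
    refine AnalyticAt.sub ?_ hD
    exact AnalyticAt.comp (g := defect ξ)
      (f := fun t => t / rectFactor lam (defectSum lam μ ν t))
      (analyticAt_defect (ht.1.trans_le (div_rectFactor_mem h0 h1 ht.1 (hmem t ht)).1)) hw
  obtain ⟨c, hc0, hcs⟩ := mem_nhdsGT_iff_exists_Ioo_subset.1 h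
  replace hc0 : 0 < c := hc0
  have hb0 : 0 < b := hy.trans hyb
  have hz : min b c / 2 ∈ Ioo 0 b := ⟨by positivity, by linarith [min_le_left b c]⟩
  have hzc : min b c / 2 ∈ Ioo 0 c := ⟨by positivity, by linarith [min_le_right b c]⟩
  have key := han.eqOn_zero_of_preconnected_of_eventuallyEq_zero isPreconnected_Ioo hz (by
    filter_upwards [Ioo_mem_nhds hzc.1 hzc.2] with t ht
    exact sub_eq_zero.2 (hcs ht)) ⟨hy, hyb⟩
  have hD := defectSum_mem h0 h1 (ε := 1 / 32) hy (by norm_num) hμ hν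
  have hw := div_rectFactor_mem h0 h1 hy (hmem y ⟨hy, hyb⟩)
  replace key : defect ξ (y / rectFactor lam (defectSum lam μ ν y)) = defectSum lam μ ν y :=
    sub_eq_zero.1 key
  -- By sublinearity the defect of ξ at 2y is at most twice its value D at the intermediate point,
  -- which is at least y; and 2D ≤ 1/8.
  have h5 := mul_defect_le (μ := ξ) (hy.le.trans hw.1) hw.2
  rw [key] at h5
  have h6 : y * defect ξ (2 * y) ≤ y * (2 * defectSum lam μ ν y) := by
    have h7 : 0 ≤ defect ξ (2 * y) := defect_nonneg (by linarith)
    nlinarith [mul_le_mul_of_nonneg_right hw.1 h7]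
  have h7 : defect ξ (2 * y) ≤ 1 / 8 := by
    have := le_of_mul_le_mul_left h6 hy
    linarith [hD.2]
  exact ⟨h7, rectDefect_eq_of_defect_eq h0 h1 hy h7 hD.1 (hmem y ⟨hy, hyb⟩).2 key⟩

end

-- For small y the moment series of ξ and the walk series converge at the same point and have the
-- same terms; their sums are the resolvent mean and 1 - D.
include h0 h1 in
lemma rectAdd_of_isRectConv {μ₁ μ₂ ξ : SymmProb} (hμ₁ : μ₁.CompactlySupported)
    (hμ₂ : μ₂.CompactlySupported) (h : IsRectConv lam μ₁ μ₂ ξ) :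
    RectAdd lam μ₁.toMeasure μ₂.toMeasure ξ.toMeasure := by
  obtain ⟨R₁, hR₁⟩ := exists_symmBdd hμ₁
  obtain ⟨R₂, hR₂⟩ := exists_symmBdd hμ₂
  obtain ⟨R₃, hR₃⟩ := exists_symmBdd h.1
  set R := max (max R₁ R₂) R₃
  replace hR₁ := hR₁.mono (show R₁ ≤ R from (le_max_left _ _).trans (le_max_left _ _))
  replace hR₂ := hR₂.mono (show R₂ ≤ R from (le_max_right _ _).trans (le_max_left _ _))
  replace hR₃ := hR₃.mono (show R₃ ≤ R from le_max_right _ _)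
  set L := 2 * (4 * R ^ 2) + 2 * R ^ 2
  have hRL : R ^ 2 ≤ L ^ 2 := by
    have h2 : 1 ≤ R ^ 2 := one_le_pow₀ hR₁.one_le
    have : R ^ 2 ≤ L := by simp only [L]; linarith
    nlinarith
  have hsmall : ∀ᶠ y in 𝓝[>] (0 : ℝ), y ≤ 1 ∧ 2 * y * L ^ 2 < 1 := by
    have hc : ContinuousAt (fun y : ℝ => 2 * y * L ^ 2) 0 := by fun_prop
    exact ((eventually_le_nhds zero_lt_one).and
      (hc.eventually (gt_mem_nhds (by simp)))).filter_mono nhdsWithin_le_nhds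
  refine rectAdd_of_eventually h0 h1 ?_
  filter_upwards [self_mem_nhdsWithin, hsmall,
    eventually_defect_lt μ₁.toMeasure (ε := 1 / 32) (by norm_num),
    eventually_defect_lt μ₂.toMeasure (ε := 1 / 32) (by norm_num)]
    with y (hy : 0 < y) ⟨hy1, hyL⟩ hd₁ hd₂
  have hD := defectSum_mem h0 h1 hy (by norm_num) hd₁ hd₂
  obtain ⟨hw1, hw2⟩ := div_rectFactor_mem h0 h1 hy ⟨hD.1, hD.2.trans (by norm_num)⟩
  set w := y / rectFactor lam (defectSum lam μ₁.toMeasure μ₂.toMeasure y) with hw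
  have hwL : w * L ^ 2 < 1 := (mul_le_mul_of_nonneg_right hw2 (sq_nonneg L)).trans_lt hyL
  have hs₁ := rectInv_spec h0 h1 hy (show defect μ₁.toMeasure (2 * y) ≤ 1 / 8 by linarith)
  have hs₂ := rectInv_spec h0 h1 hy (show defect μ₂.toMeasure (2 * y) ≤ 1 / 8 by linarith)
  have he₁ := defect_rectInv_le h0 h1 hy (show defect μ₁.toMeasure (2 * y) ≤ 1 / 8 by linarith)
  have he₂ := defect_rectInv_le h0 h1 hy (show defect μ₂.toMeasure (2 * y) ≤ 1 / 8 by linarith)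
  have t1 := tendsto_sum_walkMoment_of_defect (lam := lam) (R := R) (y := y) (u := w)
    (μ := ![μ₁.toMeasure, μ₂.toMeasure])
    (v := ![rectInv lam μ₁.toMeasure y, rectInv lam μ₂.toMeasure y])
    (fun i => by fin_cases i <;> assumption) h0 h1 hy
    (fun i => by
      fin_cases i
      · exact hy.trans_le hs₁.1.1
      · exact hy.trans_le hs₂.1.1)
    (fun i => by
      fin_cases i
      · exact hs₁.1.2.trans (by linarith)
      · exact hs₂.1.2.trans (by linarith))
    (fun i => by
      fin_cases i
      · exact hs₁.1.2
      · exact hs₂.1.2)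
    (fun i => by
      fin_cases i
      · exact he₁.trans (by linarith)
      · exact he₂.trans (by linarith))
    (fun i => by
      fin_cases i
      · exact hs₁.2
      · exact hs₂.2) hw hwL
  have t2 := hR₃.tendsto_sum_moments (hy.le.trans hw1)
    (show w * R ^ 2 < 1 from
      (mul_le_mul_of_nonneg_left hRL (hy.le.trans hw1)).trans_lt hwL)
  simp only [integral_pow_of_isRectConv h0 h1 hR₁ hR₂ h] at t2
  have e := tendsto_nhds_unique t2 t1
  rw [defect, e]
  exact sub_sub_cancel 1 _

end RectConv

/-! ### The convolution of arbitrary symmetric measures -/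

namespace RectConv

/-! ### Tightness from small defects. -/

section Tightness

/-- Outside the interval the integrand of the defect is at least 1/2, so Markov's inequality
applies. -/
lemma measure_compl_Icc_le {κ : Measure ℝ} [IsProbabilityMeasure κ] {y T : ℝ} (hy : 0 < y)
    (hT : 0 ≤ T) (hyT : 1 ≤ y * T ^ 2) :
    κ (Icc (-T) T)ᶜ ≤ ENNReal.ofReal (2 * defect κ y) := by
  have hsub : (Icc (-T) T)ᶜ ⊆ {x : ℝ | 1 / 2 ≤ 1 - (1 + y * x ^ 2)⁻¹} := by
    intro x hx
    have h1 : T ≤ |x| := by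
      by_contra h
      exact hx (abs_le.1 (not_le.1 h).le)
    have h2 : T ^ 2 ≤ x ^ 2 := by rw [← sq_abs x]; gcongr
    have h3 : 1 ≤ y * x ^ 2 := hyT.trans (mul_le_mul_of_nonneg_left h2 hy.le)
    have h4 : (1 + y * x ^ 2)⁻¹ ≤ 2⁻¹ := inv_anti₀ two_pos (by linarith)
    change 1 / 2 ≤ 1 - (1 + y * x ^ 2)⁻¹
    linarith
  have h := mul_meas_ge_le_integral_of_nonneg (μ := κ)
    (ae_of_all _ fun x => sub_nonneg.2 (res_le_one hy.le x))
    ((integrable_const (1 : ℝ)).sub (integrable_res hy.le)) (1 / 2)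
  rw [← defect_eq_integral hy.le] at h
  refine (measure_mono hsub).trans ?_
  rw [← ofReal_measureReal]
  exact ENNReal.ofReal_le_ofReal (by linarith)

lemma isTightMeasureSet_of_defect {κ : ℕ → SymmProb}
    (h : ∀ ε > 0, ∀ᶠ y in 𝓝[>] (0 : ℝ), ∀ n, defect (κ n).toMeasure y ≤ ε) :
    IsTightMeasureSet {((μ : ProbabilityMeasure ℝ) : Measure ℝ) | μ ∈ range fun n => (κ n).1} := by
  rw [isTightMeasureSet_iff_exists_isCompact_measure_compl_le]
  intro ε hε
  have hε1 : min ε 1 ≠ ⊤ := ne_top_of_le_ne_top ENNReal.one_ne_top (min_le_right _ _)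
  have hε' : 0 < (min ε 1).toReal := ENNReal.toReal_pos (lt_min hε one_pos).ne' hε1
  obtain ⟨y, hyn, hy⟩ := ((h _ (half_pos hε')).and self_mem_nhdsWithin).exists
  replace hy : 0 < y := hy
  refine ⟨Icc (-(√y)⁻¹) (√y)⁻¹, isCompact_Icc, ?_⟩
  rintro _ ⟨_, ⟨n, rfl⟩, rfl⟩
  refine (measure_compl_Icc_le (κ := (κ n).toMeasure) hy (by positivity) ?_).trans ?_
  · rw [inv_pow, Real.sq_sqrt hy.le, mul_inv_cancel₀ hy.ne']
  · refine (ENNReal.ofReal_le_ofReal (show _ ≤ (min ε 1).toReal by linarith [hyn n])).trans ?_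
    rw [ENNReal.ofReal_toReal hε1]
    exact min_le_left _ _

lemma isNegInvariant_of_tendsto {κ : ℕ → SymmProb} {μ : ProbabilityMeasure ℝ}
    (h : Tendsto (fun n => (κ n).1) atTop (𝓝 μ)) : (μ : Measure ℝ).IsNegInvariant := by
  have h2 := ProbabilityMeasure.tendsto_map_of_tendsto_of_continuous _ _ h (continuous_neg (G := ℝ))
  have h3 : ∀ n, (κ n).1.map (continuous_neg (G := ℝ)).measurable.aemeasurable = (κ n).1 := by
    intro n
    apply Subtype.ext
    exact (κ n).2.neg_eq_self
  simp only [h3] at h2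
  have h4 := tendsto_nhds_unique h2 h
  exact ⟨congrArg Subtype.val h4⟩

lemma exists_tendsto_subseq {κ : ℕ → SymmProb}
    (h : ∀ ε > 0, ∀ᶠ y in 𝓝[>] (0 : ℝ), ∀ n, defect (κ n).toMeasure y ≤ ε) :
    ∃ (ξ : SymmProb) (φ : ℕ → ℕ), StrictMono φ ∧ Tendsto (fun n => κ (φ n)) atTop (𝓝 ξ) := by
  have hc := isCompact_closure_of_isTightMeasureSet (isTightMeasureSet_of_defect h)
  obtain ⟨μ, -, φ, hφ, hμ⟩ := hc.tendsto_subseq (x := fun n => (κ n).1)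
    fun n => subset_closure ⟨n, rfl⟩
  exact ⟨⟨μ, isNegInvariant_of_tendsto (κ := κ ∘ φ) hμ⟩, φ, hφ, tendsto_subtype_rng.2 hμ⟩

end Tightness

/-! ### Defects along weakly convergent sequences. -/

section Limits

variable {κ : ℕ → SymmProb} {ξ : SymmProb} (hκ : Tendsto κ atTop (𝓝 ξ))

include hκ

lemma tendsto_defect {u : ℝ} (hu : 0 ≤ u) :
    Tendsto (fun n => defect (κ n).toMeasure u) atTop (𝓝 (defect ξ.toMeasure u)) := by
  let f : BoundedContinuousFunction ℝ ℝ := BoundedContinuousFunction.ofNormedAddCommGroup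
    (fun x => (1 + u * x ^ 2)⁻¹) (continuous_res hu) 1 fun x => by
      rw [Real.norm_eq_abs, abs_of_nonneg (res_nonneg hu x)]; exact res_le_one hu x
  exact ((ProbabilityMeasure.tendsto_iff_forall_integral_tendsto.1
    (tendsto_subtype_rng.1 hκ)) f).const_sub 1

/-- A point chosen for the limit serves for the tail of the sequence, and for all smaller y by
monotonicity; the finitely many remaining terms are treated one by one. -/
lemma eventually_forall_defect_le {ε : ℝ} (hε : 0 < ε) :
    ∀ᶠ y in 𝓝[>] (0 : ℝ), ∀ n, defect (κ n).toMeasure y ≤ ε := by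
  have hdef : ∀ (μ : SymmProb), ∀ᶠ y in 𝓝[>] (0 : ℝ), defect μ.toMeasure y < ε := fun μ =>
    tendsto_defect_zero.eventually (gt_mem_nhds hε)
  obtain ⟨y₁, hy₁, hy₁0⟩ := ((hdef ξ).and self_mem_nhdsWithin).exists
  replace hy₁0 : 0 < y₁ := hy₁0
  obtain ⟨N, hN⟩ := eventually_atTop.1 ((tendsto_defect hκ hy₁0.le).eventually (gt_mem_nhds hy₁))
  have h2 : ∀ᶠ y in 𝓝[>] (0 : ℝ), ∀ n ∈ Finset.range N, defect (κ n).toMeasure y < ε :=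
    (Filter.eventually_all_finset _).2 fun n _ => hdef (κ n)
  filter_upwards [h2, self_mem_nhdsWithin, mem_nhdsWithin_of_mem_nhds (Iic_mem_nhds hy₁0)]
    with y hy (hy0 : 0 < y) (hyy : y ≤ y₁) n
  rcases lt_or_ge n N with hn | hn
  · exact (hy n (Finset.mem_range.2 hn)).le
  · exact (defect_mono hy0.le hyy).trans (hN n hn).le

variable {lam : ℝ} (h0 : 0 ≤ lam) (h1 : lam ≤ 1)
include h0 h1

/-- At the limiting u the maps tend to y, so the lower bound on their slopes forces the inverses to
tend to u; the uniform Lipschitz bound then carries this to the defects. -/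
lemma tendsto_rectDefect {y : ℝ} (hy : 0 < y) (h : ∀ᶠ n in atTop, defect (κ n).toMeasure (2 * y) ≤ 1 / 8)
    (hξ : defect ξ.toMeasure (2 * y) ≤ 1 / 8) :
    Tendsto (fun n => rectDefect lam (κ n).toMeasure y) atTop
      (𝓝 (rectDefect lam ξ.toMeasure y)) := by
  obtain ⟨⟨hu1, hu2⟩, hu3⟩ := rectInv_spec h0 h1 hy hξ
  have hd := tendsto_defect hκ (hy.le.trans hu1)
  unfold rectDefect
  set u := rectInv lam ξ.toMeasure y with hu
  have hmap : Tendsto (fun n => rectMap lam (κ n).toMeasure u) atTop (𝓝 y) := by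
    rw [← hu3]
    exact (((analyticAt_rectFactor lam _).continuousAt.tendsto.comp hd)).const_mul u
  have hinv : Tendsto (fun n => rectInv lam (κ n).toMeasure y) atTop (𝓝 u) := by
    rw [tendsto_iff_dist_tendsto_zero]
    have h2 : Tendsto (fun n => 2 * |y - rectMap lam (κ n).toMeasure u|) atTop (𝓝 0) := by
      have := ((hmap.const_sub y).abs).const_mul 2
      simpa using this
    refine squeeze_zero' (Eventually.of_forall fun _ => dist_nonneg) ?_ h2
    filter_upwards [h] with n hn
    obtain ⟨hs1, hs2⟩ := rectInv_spec h0 h1 hy hn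
    have := abs_sub_le_rectMap h0 h1 (hy.trans_le hs1.1) (hy.trans_le hu1)
      ((defect_mono (hy.le.trans hs1.1) hs1.2).trans hn)
      ((defect_mono (hy.le.trans hu1) hu2).trans hn)
    rwa [hs2] at this
  have hdiff : Tendsto (fun n => defect (κ n).toMeasure (rectInv lam (κ n).toMeasure y)
      - defect (κ n).toMeasure u) atTop (𝓝 0) := by
    rw [tendsto_zero_iff_abs_tendsto_zero]
    have h2 : Tendsto (fun n => |rectInv lam (κ n).toMeasure y - u| / y) atTop (𝓝 0) := by
      have := ((hinv.sub_const u).abs).div_const y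
      simpa using this
    refine squeeze_zero' (Eventually.of_forall fun _ => abs_nonneg _) ?_ h2
    filter_upwards [h] with n hn
    exact abs_defect_sub_le hy (rectInv_spec h0 h1 hy hn).1.1 hu1
  simpa using hdiff.add hd

end Limits

lemma RectAdd.eventually {lam : ℝ} {μ ν ξ : SymmProb}
    (h : RectAdd lam μ.toMeasure ν.toMeasure ξ.toMeasure) : ∀ᶠ y in 𝓝[>] (0 : ℝ),
      rectDefect lam ξ.toMeasure y = rectDefect lam μ.toMeasure y + rectDefect lam ν.toMeasure y := by
  filter_upwards [self_mem_nhdsWithin, eventually_defect_lt μ.toMeasure (ε := 1 / 32) (by norm_num),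
    eventually_defect_lt ν.toMeasure (ε := 1 / 32) (by norm_num)] with y hy h1 h2
  exact (h y hy h1 h2).2

/-- Compactly supported measures are dense. -/
lemma exists_seq_compactlySupported (μ : SymmProb) :
    ∃ κ : ℕ → SymmProb, (∀ n, (κ n).CompactlySupported) ∧ Tendsto κ atTop (𝓝 μ) := by
  let c : ℕ → ℝ → ℝ := fun n x => max (-n) (min n x)
  have hc : ∀ n, Continuous (c n) := fun n => by fun_prop
  have hneg : ∀ n x, c n (-x) = -c n x := by
    intro n x
    have : (0 : ℝ) ≤ n := Nat.cast_nonneg n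
    simp only [c, max_def, min_def]
    split_ifs <;> linarith
  have hinv : ∀ n, (μ.toMeasure.map (c n)).IsNegInvariant := by
    intro n
    constructor
    have e : Neg.neg ∘ c n = c n ∘ Neg.neg := by ext x; exact (hneg n x).symm
    rw [Measure.neg_def, Measure.map_map measurable_neg (hc n).measurable, e,
      ← Measure.map_map (hc n).measurable measurable_neg]
    have : μ.toMeasure.map Neg.neg = μ.toMeasure := μ.2.neg_eq_self
    rw [this]
  refine ⟨fun n => ⟨μ.1.map (hc n).measurable.aemeasurable, hinv n⟩, fun n => ?_, ?_⟩
  · refine ⟨Icc (-n) n, isCompact_Icc, ?_⟩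
    change (μ.toMeasure.map (c n)) _ = 0
    rw [Measure.map_apply (hc n).measurable measurableSet_Icc.compl]
    convert measure_empty (μ := μ.toMeasure)
    ext x
    have : (0 : ℝ) ≤ n := Nat.cast_nonneg n
    simp [c]
  · refine tendsto_subtype_rng.2 (ProbabilityMeasure.tendsto_iff_forall_integral_tendsto.2
      fun f => ?_)
    have e : ∀ n, ∫ x, f x ∂(μ.toMeasure.map (c n)) = ∫ x, f (c n x) ∂μ.toMeasure := fun n =>
      integral_map (hc n).measurable.aemeasurable f.continuous.aestronglyMeasurable
    change Tendsto (fun n => ∫ x, f x ∂(μ.toMeasure.map (c n))) atTop (𝓝 (∫ x, f x ∂μ.toMeasure))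
    simp only [e]
    refine tendsto_integral_of_dominated_convergence (fun _ => ‖f‖)
      (fun n => (f.continuous.comp (hc n)).aestronglyMeasurable) (integrable_const _)
      (fun n => ae_of_all _ fun x => f.norm_coe_le_norm _) (ae_of_all _ fun x => ?_)
    refine tendsto_const_nhds.congr' ?_
    filter_upwards [eventually_ge_atTop ⌈|x|⌉₊] with n hn
    have h2 : |x| ≤ n := (Nat.le_ceil _).trans (by exact_mod_cast hn)
    obtain ⟨h3, h4⟩ := abs_le.1 h2
    simp only [c]
    rw [min_eq_right h4, max_eq_right h3]

variable {lam : ℝ} (h0 : 0 ≤ lam) (h1 : lam ≤ 1)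
include h0 h1

/-- The hypotheses of `RectAdd` are strict inequalities at one point, so they hold eventually along
the sequence; its conclusions are closed conditions. -/
lemma RectAdd.of_tendsto {κ₁ κ₂ κ₃ : ℕ → SymmProb} {μ ν ξ : SymmProb}
    (hμ : Tendsto κ₁ atTop (𝓝 μ)) (hν : Tendsto κ₂ atTop (𝓝 ν)) (hξ : Tendsto κ₃ atTop (𝓝 ξ))
    (h : ∀ n, RectAdd lam (κ₁ n).toMeasure (κ₂ n).toMeasure (κ₃ n).toMeasure) :
    RectAdd lam μ.toMeasure ν.toMeasure ξ.toMeasure := by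
  intro y hy hdμ hdν
  have hy2 : 0 ≤ 2 * y := by linarith
  have e1 := (tendsto_defect hμ hy2).eventually (gt_mem_nhds hdμ)
  have e2 := (tendsto_defect hν hy2).eventually (gt_mem_nhds hdν)
  have e3 : ∀ᶠ n in atTop, defect (κ₃ n).toMeasure (2 * y) ≤ 1 / 8 ∧
      rectDefect lam (κ₃ n).toMeasure y
        = rectDefect lam (κ₁ n).toMeasure y + rectDefect lam (κ₂ n).toMeasure y := by
    filter_upwards [e1, e2] with n hn1 hn2 using h n y hy hn1 hn2
  have hdξ := le_of_tendsto (tendsto_defect hξ hy2) (e3.mono fun _ hn => hn.1)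
  refine ⟨hdξ, tendsto_nhds_unique
    (tendsto_rectDefect hξ h0 h1 hy (e3.mono fun _ hn => hn.1) hdξ) ?_⟩
  refine ((tendsto_rectDefect hμ h0 h1 hy (e1.mono fun _ hn => hn.le.trans (by norm_num))
    (hdμ.le.trans (by norm_num))).add (tendsto_rectDefect hν h0 h1 hy
    (e2.mono fun _ hn => hn.le.trans (by norm_num)) (hdν.le.trans (by norm_num)))).congr' ?_
  filter_upwards [e3] with n hn using hn.2.symm

/-- Compactness of the convolutions of convergent sequences. -/
lemma exists_rectAdd_of_tendsto {κ₁ κ₂ κ₃ : ℕ → SymmProb} {μ ν : SymmProb}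
    (hμ : Tendsto κ₁ atTop (𝓝 μ)) (hν : Tendsto κ₂ atTop (𝓝 ν))
    (h : ∀ n, RectAdd lam (κ₁ n).toMeasure (κ₂ n).toMeasure (κ₃ n).toMeasure) :
    ∃ (ξ : SymmProb) (φ : ℕ → ℕ), StrictMono φ ∧ Tendsto (fun n => κ₃ (φ n)) atTop (𝓝 ξ) ∧
      RectAdd lam μ.toMeasure ν.toMeasure ξ.toMeasure := by
  have key : ∀ ε > 0, ∀ᶠ y in 𝓝[>] (0 : ℝ), ∀ n, defect (κ₃ n).toMeasure y ≤ ε := by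
    intro ε hε
    -- The bound 1/64 stays under the threshold 1/32 of `RectAdd`, and ε/2 is the share of each
    -- summand.
    have hε' : 0 < min (ε / 2) (1 / 64) := by positivity
    filter_upwards [tendsto_two_mul_nhdsGT.eventually (eventually_forall_defect_le hμ hε'),
      tendsto_two_mul_nhdsGT.eventually (eventually_forall_defect_le hν hε'),
      self_mem_nhdsWithin] with y hy1 hy2 (hy : 0 < y) n
    have i1 := min_le_left (ε / 2) (1 / 64)
    have i2 := min_le_right (ε / 2) (1 / 64)
    obtain ⟨e1, e2⟩ := h n y hy (by linarith [hy1 n]) (by linarith [hy2 n])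
    have e3 := defect_rectInv_le h0 h1 hy
      (show defect (κ₁ n).toMeasure (2 * y) ≤ 1 / 8 by linarith [hy1 n])
    have e4 := defect_rectInv_le h0 h1 hy
      (show defect (κ₂ n).toMeasure (2 * y) ≤ 1 / 8 by linarith [hy2 n])
    have e5 : defect (κ₃ n).toMeasure y ≤ rectDefect lam (κ₃ n).toMeasure y :=
      defect_mono hy.le (rectInv_spec h0 h1 hy e1).1.1
    linarith [hy1 n, hy2 n]
  obtain ⟨ξ, φ, hφ, hξ⟩ := exists_tendsto_subseq key
  exact ⟨ξ, φ, hφ, hξ, RectAdd.of_tendsto h0 h1 (hμ.comp hφ.tendsto_atTop)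
    (hν.comp hφ.tendsto_atTop) hξ fun n => h (φ n)⟩

lemma symmProb_eq_of_rectDefect {μ ν : SymmProb}
    (h : ∀ᶠ y in 𝓝[>] (0 : ℝ), rectDefect lam μ.toMeasure y = rectDefect lam ν.toMeasure y) :
    μ = ν :=
  Subtype.ext (Subtype.ext (eq_of_rectDefect_eq h0 h1 (μ := μ.toMeasure) (ν := ν.toMeasure) h))

lemma RectAdd.unique {μ ν ξ ξ' : SymmProb} (h : RectAdd lam μ.toMeasure ν.toMeasure ξ.toMeasure)
    (h' : RectAdd lam μ.toMeasure ν.toMeasure ξ'.toMeasure) : ξ = ξ' := by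
  refine symmProb_eq_of_rectDefect h0 h1 ?_
  filter_upwards [RectAdd.eventually h, RectAdd.eventually h'] with y e e'
  rw [e, e']

lemma exists_rectAdd (μ ν : SymmProb) :
    ∃ ξ : SymmProb, RectAdd lam μ.toMeasure ν.toMeasure ξ.toMeasure := by
  obtain ⟨κ₁, hc₁, hκ₁⟩ := exists_seq_compactlySupported μ
  obtain ⟨κ₂, hc₂, hκ₂⟩ := exists_seq_compactlySupported ν
  choose κ₃ hκ₃ using fun n => exists_isRectConv h0 h1 (hc₁ n) (hc₂ n)
  obtain ⟨ξ, -, -, -, h⟩ := exists_rectAdd_of_tendsto h0 h1 hκ₁ hκ₂ fun n =>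
    rectAdd_of_isRectConv h0 h1 (hc₁ n) (hc₂ n) (hκ₃ n)
  exact ⟨ξ, h⟩

/-- Only the values on compact supports and continuity enter, so these alone already force
uniqueness. -/
lemma rectAdd_of_isContinuousExtension {op : SymmProb → SymmProb → SymmProb}
    (hop : IsContinuousExtension lam op) (μ ν : SymmProb) :
    RectAdd lam μ.toMeasure ν.toMeasure (op μ ν).toMeasure := by
  obtain ⟨κ₁, hc₁, hκ₁⟩ := exists_seq_compactlySupported μ
  obtain ⟨κ₂, hc₂, hκ₂⟩ := exists_seq_compactlySupported ν
  exact RectAdd.of_tendsto h0 h1 hκ₁ hκ₂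
    ((hop.continuous.tendsto (μ, ν)).comp (hκ₁.prodMk_nhds hκ₂)) fun n =>
    rectAdd_of_isRectConv h0 h1 (hc₁ n) (hc₂ n) (hop.extends_conv _ _ (hc₁ n) (hc₂ n))

/-- The rectangular free convolution has a unique continuous extension. -/
lemma existsUnique_isContinuousExtension :
    ∃! op : SymmProb → SymmProb → SymmProb, IsContinuousExtension lam op := by
  choose op hop using exists_rectAdd h0 h1
  have hev := fun μ ν => RectAdd.eventually (hop μ ν)
  refine ⟨op, ⟨fun μ ν hμ hν => ?_, fun μ ν => ?_, fun μ ν ξ => ?_, ?_⟩, fun op' hop' => ?_⟩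
  · obtain ⟨ξ, hξ⟩ := exists_isRectConv h0 h1 hμ hν
    rwa [RectAdd.unique h0 h1 (hop μ ν) (rectAdd_of_isRectConv h0 h1 hμ hν hξ)]
  · refine symmProb_eq_of_rectDefect h0 h1 ?_
    filter_upwards [hev μ ν, hev ν μ] with y e1 e2
    rw [e1, e2, add_comm]
  · refine symmProb_eq_of_rectDefect h0 h1 ?_
    filter_upwards [hev μ ν, hev (op μ ν) ξ, hev ν ξ, hev μ (op ν ξ)] with y e1 e2 e3 e4
    rw [e2, e1, e4, e3, add_assoc]
  · have : TopologicalSpace.MetrizableSpace SymmProb := IsEmbedding.subtypeVal.metrizableSpace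
    -- Every subsequence has a further one that converges, and `RectAdd` identifies its limit.
    rw [continuous_iff_seqContinuous]
    intro x p hx
    refine tendsto_of_subseq_tendsto fun ns hns => ?_
    have h2 := hx.comp hns
    obtain ⟨ξ, φ, -, hφ, hξ⟩ := exists_rectAdd_of_tendsto h0 h1
      ((continuous_fst.tendsto p).comp h2) ((continuous_snd.tendsto p).comp h2)
      (κ₃ := fun n => op (x (ns n)).1 (x (ns n)).2) fun n => hop _ _
    refine ⟨φ, ?_⟩
    rw [← RectAdd.unique h0 h1 (hop p.1 p.2) hξ] at hφ
    exact hφ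
  · funext μ ν
    exact RectAdd.unique h0 h1 (rectAdd_of_isContinuousExtension h0 h1 hop' μ ν) (hop μ ν)

end RectConv

/-! ### Inverses in sectors -/

namespace RectConv

open Metric

lemma mem_leftSector_mono {α α' : ℝ} (h : α ≤ α') : leftSector α ⊆ leftSector α' :=
  fun _ hz => ⟨hz.1, hz.2.trans_le h⟩

/-- Sectors are invariant under dilation, so it suffices that w/z close to 1 has small argument. -/
lemma exists_closedBall_subset_leftSector {α α' : ℝ} (hα : α < α') (hα' : α' ≤ Real.pi) :
    ∃ c ∈ Ioo (0 : ℝ) 1, ∀ z ∈ leftSector α, closedBall z (c * ‖z‖) ⊆ leftSector α' := by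
  have hc : ∀ᶠ ζ in 𝓝 (1 : ℂ), |Complex.arg ζ| < α' - α := by
    have h := (Complex.continuousAt_arg (x := 1) (by simp)).abs
    refine h.eventually (gt_mem_nhds ?_)
    simpa using hα
  obtain ⟨c, hc0, hc⟩ := Metric.eventually_nhds_iff_ball.1 hc
  refine ⟨min (c / 2) (1 / 2), ⟨by positivity, (min_le_right _ _).trans_lt (by norm_num)⟩, ?_⟩
  intro z hz w hw
  have hz0 : 0 < ‖z‖ := norm_pos_iff.2 hz.1
  have h1 : ‖w / z - 1‖ ≤ min (c / 2) (1 / 2) := by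
    have : w / z - 1 = (w - z) / z := by rw [sub_div, div_self hz.1]
    rw [this, norm_div, div_le_iff₀ hz0]
    exact mem_closedBall_iff_norm.1 hw
  have h2 : |Complex.arg (w / z)| < α' - α :=
    hc _ (mem_ball_iff_norm.2 (h1.trans_lt ((min_le_left _ _).trans_lt (by linarith))))
  have hw0 : w ≠ 0 := by
    rintro rfl
    rw [zero_div, zero_sub, norm_neg, norm_one] at h1
    linarith [min_le_right (c / 2) (1 / 2)]
  refine ⟨hw0, ?_⟩
  have e : -w = -z * (w / z) := by field_simp [hz.1]
  have hlt : |Complex.arg (-z) + Complex.arg (w / z)| < α' :=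
    (abs_add_le _ _).trans_lt (by linarith [hz.2])
  have h3 := abs_lt.1 hlt
  rw [e, Complex.arg_mul (neg_ne_zero.2 hz.1) (div_ne_zero hw0 hz.1)
    ⟨by linarith, by linarith⟩]
  exact hlt

/-- A function which is holomorphic off the positive half-line and tangent to the identity at `0`
in sectors. -/
structure SectorTangent (H : ℂ → ℂ) : Prop where
  differentiableAt : ∀ z, -z ∈ Complex.slitPlane → DifferentiableAt ℂ H z
  tendsto : ∀ α ∈ Ioo (0 : ℝ) Real.pi, Tendsto (fun z => H z / z) (𝓝[leftSector α] 0) (𝓝 1)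

lemma eventually_nhdsWithin_leftSector_iff {α : ℝ} {P : ℂ → Prop} :
    (∀ᶠ z in 𝓝[leftSector α] 0, P z) ↔ ∃ β > 0, ∀ z ∈ truncSector α β, P z := by
  rw [Metric.nhdsWithin_basis_ball.eventually_iff]
  refine exists_congr fun β => and_congr_right fun _ => ?_
  refine forall_congr' fun z => ?_
  rw [mem_inter_iff, mem_ball_zero_iff, and_comm]
  rfl

variable {H : ℂ → ℂ} (hH : SectorTangent H)

lemma SectorTangent.eventually_norm_sub_le (hH : SectorTangent H) {α ε : ℝ}
    (hα : α ∈ Ioo (0 : ℝ) Real.pi) (hε : 0 < ε) :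
    ∀ᶠ z in 𝓝[leftSector α] 0, ‖H z - z‖ ≤ ε * ‖z‖ := by
  have h := (hH.tendsto α hα).eventually (Metric.ball_mem_nhds 1 hε)
  filter_upwards [h, self_mem_nhdsWithin] with z hz hzα
  have e : H z - z = (H z / z - 1) * z := by rw [sub_mul, one_mul, div_mul_cancel₀ _ hzα.1]
  rw [e, norm_mul]
  exact mul_le_mul_of_nonneg_right (mem_ball_iff_norm.1 hz).le (norm_nonneg z)

/-- The constants `c`, `β` such that on the ball of radius `c ‖z‖` around a point `z` of the
truncated sector, the function is a contractive perturbation of the identity. -/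
structure SectorBound (H : ℂ → ℂ) (α c β : ℝ) : Prop where
  c_pos : 0 < c
  c_lt : c < 1
  β_pos : 0 < β
  sector : ∃ α' ∈ Ioo (0 : ℝ) Real.pi, ∀ z ∈ truncSector α β,
    closedBall z (c * ‖z‖) ⊆ leftSector α'
  lipschitz : ∀ z ∈ truncSector α β, ∀ w ∈ closedBall z (c * ‖z‖), ∀ w' ∈ closedBall z (c * ‖z‖),
    ‖(H w - w) - (H w' - w')‖ ≤ 1 / 2 * ‖w - w'‖
  small : ∀ z ∈ truncSector α β, ∀ w ∈ closedBall z (c * ‖z‖), ‖H w - w‖ ≤ c / 2 * ‖z‖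

lemma SectorTangent.exists_sectorBound (hH : SectorTangent H) {α : ℝ}
    (hα : α ∈ Ioo (0 : ℝ) Real.pi) : ∃ c β, SectorBound H α c β := by
  -- The sector of opening α₁ holds the balls around z, and that of opening α₂ the circles around
  -- their points used in Cauchy's estimate.
  set α₁ := (α + Real.pi) / 2 with hα₁
  set α₂ := (α₁ + Real.pi) / 2 with hα₂
  have h1 : α < α₁ := by linarith [hα.2]
  have h1' : α₁ < Real.pi := by linarith [hα.2]
  have h2 : α₁ < α₂ := by linarith
  have h2' : α₂ < Real.pi := by linarith
  have hm₁ : α₁ ∈ Ioo (0 : ℝ) Real.pi := ⟨hα.1.trans h1, h1'⟩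
  have hm₂ : α₂ ∈ Ioo (0 : ℝ) Real.pi := ⟨hm₁.1.trans h2, h2'⟩
  obtain ⟨c, ⟨hc0, hc1⟩, hc⟩ := exists_closedBall_subset_leftSector h1 h1'.le
  obtain ⟨c', ⟨hc0', hc1'⟩, hc'⟩ := exists_closedBall_subset_leftSector h2 h2'.le
  have hε : 0 < min (c' / 4) (c / 4) := by positivity
  obtain ⟨β, hβ, hε⟩ := eventually_nhdsWithin_leftSector_iff.1 (hH.eventually_norm_sub_le hm₂ hε)
  have hnorm : ∀ {a : ℝ} {z w : ℂ}, a < 1 → w ∈ closedBall z (a * ‖z‖) → ‖w‖ ≤ 2 * ‖z‖ := by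
    intro a z w ha hw
    have h3 := mem_closedBall_iff_norm.1 hw
    have h4 := norm_le_norm_add_norm_sub' w z
    nlinarith [norm_nonneg z]
  have hbd : ∀ z ∈ truncSector α (β / 4), ∀ w ∈ closedBall z (c * ‖z‖),
      ‖H w - w‖ ≤ min (c' / 4) (c / 4) * ‖w‖ := by
    intro z hz w hw
    refine hε w ⟨mem_leftSector_mono h2.le (hc z hz.1 hw), ?_⟩
    have h3 := hnorm hc1 hw
    have h4 : ‖z‖ < β / 4 := hz.2
    change ‖w‖ < β
    linarith
  have hdiff : ∀ w, -w ∈ Complex.slitPlane → DifferentiableAt ℂ (fun w => H w - w) w := fun w hw =>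
    (hH.differentiableAt w hw).sub differentiableAt_id
  -- Passing from z to w, and from w to a circle around it, at most doubles the norm each time;
  -- hence β/4.
  refine ⟨c, β / 4, hc0, hc1, by positivity, ⟨α₁, hm₁, fun z hz => hc z hz.1⟩, ?_, ?_⟩
  · intro z hz w hw w' hw'
    refine (convex_closedBall z (c * ‖z‖)).norm_image_sub_le_of_norm_deriv_le (𝕜 := ℂ)
      (f := fun w => H w - w) (C := 1 / 2)
      (fun v hv => hdiff v (neg_mem_slitPlane_of_mem_leftSector h1'.le (hc z hz.1 hv)))
      (fun v hv => ?_) hw' hw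
    have hv1 := hc z hz.1 hv
    have hv0 : 0 < ‖v‖ := norm_pos_iff.2 hv1.1
    have hvz := hnorm hc1 hv
    have hz4 : ‖z‖ < β / 4 := hz.2
    -- Cauchy's estimate on radius c'‖v‖ gives (c'/4)(2‖v‖)/(c'‖v‖) = 1/2.
    have key := Complex.norm_deriv_le_of_forall_mem_sphere_norm_le (f := fun w => H w - w) (c := v)
      (R := c' * ‖v‖) (C := c' / 4 * (2 * ‖v‖)) (by positivity) ?_ ?_
    · refine key.trans (le_of_eq ?_)
      field_simp
      norm_num
    · refine DifferentiableOn.diffContOnCl fun s hs => ?_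
      have hs' := closure_ball_subset_closedBall hs
      exact (hdiff s (neg_mem_slitPlane_of_mem_leftSector h2'.le
        (hc' v hv1 hs'))).differentiableWithinAt
    · intro s hs
      have hs' := sphere_subset_closedBall hs
      have hsn := hnorm hc1' hs'
      have h5 := hε s ⟨hc' v hv1 hs', by change ‖s‖ < β; linarith⟩
      refine h5.trans ?_
      gcongr
      exact min_le_left _ _
  · intro z hz w hw
    refine (hbd z hz w hw).trans ?_
    have h3 := hnorm hc1 hw
    calc min (c' / 4) (c / 4) * ‖w‖ ≤ c / 4 * (2 * ‖z‖) := by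
          gcongr
          exact min_le_right _ _
      _ = c / 2 * ‖z‖ := by ring

lemma SectorBound.eq_of_eq {α c β : ℝ} (h : SectorBound H α c β) {z w w' : ℂ}
    (hz : z ∈ truncSector α β) (hw : w ∈ closedBall z (c * ‖z‖))
    (hw' : w' ∈ closedBall z (c * ‖z‖)) (e : H w = H w') : w = w' := by
  have h1 := h.lipschitz z hz w hw w' hw'
  have h2 : (H w - w) - (H w' - w') = -(w - w') := by rw [e]; ring
  rw [h2, norm_neg] at h1
  exact sub_eq_zero.1 (norm_eq_zero.1 (by linarith [norm_nonneg (w - w')]))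

/-- A preimage of z is a fixed point of w ↦ z - (H w - w), a contraction of the ball. -/
lemma SectorBound.exists_eq {α c β : ℝ} (h : SectorBound H α c β) {z : ℂ}
    (hz : z ∈ truncSector α β) : ∃ w ∈ closedBall z (c * ‖z‖), H w = z := by
  have hr : 0 ≤ c * ‖z‖ := mul_nonneg h.c_pos.le (norm_nonneg z)
  let T : ℂ → ℂ := fun w => z - (H w - w)
  have hmaps : MapsTo T (closedBall z (c * ‖z‖)) (closedBall z (c * ‖z‖)) := by
    intro w hw
    rw [mem_closedBall_iff_norm]
    have h1 := h.small z hz w hw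
    have : T w - z = -(H w - w) := by simp only [T]; ring
    rw [this, norm_neg]
    linarith
  have hcontr : ContractingWith (1 / 2) (hmaps.restrict T _ _) := by
    refine ⟨by rw [← NNReal.coe_lt_coe]; norm_num, LipschitzWith.of_dist_le_mul fun w w' => ?_⟩
    have h1 := h.lipschitz z hz w w.2 w' w'.2
    rw [Subtype.dist_eq, dist_eq_norm]
    change ‖(z - (H w - w)) - (z - (H w' - w'))‖ ≤ _
    rw [sub_sub_sub_cancel_left, norm_sub_rev, Subtype.dist_eq, dist_eq_norm]
    simpa using h1
  obtain ⟨w, hw, hfix, -⟩ := hcontr.exists_fixedPoint' isClosed_closedBall.isComplete hmaps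
    (mem_closedBall_self hr) (edist_ne_top _ _)
  refine ⟨w, hw, ?_⟩
  have : z - (H w - w) = w := hfix
  linear_combination -this

/-- The closest preimage. -/
noncomputable def sectorInv (H : ℂ → ℂ) (z : ℂ) : ℂ :=
  Classical.epsilon fun w => H w = z ∧ ∀ w', H w' = z → ‖w - z‖ ≤ ‖w' - z‖

/-- Every other preimage lies outside the ball, hence further away. The closest preimage does not
involve α, so a single function inverts H in all sectors. -/
lemma SectorBound.sectorInv_eq {α c β : ℝ} (h : SectorBound H α c β) {z w : ℂ}
    (hz : z ∈ truncSector α β) (hw : w ∈ closedBall z (c * ‖z‖)) (e : H w = z) :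
    sectorInv H z = w := by
  have hmin : ∀ w', H w' = z → ‖w - z‖ ≤ ‖w' - z‖ := by
    intro w' e'
    by_cases hw' : w' ∈ closedBall z (c * ‖z‖)
    · rw [h.eq_of_eq hz hw hw' (e.trans e'.symm)]
    · rw [mem_closedBall_iff_norm, not_le] at hw'
      exact (mem_closedBall_iff_norm.1 hw).trans hw'.le
  have hs := Classical.epsilon_spec (p := fun w => H w = z ∧ ∀ w', H w' = z → ‖w - z‖ ≤ ‖w' - z‖)
    ⟨w, e, hmin⟩
  exact h.eq_of_eq hz (mem_closedBall_iff_norm.2 ((hs.2 w e).trans (mem_closedBall_iff_norm.1 hw)))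
    hw (hs.1.trans e.symm)

lemma SectorBound.sectorInv_spec {α c β : ℝ} (h : SectorBound H α c β) {z : ℂ}
    (hz : z ∈ truncSector α β) :
    sectorInv H z ∈ closedBall z (c * ‖z‖) ∧ H (sectorInv H z) = z := by
  obtain ⟨w, hw, e⟩ := h.exists_eq hz
  rw [h.sectorInv_eq hz hw e]
  exact ⟨hw, e⟩

/-- The derivative of H cannot vanish, as H - id would then have derivative -1 although it is
1/2-Lipschitz. Analyticity of the inverse is tested after composing with H. -/
lemma SectorBound.analyticAt_sectorInv (hH : SectorTangent H) {α c β : ℝ}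
    (hα : α ∈ Ioo (0 : ℝ) Real.pi) (h : SectorBound H α c β)
    {z : ℂ} (hz : z ∈ truncSector α β) : AnalyticAt ℂ (sectorInv H) z := by
  obtain ⟨hw, e⟩ := h.sectorInv_spec hz
  set w := sectorInv H z
  have hz0 : 0 < ‖z‖ := norm_pos_iff.2 hz.1.1
  obtain ⟨α', hα', hsec⟩ := h.sector
  have hw' : -w ∈ Complex.slitPlane :=
    neg_mem_slitPlane_of_mem_leftSector hα'.2.le (hsec z hz hw)
  have han : AnalyticAt ℂ H w := by
    refine DifferentiableOn.analyticAt (s := {v | -v ∈ Complex.slitPlane})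
      (fun v hv => (hH.differentiableAt v hv).differentiableWithinAt) ?_
    exact (Complex.isOpen_slitPlane.preimage continuous_neg).mem_nhds hw'
  have hlt : ‖w - z‖ < c * ‖z‖ := by
    have h1 := h.small z hz w hw
    rw [e, norm_sub_rev] at h1
    nlinarith [mul_pos h.c_pos hz0]
  have hnhds : closedBall z (c * ‖z‖) ∈ 𝓝 w :=
    mem_of_superset (isOpen_ball.mem_nhds (mem_ball_iff_norm.2 hlt)) ball_subset_closedBall
  have hder : deriv H w ≠ 0 := by
    intro h0
    have h1 : HasDerivAt (fun v => H v - v) (0 - 1) w := by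
      rw [← h0]; exact han.differentiableAt.hasDerivAt.sub (hasDerivAt_id w)
    have h2 := h1.le_of_lip' (C := 1 / 2) (by norm_num) (by
      filter_upwards [hnhds] with v hv using h.lipschitz z hz v hv w hw)
    norm_num at h2
  rw [← e, ← analyticAt_comp_iff_of_deriv_ne_zero han hder]
  refine analyticAt_id.congr ?_
  have hc : ContinuousAt H w := han.continuousAt
  have e1 : ∀ᶠ v in 𝓝 w, H v ∈ truncSector α β :=
    hc.eventually (by rw [e]; exact (isOpen_truncSector hα.2.le β).mem_nhds hz)
  have e2 : ∀ᶠ v in 𝓝 w, ‖v - H v‖ < c * ‖H v‖ := by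
    have h1 : ContinuousAt (fun v => ‖v - H v‖) w := (continuousAt_id.sub hc).norm
    have h2 : ContinuousAt (fun v => c * ‖H v‖) w := continuousAt_const.mul hc.norm
    exact h1.eventually_lt h2 (by rwa [e])
  filter_upwards [e1, e2] with v hv1 hv2
  exact (h.sectorInv_eq hv1 (mem_closedBall_iff_norm.2 hv2.le) rfl).symm

include hH

lemma SectorTangent.isSectorialInverse_sectorInv : IsSectorialInverse H (sectorInv H) := by
  intro α hα
  obtain ⟨c, β, h⟩ := hH.exists_sectorBound hα
  have hβ : ∀ᶠ z in 𝓝[leftSector α] 0, z ∈ truncSector α β :=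
    eventually_nhdsWithin_leftSector_iff.2 ⟨β, h.β_pos, fun z hz => hz⟩
  refine ⟨⟨β, h.β_pos, fun z hz =>
    (h.analyticAt_sectorInv hH hα hz).differentiableAt.differentiableWithinAt⟩, ?_, ?_⟩
  · obtain ⟨α', hα', hsec⟩ := h.sector
    have ht : Tendsto (sectorInv H) (𝓝[leftSector α] 0) (𝓝[leftSector α'] 0) := by
      refine tendsto_nhdsWithin_iff.2 ⟨?_, hβ.mono fun z hz => hsec z hz (h.sectorInv_spec hz).1⟩
      rw [tendsto_zero_iff_norm_tendsto_zero]
      have h2 : Tendsto (fun z : ℂ => 2 * ‖z‖) (𝓝[leftSector α] 0) (𝓝 0) := by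
        have : ContinuousAt (fun z : ℂ => 2 * ‖z‖) 0 := by fun_prop
        simpa [ContinuousAt] using this.tendsto.mono_left nhdsWithin_le_nhds
      refine squeeze_zero' (Eventually.of_forall fun _ => norm_nonneg _) ?_ h2
      filter_upwards [hβ] with z hz
      have h3 := mem_closedBall_iff_norm.1 (h.sectorInv_spec hz).1
      have h4 := norm_le_norm_add_norm_sub' (sectorInv H z) z
      nlinarith [norm_nonneg z, h.c_lt]
    have h1 := ((hH.tendsto α' hα').comp ht).inv₀ one_ne_zero
    rw [inv_one] at h1
    refine h1.congr' ?_
    filter_upwards [hβ] with z hz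
    rw [Function.comp_apply, (h.sectorInv_spec hz).2, inv_div]
  -- H z may leave the sector of z, so F ∘ H = id is checked in a wider one, where z lies in the
  -- ball of radius c₁‖H z‖ around H z.
  · set α₁ := (α + Real.pi) / 2 with hα₁
    have h1 : α < α₁ := by linarith [hα.2]
    have h1' : α₁ < Real.pi := by linarith [hα.2]
    obtain ⟨c₁, β₁, h₁⟩ := hH.exists_sectorBound (α := α₁) ⟨hα.1.trans h1, h1'⟩
    obtain ⟨c', ⟨hc0', hc1'⟩, hc'⟩ := exists_closedBall_subset_leftSector h1 h1'.le
    have hc1 := h₁.c_pos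
    have hc2 := h₁.c_lt
    have hsmall := hH.eventually_norm_sub_le hα (show 0 < min c' (c₁ / 2) by positivity)
    have hβ₁ : ∀ᶠ z in 𝓝[leftSector α] 0, z ∈ truncSector α (β₁ / 2) :=
      eventually_nhdsWithin_leftSector_iff.2 ⟨β₁ / 2, half_pos h₁.β_pos, fun z hz => hz⟩
    refine eventually_nhdsWithin_leftSector_iff.1 ?_
    filter_upwards [hβ, hsmall, hβ₁] with z hz hs hz1
    refine ⟨(h.sectorInv_spec hz).2, ?_⟩
    have hs1 : ‖H z - z‖ ≤ c' * ‖z‖ :=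
      hs.trans (mul_le_mul_of_nonneg_right (min_le_left _ _) (norm_nonneg z))
    have hs2 : ‖H z - z‖ ≤ c₁ / 2 * ‖z‖ :=
      hs.trans (mul_le_mul_of_nonneg_right (min_le_right _ _) (norm_nonneg z))
    have hn1 := norm_le_norm_add_norm_sub' (H z) z
    have hn2 := norm_le_norm_add_norm_sub' z (H z)
    rw [norm_sub_rev z] at hn2
    have hzn : ‖z‖ < β₁ / 2 := hz1.2
    refine h₁.sectorInv_eq ⟨hc' z hz.1 (mem_closedBall_iff_norm.2 hs1), ?_⟩ ?_ rfl
    · change ‖H z‖ < β₁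
      nlinarith [norm_nonneg z]
    · rw [mem_closedBall_iff_norm, norm_sub_rev]
      nlinarith [norm_nonneg z]

end RectConv

/-! ### Additivity of the rectangular R-transform -/

namespace RectConv

lemma sectorTangent_rectCauchy (lam : ℝ) (μ : SymmProb) : SectorTangent (rectCauchy lam μ) := by
  refine ⟨fun z hz => ?_, fun α hα => ?_⟩
  · have hc := differentiableAt_cResMean (μ := μ.toMeasure) hz
    have hd : DifferentiableAt ℂ (fun z => z * (cResMean μ.toMeasure z *
        ((lam : ℂ) * cResMean μ.toMeasure z + (1 - (lam : ℂ))))) z :=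
      differentiableAt_id.mul (hc.mul ((hc.const_mul _).add_const _))
    refine hd.congr_of_eventuallyEq ?_
    filter_upwards [(Complex.isOpen_slitPlane.preimage continuous_neg).mem_nhds hz] with w hw
    exact rectCauchy_eq lam μ hw
  · have hc := tendsto_cResMean (μ := μ.toMeasure) hα
    have h := hc.mul ((hc.const_mul (lam : ℂ)).add_const (1 - (lam : ℂ)))
    rw [show (1 : ℂ) * ((lam : ℂ) * 1 + (1 - (lam : ℂ))) = 1 by ring] at h
    refine h.congr' ?_
    filter_upwards [self_mem_nhdsWithin] with z hz
    rw [rectCauchy_eq lam μ (neg_mem_slitPlane_of_mem_leftSector hα.2.le hz),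
      mul_div_cancel_left₀ _ hz.1]

lemma isSectorialInverse_rectCauchyInv (lam : ℝ) (μ : SymmProb) :
    IsSectorialInverse (rectCauchy lam μ) (rectCauchyInv lam μ) :=
  Classical.epsilon_spec ⟨_, (sectorTangent_rectCauchy lam μ).isSectorialInverse_sectorInv⟩

lemma rectCauchy_neg (lam : ℝ) (μ : SymmProb) {u : ℝ} (hu : 0 < u) :
    rectCauchy lam μ (-(u : ℂ)) = -(rectMap lam μ.toMeasure u : ℂ) := by
  have hz : -(-(u : ℂ)) ∈ Complex.slitPlane := by
    rw [neg_neg]; exact Complex.ofReal_mem_slitPlane.2 hu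
  rw [rectCauchy_eq lam μ hz, cResMean_neg]
  unfold rectMap rectFactor defect
  push_cast
  ring

lemma neg_mem_truncSector {α β y : ℝ} (hα : 0 < α) (hy : 0 < y) (hyβ : y < β) :
    -(y : ℂ) ∈ truncSector α β := by
  refine ⟨⟨neg_ne_zero.2 (Complex.ofReal_ne_zero.2 hy.ne'), ?_⟩, ?_⟩
  · rwa [neg_neg, Complex.arg_ofReal_of_nonneg hy.le, abs_zero]
  · change ‖-(y : ℂ)‖ < β
    rwa [norm_neg, Complex.norm_real, Real.norm_of_nonneg hy.le]

/-- -d is a root of λX² + (λ + 1)X = F - 1 with F the factor, and the radicand is the square of λ +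
1 - 2λd ≥ 0, so the principal root selects it. -/
lemma rectU_rectFactor {lam d : ℝ} (h0 : 0 ≤ lam) (hd : d ≤ 1 / 8) :
    rectU lam ((rectFactor lam d : ℂ) - 1) = -(d : ℂ) := by
  unfold rectU
  split_ifs with h
  · simp [h, rectFactor]
  · have hl : (lam : ℂ) ≠ 0 := Complex.ofReal_ne_zero.2 h
    have hs : 0 ≤ lam + 1 - 2 * lam * d := by nlinarith
    have e : ((lam : ℂ) + 1) ^ 2 + 4 * (lam : ℂ) * ((rectFactor lam d : ℂ) - 1)
        = (((lam + 1 - 2 * lam * d) ^ 2 : ℝ) : ℂ) := by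
      unfold rectFactor; push_cast; ring
    rw [e, show (1 / 2 : ℂ) = ((1 / 2 : ℝ) : ℂ) by push_cast; rfl,
      ← Complex.ofReal_cpow (sq_nonneg _), ← Real.sqrt_eq_rpow, Real.sqrt_sq hs]
    push_cast
    field_simp
    ring

lemma eventually_rectRTransform_neg {lam : ℝ} (h0 : 0 ≤ lam) (h1 : lam ≤ 1) (μ : SymmProb) :
    ∀ᶠ y : ℝ in 𝓝[>] 0,
      rectRTransform lam μ (-(y : ℂ)) = -(rectDefect lam μ.toMeasure y : ℂ) := by
  have hα : Real.pi / 2 ∈ Ioo (0 : ℝ) Real.pi :=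
    ⟨by linarith [Real.pi_pos], by linarith [Real.pi_pos]⟩
  obtain ⟨-, -, β, hβ, hF⟩ := isSectorialInverse_rectCauchyInv lam μ _ hα
  have hs : ∀ᶠ y : ℝ in 𝓝[>] 0, y < β / 2 :=
    nhdsWithin_le_nhds (gt_mem_nhds (half_pos hβ))
  filter_upwards [hs, self_mem_nhdsWithin,
    eventually_defect_lt μ.toMeasure (show (0 : ℝ) < 1 / 8 by norm_num)] with y hyβ hy hd
  have hy : 0 < y := hy
  have hu := rectInv_pos h0 h1 hy hd.le
  obtain ⟨hmem, hmap⟩ := rectInv_spec h0 h1 hy hd.le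
  have hdl := defect_rectInv_le h0 h1 hy hd.le
  have hmap' := hmap
  unfold rectMap at hmap'
  set u := rectInv lam μ.toMeasure y
  -- F ∘ H = id at -u fixes the value, whichever inverse was chosen.
  have hinv : rectCauchyInv lam μ (-(y : ℂ)) = -(u : ℂ) := by
    have := (hF _ (neg_mem_truncSector hα.1 hu (by linarith [hmem.2]))).2
    rwa [rectCauchy_neg lam μ hu, hmap] at this
  have e : -(y : ℂ) / -(u : ℂ) = (rectFactor lam (defect μ.toMeasure u) : ℂ) := by
    rw [neg_div_neg_eq, ← Complex.ofReal_div, ← hmap', mul_div_cancel_left₀ _ hu.ne']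
  unfold rectRTransform
  rw [hinv, e]
  exact rectU_rectFactor h0 (hdl.trans (by linarith))

lemma analyticAt_rectU {lam : ℝ} {z : ℂ}
    (hz : ((lam : ℂ) + 1) ^ 2 + 4 * (lam : ℂ) * z ∈ Complex.slitPlane) :
    AnalyticAt ℂ (rectU lam) z := by
  unfold rectU
  split_ifs with h
  · exact analyticAt_id
  · have h1 : AnalyticAt ℂ (fun z : ℂ => ((lam : ℂ) + 1) ^ 2 + 4 * (lam : ℂ) * z) z := by
      fun_prop
    exact ((analyticAt_const).add (h1.cpow analyticAt_const hz)).div analyticAt_const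
      (mul_ne_zero two_ne_zero (Complex.ofReal_ne_zero.2 h))

lemma truncSector_mono {α β β' : ℝ} (h : β ≤ β') : truncSector α β ⊆ truncSector α β' :=
  fun _ hz => ⟨hz.1, lt_of_lt_of_le hz.2 h⟩

/-- Since z/F(z) tends to 1, the radicand tends to (λ + 1)² > 0 and stays off the cut. -/
lemma exists_analyticOnNhd_rectRTransform {lam : ℝ} (h0 : 0 ≤ lam) (μ : SymmProb) {α : ℝ}
    (hα : α ∈ Ioo (0 : ℝ) Real.pi) :
    ∃ β > 0, AnalyticOnNhd ℂ (rectRTransform lam μ) (truncSector α β) := by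
  obtain ⟨⟨β, hβ, hF⟩, ht, -⟩ := isSectorialInverse_rectCauchyInv lam μ α hα
  set F := rectCauchyInv lam μ
  have ht' : Tendsto (fun z => ((lam : ℂ) + 1) ^ 2 + 4 * (lam : ℂ) * (z / F z - 1))
      (𝓝[leftSector α] 0) (𝓝 (((lam : ℂ) + 1) ^ 2 + 4 * (lam : ℂ) * ((1 : ℂ)⁻¹ - 1))) := by
    refine ((((ht.inv₀ one_ne_zero).congr fun z => ?_).sub_const 1).const_mul _).const_add _
    rw [inv_div]
  have hslit : ((lam : ℂ) + 1) ^ 2 + 4 * (lam : ℂ) * ((1 : ℂ)⁻¹ - 1) ∈ Complex.slitPlane := by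
    rw [show ((lam : ℂ) + 1) ^ 2 + 4 * (lam : ℂ) * ((1 : ℂ)⁻¹ - 1)
      = (((lam + 1) ^ 2 : ℝ) : ℂ) by push_cast; simp]
    exact Complex.ofReal_mem_slitPlane.2 (by positivity)
  obtain ⟨β', hβ', h⟩ := eventually_nhdsWithin_leftSector_iff.1
    ((ht.eventually_ne one_ne_zero).and (ht'.eventually (Complex.isOpen_slitPlane.mem_nhds hslit)))
  refine ⟨min β β', lt_min hβ hβ', fun z hz => ?_⟩
  obtain ⟨hne, hsl⟩ := h z (truncSector_mono (min_le_right _ _) hz)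
  have hFz : AnalyticAt ℂ F z :=
    hF.analyticAt ((isOpen_truncSector hα.2.le β).mem_nhds (truncSector_mono (min_le_left _ _) hz))
  have hF0 : F z ≠ 0 := fun h => hne (by rw [h, zero_div])
  have hg : AnalyticAt ℂ (fun w => w / F w - 1) z :=
    (analyticAt_id.div hFz hF0).sub analyticAt_const
  exact AnalyticAt.comp (f := fun w => w / F w - 1) (analyticAt_rectU hsl) hg

/-- The truncated sector is the image of a convex half-strip under w ↦ -exp w. -/
lemma isPreconnected_truncSector {α β : ℝ} (hα : α ≤ Real.pi) (hβ : 0 < β) :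
    IsPreconnected (truncSector α β) := by
  have e : truncSector α β = (fun w => -Complex.exp w) ''
      ({w : ℂ | w.re < Real.log β} ∩ ({w : ℂ | -α < w.im} ∩ {w : ℂ | w.im < α})) := by
    ext z
    constructor
    · rintro ⟨⟨hz0, hz⟩, hzβ⟩
      have hz' := abs_lt.1 hz
      have hzβ' : ‖z‖ < β := hzβ
      refine ⟨Complex.log (-z), ⟨?_, ?_, ?_⟩, ?_⟩
      · change (Complex.log (-z)).re < _
        rw [Complex.log_re, norm_neg]
        exact Real.log_lt_log (norm_pos_iff.2 hz0) hzβ'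
      · change _ < (Complex.log (-z)).im
        rw [Complex.log_im]; exact hz'.1
      · change (Complex.log (-z)).im < _
        rw [Complex.log_im]; exact hz'.2
      · change -Complex.exp (Complex.log (-z)) = z
        rw [Complex.exp_log (neg_ne_zero.2 hz0), neg_neg]
    · rintro ⟨w, ⟨hre, him1, him2⟩, rfl⟩
      have hre : w.re < Real.log β := hre
      have him1 : -α < w.im := him1
      have him2 : w.im < α := him2
      refine ⟨⟨neg_ne_zero.2 (Complex.exp_ne_zero w), ?_⟩, ?_⟩
      · rw [neg_neg, ← Complex.log_im, Complex.log_exp (by linarith) (by linarith)]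
        exact abs_lt.2 ⟨him1, him2⟩
      · change ‖-Complex.exp w‖ < β
        rw [norm_neg, Complex.norm_exp]
        exact (Real.lt_log_iff_exp_lt hβ).1 hre
  rw [e]
  refine IsPreconnected.image (Convex.isPreconnected ?_) _ (by fun_prop)
  exact (convex_halfSpace_re_lt _).inter
    ((convex_halfSpace_im_gt _).inter (convex_halfSpace_im_lt _))

theorem sectorialEq_rectRTransform {lam : ℝ} (h0 : 0 ≤ lam) (h1 : lam ≤ 1) {μ ν ξ : SymmProb}
    (h : RectAdd lam μ.toMeasure ν.toMeasure ξ.toMeasure) :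
    SectorialEq (rectRTransform lam ξ)
      (fun z => rectRTransform lam μ z + rectRTransform lam ν z) := by
  intro α hα
  obtain ⟨β₁, hβ₁, hξ⟩ := exists_analyticOnNhd_rectRTransform h0 ξ hα
  obtain ⟨β₂, hβ₂, hμ⟩ := exists_analyticOnNhd_rectRTransform h0 μ hα
  obtain ⟨β₃, hβ₃, hν⟩ := exists_analyticOnNhd_rectRTransform h0 ν hα
  set β := min β₁ (min β₂ β₃)
  have hβ : 0 < β := lt_min hβ₁ (lt_min hβ₂ hβ₃)
  have hev : ∀ᶠ y : ℝ in 𝓝[>] 0, rectRTransform lam ξ (-(y : ℂ))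
      = rectRTransform lam μ (-(y : ℂ)) + rectRTransform lam ν (-(y : ℂ)) := by
    filter_upwards [RectAdd.eventually h, eventually_rectRTransform_neg h0 h1 ξ,
      eventually_rectRTransform_neg h0 h1 μ, eventually_rectRTransform_neg h0 h1 ν]
      with y hy e1 e2 e3
    rw [e1, e2, e3, hy]
    push_cast
    ring
  obtain ⟨b, hb, hev⟩ := mem_nhdsGT_iff_exists_Ioo_subset.1 hev
  have hb : 0 < b := hb
  -- The point -t lies in the common sector and is a limit of points of the negative half-line where
  -- equality is known.
  set t := min b β / 2
  have hm : 0 < min b β := lt_min hb hβ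
  have ht : 0 < t := half_pos hm
  have htm : t < min b β := half_lt_self hm
  refine ⟨β, hβ, fun z hz => ?_⟩
  refine (hξ.mono (truncSector_mono (min_le_left _ _))).eqOn_of_preconnected_of_frequently_eq
    ((hμ.mono (truncSector_mono ((min_le_right _ _).trans (min_le_left _ _)))).add
      (hν.mono (truncSector_mono ((min_le_right _ _).trans (min_le_right _ _)))))
    (isPreconnected_truncSector hα.2.le hβ)
    (neg_mem_truncSector hα.1 ht (htm.trans_le (min_le_right _ _))) ?_ hz
  have hlim : Tendsto (fun y : ℝ => -(y : ℂ)) (𝓝[≠] t) (𝓝[≠] (-(t : ℂ))) := by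
    refine tendsto_nhdsWithin_iff.2 ⟨?_, ?_⟩
    · exact (Complex.continuous_ofReal.neg.tendsto t).mono_left nhdsWithin_le_nhds
    · filter_upwards [self_mem_nhdsWithin] with y hy h
      exact hy (by simpa using h)
  refine hlim.frequently (Eventually.frequently ?_)
  filter_upwards [nhdsWithin_le_nhds (Ioo_mem_nhds ht (htm.trans_le (min_le_left _ _)))] with y hy
  exact hev hy

end RectConv

theorem mainTheorem6 (lam : ℝ) (hlam : lam ∈ Set.Icc (0 : ℝ) 1) :
    (∃! op : SymmProb → SymmProb → SymmProb, IsContinuousExtension lam op) ∧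
    (∀ μ : SymmProb, IsSectorialInverse (rectCauchy lam μ) (rectCauchyInv lam μ)) ∧
    (∀ op : SymmProb → SymmProb → SymmProb, IsContinuousExtension lam op →
      ∀ μ ν : SymmProb,
        SectorialEq (rectRTransform lam (op μ ν))
          (fun z => rectRTransform lam μ z + rectRTransform lam ν z)) :=
  ⟨RectConv.existsUnique_isContinuousExtension hlam.1 hlam.2,
    fun μ => RectConv.isSectorialInverse_rectCauchyInv lam μ,
    fun _ hop μ ν => RectConv.sectorialEq_rectRTransform hlam.1 hlam.2
      (RectConv.rectAdd_of_isContinuousExtension hlam.1 hlam.2 hop μ ν)⟩
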